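/- Let $\omega=e^{2\pi i/3}$, $J=\mathrm{diag}(\omega,\omega^2,1)$ and $$\mathcal A=\begin{pmatrix}0&0&1\\1&0&0\\0&1&0\end{pmatrix},\qquad \mathcal B=\begin{pmatrix}0&1&0\\1&0&0\\0&0&1\end{pmatrix}.$$ For $s_1,s_3\in\mathbb C$ put $s_2=-\overline{s_1}$, $s_4=-\overline{s_3}$ and $$S_1=\begin{pmatrix}1&0&0\\s_1&1&s_3\\0&0&1\end{pmatrix},\ S_2=\begin{pmatrix}1&0&0\\0&1&0\\s_2&s_4&1\end{pmatrix},\ S_3=\begin{pmatrix}1&s_3&s_1\\0&1&0\\0&0&1\end{pmatrix},$$ $$S_4=\begin{pmatrix}1&0&0\\s_4&1&s_2\\0&0&1\end{pmatrix},\ S_5=\begin{pmatrix}1&0&0\\0&1&0\\s_3&s_1&1\end{pmatrix},\ S_6=\begin{pmatrix}1&s_2&s_4\\0&1&0\\0&0&1\end{pmatrix}.$$ Assume that $S_1S_2S_3S_4S_5S_6=I$. Let $\Sigma=\Sigma_1\cup\dots\cup\Sigma_6$, where $\Sigma_j$ is the ray from $0$ at angle $\frac{\pi}{6}+(j-1)\frac{\pi}{3}$,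 oriented outwards, and for $y\in\mathbb R$ and $\lambda\in\Sigma_j\setminus\{0\}$ let $$v^p(y;\lambda)=e^{X}S_je^{-X},\qquad X=3y\lambda J+\tfrac{27}{4}\lambda^2J^2 .$$ For given $y\in\mathbb R$, the model Riemann–Hilbert problem asks for a $3\times3$ matrix-valued function $m^p(y;\lambda)$ such that 1. $m^p(y;\cdot)$ is analytic in $\mathbb C\setminus\Sigma$; 2. at each point of $\Sigma\setminus\{0\}$ the limits $m^p_+$ from the left and $m^p_-$ from the right exist, and $m^p_+=m^p_-v^p$; 3. $m^p(y;\lambda)=I+\mathcal O(1/\lambda)$ as $\lambda\to\infty$, and $m^p(y;\lambda)$ is bounded as $\lambda\to0$, $\lambda\notin\Sigma$; 4. $\mathcal A\,m^p(y;\omega\lambda)\,\mathcal A^{-1}=m^p(y;\lambda)=\mathcal B\,\overline{m^p(y;\overline\lambda)}\,\mathcal B$ for $\lambda\in\mathbb C\setminus\Sigma$. Let $Y\subseteq\mathbb R$ be open and let $m^p(y;\cdot)$ be a solution of this problem for every $y\in Y$. Then there are matrices $m^p_j(y)$, $j\ge1$, $y\in Y$, such that for every $y\in Y$ and every integer $N\ge1$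 $$m^p(y;\lambda)=I+\sum_{j=1}^N\frac{m^p_j(y)}{\lambda^j}+\mathcal O\Big(\frac1{\lambda^{N+1}}\Big),\qquad \lambda\to\infty,\ \lambda\notin\Sigma .$$ Moreover, for $y\in Y$, $$m^p_1=\begin{pmatrix}\omega^2\varphi_3&\omega^2\varphi_1&\omega^2\varphi_2\\ \omega\varphi_2&\omega\varphi_3&\omega\varphi_1\\ \varphi_1&\varphi_2&\varphi_3\end{pmatrix},\qquad \varphi_1=\overline{\varphi_2},\quad \varphi_3=\overline{\varphi_3},$$ and there is a twice continuously differentiable function $P:Y\to\mathbb R$ with $$\operatorname{Im}\varphi_2(y)=-\frac{P(y)+\frac{2y}{3}}{6\sqrt3},\qquad 18\,P(y)\operatorname{Re}\varphi_2(y)=-\Big(P'(y)+\frac23\Big)\qquad(y\in Y),$$ which solves the Painlevé IV equation $$P''=\frac{(P')^2}{2P}+\frac32P^3+4yP^2+(2y^2-4\alpha+\beta)P-\frac{\beta^2}{2P},\qquad \alpha=-\frac16,\ \beta=-\frac23,$$ at every $y\in Y$ with $P(y)\ne0$; at the zeros of $P$ one has $(P')^2=\beta^2$ (the equation multiplied by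 $2P$). -/

import Mathlib

open Filter Topology Asymptotics Bornology

namespace PIVModel

/-- The primitive cube root of unity `ω = e^{2πi/3}`. -/
noncomputable def omega : ℂ := Complex.exp (2 * Real.pi * Complex.I / 3)

/-- The diagonal of `J = diag(ω, ω², 1)`. -/
noncomputable def J : Fin 3 → ℂ := ![omega, omega ^ 2, 1]

/-- The permutation matrix `𝒜` of the `ℤ₃` symmetry. -/
def matA : Matrix (Fin 3) (Fin 3) ℂ := !![0, 0, 1; 1, 0, 0; 0, 1, 0]

/-- The permutation matrix `ℬ` of the `ℤ₂` symmetry. -/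
def matB : Matrix (Fin 3) (Fin 3) ℂ := !![0, 1, 0; 1, 0, 0; 0, 0, 1]

/-- The diagonal entries of `3 y z J + (27/4) z² J²`. -/
noncomputable def phase (y : ℝ) (z : ℂ) (i : Fin 3) : ℂ :=
  3 * y * z * J i + 27 / 4 * z ^ 2 * J i ^ 2

/-- The six constant matrices (Stokes matrices) that are conjugated by the exponentials in the
jump matrices.  The rays and the matrices are numbered from `0` to `5` here, where the usual
numbering is from `1` to `6`.  The remaining parameters are `s₂ = -conj s₁`, `s₄ = -conj s₃`. -/
noncomputable def stokes (s₁ s₃ : ℂ) : Fin 6 → Matrix (Fin 3) (Fin 3) ℂ :=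
  let s₂ : ℂ := -(starRingEnd ℂ) s₁
  let s₄ : ℂ := -(starRingEnd ℂ) s₃
  ![!![1, 0, 0; s₁, 1, s₃; 0, 0, 1],
    !![1, 0, 0; 0, 1, 0; s₂, s₄, 1],
    !![1, s₃, s₁; 0, 1, 0; 0, 0, 1],
    !![1, 0, 0; s₄, 1, s₂; 0, 0, 1],
    !![1, 0, 0; 0, 1, 0; s₃, s₁, 1],
    !![1, s₂, s₄; 0, 1, 0; 0, 0, 1]]

/-- The jump matrix `e^{X} S e^{-X}` on the ray number `j`, where `X = 3 y z J + (27/4) z² J²`. -/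
noncomputable def jump (s₁ s₃ : ℂ) (j : Fin 6) (y : ℝ) (z : ℂ) : Matrix (Fin 3) (Fin 3) ℂ :=
  Matrix.diagonal (fun i => Complex.exp (phase y z i)) * stokes s₁ s₃ j *
    Matrix.diagonal (fun i => Complex.exp (-phase y z i))

/-- The unit vector along the ray number `j`; the angles are `π/6 + j π/3`, `j = 0, …, 5`. -/
noncomputable def dir (j : Fin 6) : ℂ :=
  Complex.exp ((Real.pi / 6 + (j : ℕ) * (Real.pi / 3)) * Complex.I)

/-- The contour: the union of the six closed rays from the origin. -/
def contour : Set ℂ := {z | ∃ j : Fin 6, ∃ r : ℝ, 0 ≤ r ∧ z = r * dir j}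

/-- The open half plane to the left of the ray number `j`, which is oriented outwards.  Close to a
point of the ray other than the origin it coincides with the adjacent sector on the left. -/
def leftSide (j : Fin 6) : Set ℂ := {z | 0 < (z * (starRingEnd ℂ) (dir j)).im}

/-- The open half plane to the right of the ray number `j`, which is oriented outwards. -/
def rightSide (j : Fin 6) : Set ℂ := {z | (z * (starRingEnd ℂ) (dir j)).im < 0}

/-- `m` solves the `3 × 3` model Riemann–Hilbert problem with Stokes parameters `s₁`, `s₃` at the
real parameter `y`.  (The values of `m` on the contour are irrelevant.) -/
structure IsSolution (s₁ s₃ : ℂ) (y : ℝ) (m : ℂ → Matrix (Fin 3) (Fin 3) ℂ) : Prop where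
  /-- `m` is analytic off the contour. -/
  analytic : ∀ i k, DifferentiableOn ℂ (fun z => m z i k) contourᶜ
  /-- At every point of the contour other than the origin the limits `m₊` from the left and `m₋`
  from the right exist, and `m₊ = m₋ v`. -/
  jump_rel : ∀ j : Fin 6, ∀ r : ℝ, 0 < r → ∃ mp mm : Matrix (Fin 3) (Fin 3) ℂ,
    Tendsto m (𝓝[leftSide j] (r * dir j)) (𝓝 mp) ∧
    Tendsto m (𝓝[rightSide j] (r * dir j)) (𝓝 mm) ∧
    mp = mm * jump s₁ s₃ j y (r * dir j)
  /-- `m = I + O(1/z)` as `z → ∞` off the contour. -/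
  at_infty : ∀ i k, (fun z => (m z - 1) i k) =O[cobounded ℂ ⊓ 𝓟 contourᶜ] (fun z => z⁻¹)
  /-- `m` is bounded as `z → 0` off the contour. -/
  at_zero : ∀ i k, (fun z => m z i k) =O[𝓝 0 ⊓ 𝓟 contourᶜ] (fun _ => (1 : ℂ))
  /-- The `ℤ₃` symmetry. -/
  symm_three : ∀ z ∈ contourᶜ, matA * m (omega * z) * matA⁻¹ = m z
  /-- The `ℤ₂` symmetry. -/
  symm_two : ∀ z ∈ contourᶜ,
    m z = matB * (m ((starRingEnd ℂ) z)).map (starRingEnd ℂ) * matB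

/-- `P` is a real solution on the open set `Y` of the Painlevé IV equation
`P'' = P'² / (2P) + (3/2) P³ + 4 y P² + (2y² - 4α + β) P - β² / (2P)`.
Zeros of `P` are allowed: there the equation is read after multiplication by `2P`, so that it says
`P'² = β²`. -/
structure SolvesPIV (α β : ℝ) (Y : Set ℝ) (P : ℝ → ℝ) : Prop where
  contDiffOn : ContDiffOn ℝ 2 P Y
  equation : ∀ y ∈ Y, P y ≠ 0 →
    deriv (deriv P) y = 1 / (2 * P y) * deriv P y ^ 2 + 3 / 2 * P y ^ 3 + 4 * y * P y ^ 2
      + (2 * y ^ 2 - 4 * α + β) * P y - β ^ 2 / (2 * P y)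
  at_zeros : ∀ y ∈ Y, P y = 0 → deriv P y ^ 2 = β ^ 2

end PIVModel

/-!
Write `X = 3 y z J + (27/4) z² J²`. The proof recovers the Lax pair of the Painlevé IV equation from
the Riemann–Hilbert problem, and reads the equation off from the first two coefficients
`a = m₁` and `b = m₂` of the solution at infinity.

*Entire functions in the sectors.* The jump matrices are constant after conjugation by `e^X`, and
the product of the Stokes matrices is `I`. If `Q_k` are their partial products, then the functions
`m e^X Q_k⁻¹` of the six sectors fit together continuously across the rays and are bounded at the
origin, so they are one entire function (`exists_entire_extension`, `IsSolution.exists_entire`).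
Hence `m` continues from the sector `k` to an entire function `M k` of determinant `1`, with
`M k = M (k - 1) v_k` on all of `ℂ` (`IsSolution.exists_pieces`).

*Expansion at infinity.* The matrix `v_k - I` decays like a Gaussian in a wedge about the ray `k`
(`norm_jumpSubOne_le`). Cauchy's formula writes the functions as an integral of their jumps over
the rays (`cauchy_representation`). The rays may be rotated a little, so that the point under
consideration keeps away from them; expanding the kernel gives the asymptotic series up to the
boundary of the sectors, with constants that are moments of the bound for the jumps
(`SectorialFamily.norm_sub_expansion_le`).

*Dependence on `y`.* No regularity in `y` is assumed. The jumps of `m(y) m(y₀)⁻¹` are of size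
`|y - y₀|` times a bound for `m(y)`, so `m(y)` is bounded uniformly for `y` near `y₀`
(`SolutionPieces.exists_uniform_bound`), and so are the constants in its expansion. The function
`m(y) e^{3 (y - y₀) z J} m(y₀)⁻¹` has no jumps. Comparing it with its expansion on the circle of
radius `1 / |y - y₀|`, by Cauchy's estimates at the origin, yields
`a' = 3 [J, b] + 3 [a, J] a` (`SolutionPieces.exists_coef_expansion`, `hasDerivAt_coef_one`).

*Dependence on `z`.* The function `(∂m/∂z + m ∂X/∂z) m⁻¹` has no jumps either and differs from
`∂X/∂z` by a bounded function, hence by a constant (`SolutionPieces.lax_equation`). The order `z⁻¹`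
of the resulting differential equation expresses the off-diagonal part of `b` by `a`
(`SolutionPieces.coef_relation`).

*The Painlevé equation.* The symmetries reduce `a` to `φ₂` and a real number `φ₃`
(`eq_of_symmetries`), and the evolution of the entry `φ₂` becomes
`φ₂' = 9 (conj φ₂)² - (2/3) √3 i y φ₂` (`evolution_entry`). In terms of
`P = -6 √3 Im φ₂ - 2y/3` this system of two real equations is the Painlevé IV equation
(`solvesPIV_of_system`).
-/

namespace PIVModel

/-! ### Geometry of the rays and sectors -/

/-- The angle of the ray number `k`. -/
noncomputable def ang (k : Fin 6) : ℝ := Real.pi / 6 + (k : ℕ) * (Real.pi / 3)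

/-- The point at distance `r` from the origin whose angle exceeds that of the ray number `k`
by `t`.  The closed sector between the rays `k` and `k + 1` is given by `0 ≤ t ≤ π / 3`. -/
noncomputable def pt (k : Fin 6) (r t : ℝ) : ℂ := r * (dir k * Complex.exp (t * Complex.I))

lemma dir_eq (k : Fin 6) : dir k = Complex.exp (ang k * Complex.I) := by
  simp [dir, ang]

lemma pt_eq (k : Fin 6) (r t : ℝ) : pt k r t = r * Complex.exp ((ang k + t : ℝ) * Complex.I) := by
  rw [pt, dir_eq, ← Complex.exp_add]; push_cast; ring_nf

lemma norm_dir (k : Fin 6) : ‖dir k‖ = 1 := by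
  rw [dir_eq, Complex.norm_exp_ofReal_mul_I]

lemma dir_ne_zero (k : Fin 6) : dir k ≠ 0 := by
  rw [dir_eq]; exact Complex.exp_ne_zero _

lemma norm_pt (k : Fin 6) (r t : ℝ) : ‖pt k r t‖ = |r| := by
  rw [pt_eq]; simp [Complex.norm_exp_ofReal_mul_I, -Complex.ofReal_add]

lemma norm_pt_of_pos (k : Fin 6) {r : ℝ} (hr : 0 < r) (t : ℝ) : ‖pt k r t‖ = r := by
  rw [norm_pt, abs_of_pos hr]

lemma pt_ne_zero (k : Fin 6) {r : ℝ} (hr : 0 < r) (t : ℝ) : pt k r t ≠ 0 := by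
  rw [← norm_pos_iff, norm_pt_of_pos k hr]; exact hr

lemma pt_eq_mul (k : Fin 6) (r t : ℝ) : pt k r t = r * pt k 1 t := by
  simp [pt]

lemma pt_zero_right (k : Fin 6) (r : ℝ) : pt k r 0 = r * dir k := by
  simp [pt]

lemma continuous_pt (k : Fin 6) : Continuous fun p : ℝ × ℝ => pt k p.1 p.2 := by
  unfold pt; fun_prop

lemma exp_int_mul_pi_div_three_mod (a b : ℤ) (h : (6 : ℤ) ∣ a - b) :
    Complex.exp ((Real.pi / 6 + a * (Real.pi / 3)) * Complex.I) =
      Complex.exp ((Real.pi / 6 + b * (Real.pi / 3)) * Complex.I) := by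
  obtain ⟨n, hn⟩ := h
  rw [Complex.exp_eq_exp_iff_exists_int]
  refine ⟨n, ?_⟩
  have : (a : ℂ) = b + 6 * n := by
    have : a = b + 6 * n := by linarith
    rw [this]; push_cast; ring
  rw [this]; ring

lemma dir_eq_exp_int (k : Fin 6) (a : ℤ) (h : (6 : ℤ) ∣ a - (k : ℕ)) :
    dir k = Complex.exp ((Real.pi / 6 + a * (Real.pi / 3)) * Complex.I) := by
  rw [exp_int_mul_pi_div_three_mod _ _ h, dir]; simp

/-- The left edge of the sector number `k - 1` is the ray number `k`. -/
lemma pt_sub_one (k : Fin 6) (r t : ℝ) : pt (k - 1) r (t + Real.pi / 3) = pt k r t := by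
  have : dir k = dir (k - 1) * Complex.exp ((Real.pi / 3 : ℝ) * Complex.I) := by
    rw [dir_eq_exp_int (k - 1) ((k : ℕ) - 1 : ℤ) (by revert k; decide), ← Complex.exp_add, dir]
    congr 1; push_cast; ring
  rw [pt, pt, this]
  have h2 : Complex.exp ((t + Real.pi / 3 : ℝ) * Complex.I) =
    Complex.exp ((Real.pi / 3 : ℝ) * Complex.I) * Complex.exp (t * Complex.I) := by
    rw [← Complex.exp_add]; push_cast; ring_nf
  rw [h2]; ring

lemma pt_add_one (k : Fin 6) (r t : ℝ) : pt (k + 1) r t = pt k r (t + Real.pi / 3) := by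
  rw [← pt_sub_one (k + 1)]; simp

lemma pt_injective {k k' : Fin 6} {r r' t t' : ℝ} (hr : 0 < r) (hr' : 0 < r')
    (ht : |t - t'| < Real.pi / 3) (h : pt k r t = pt k' r' t') : k = k' ∧ r = r' ∧ t = t' := by
  have hrr : r = r' := by
    rw [← norm_pt_of_pos k hr t, h, norm_pt_of_pos k' hr' t']
  subst hrr
  rw [pt_eq, pt_eq] at h
  have h1 := mul_left_cancel₀ (by exact_mod_cast hr.ne') h
  rw [Complex.exp_eq_exp_iff_exists_int] at h1
  obtain ⟨n, hn⟩ := h1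
  have h2 : ang k + t = ang k' + t' + n * (2 * Real.pi) := by
    have h3 : ((ang k + t : ℝ) : ℂ) * Complex.I =
        ((ang k' + t' + n * (2 * Real.pi) : ℝ) : ℂ) * Complex.I := by
      rw [hn]; push_cast; ring
    exact_mod_cast mul_right_cancel₀ Complex.I_ne_zero h3
  unfold ang at h2
  have hpi := Real.pi_pos
  set d : ℤ := (k : ℕ) - (k' : ℕ) - 6 * n with hd
  have h3 : (d : ℝ) * (Real.pi / 3) = t' - t := by
    rw [hd]; push_cast; linarith
  have h4 : |(d : ℝ)| < 1 := by
    have : |(d : ℝ)| * (Real.pi / 3) < 1 * (Real.pi / 3) := by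
      rw [one_mul, ← abs_of_pos (show 0 < Real.pi / 3 by positivity), ← abs_mul, h3, abs_sub_comm,
        abs_of_pos (show 0 < Real.pi / 3 by positivity)]
      exact ht
    exact lt_of_mul_lt_mul_right this (by positivity)
  have h5 : d = 0 := by
    rw [← Int.abs_lt_one_iff]; exact_mod_cast h4
  refine ⟨?_, rfl, ?_⟩
  · apply Fin.ext; omega
  · rw [h5] at h3; simp at h3; linarith

/-- Every point other than the origin lies in one of the half-open sectors. -/
lemma exists_pt {z : ℂ} (hz : z ≠ 0) :
    ∃ k r t, 0 < r ∧ 0 ≤ t ∧ t < Real.pi / 3 ∧ z = pt k r t := by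
  have hpi := Real.pi_pos
  set q : ℤ := ⌊(z.arg - Real.pi / 6) / (Real.pi / 3)⌋ with hq
  have h1 := Int.floor_le ((z.arg - Real.pi / 6) / (Real.pi / 3))
  have h2 := Int.lt_floor_add_one ((z.arg - Real.pi / 6) / (Real.pi / 3))
  rw [← hq, le_div_iff₀ (by positivity)] at h1
  rw [← hq, div_lt_iff₀ (by positivity)] at h2
  refine ⟨⟨(q % 6).toNat, by omega⟩, ‖z‖, z.arg - Real.pi / 6 - q * (Real.pi / 3),
    norm_pos_iff.2 hz, by linarith, by linarith, ?_⟩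
  rw [pt, dir_eq_exp_int _ q (by simp; omega), ← Complex.exp_add]
  conv_lhs => rw [← Complex.norm_mul_exp_arg_mul_I z]
  congr 2; push_cast; ring

lemma sin_le_abs_sin {x δ : ℝ} (hδ : 0 ≤ δ) (h1 : δ ≤ x) (h2 : x ≤ Real.pi / 3 - δ) (j : ℤ) :
    Real.sin δ ≤ |Real.sin (x + j * (Real.pi / 3))| := by
  have hpi := Real.pi_pos
  have key : ∀ y, δ ≤ y → y ≤ Real.pi - δ → Real.sin δ ≤ Real.sin y := by
    intro y hy1 hy2
    rcases le_total y (Real.pi / 2) with h | h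
    · exact Real.sin_le_sin_of_le_of_le_pi_div_two (by linarith) h hy1
    · rw [← Real.sin_pi_sub y]
      exact Real.sin_le_sin_of_le_of_le_pi_div_two (by linarith) (by linarith) (by linarith)
  obtain ⟨q, i, hi, hj⟩ : ∃ q i : ℤ, (0 ≤ i ∧ i ≤ 2) ∧ j = i + q * 3 :=
    ⟨j / 3, j % 3, by omega, by omega⟩
  have e : x + j * (Real.pi / 3) = (x + i * (Real.pi / 3)) + q * Real.pi := by
    rw [hj]; push_cast; ring
  have hi0 : (0 : ℝ) ≤ i := by exact_mod_cast hi.1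
  have hi2 : (i : ℝ) ≤ 2 := by exact_mod_cast hi.2
  rw [e, Real.sin_add_int_mul_pi, abs_mul]
  have : |((-1 : ℝ)) ^ q| = 1 := by simp [abs_zpow]
  rw [this, one_mul]
  refine (key _ ?_ ?_).trans (le_abs_self _)
  · nlinarith
  · nlinarith

/-- A point whose angle is at least `δ` away from the angles of all rays of the rotated contour
has a distance from them that is comparable with the distances from the origin. -/
lemma le_norm_sub_pt {k k₀ : Fin 6} {r ρ t α δ : ℝ} (hr : 0 < r) (hρ : 0 < ρ) (hδ : 0 ≤ δ)
    (h1 : δ ≤ t - α) (h2 : t - α ≤ Real.pi / 3 - δ) :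
    Real.sin δ * r ≤ ‖pt k r α - pt k₀ ρ t‖ ∧ Real.sin δ * ρ ≤ ‖pt k r α - pt k₀ ρ t‖ := by
  set τ : ℝ := (t - α) + (((k₀ : ℕ) : ℤ) - ((k : ℕ) : ℤ) : ℤ) * (Real.pi / 3) with hτ
  have hs : Real.sin δ ≤ |Real.sin τ| := sin_le_abs_sin hδ h1 h2 _
  have e1 : ang k₀ + t = (ang k + α) + τ := by
    rw [hτ]; unfold ang; push_cast; ring
  have e2 : pt k r α - pt k₀ ρ t =
      Complex.exp ((ang k + α : ℝ) * Complex.I) * (r - ρ * Complex.exp (τ * Complex.I)) := by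
    rw [pt_eq, pt_eq, e1, mul_sub]
    have : Complex.exp ((ang k + α + τ : ℝ) * Complex.I) =
      Complex.exp ((ang k + α : ℝ) * Complex.I) * Complex.exp (τ * Complex.I) := by
      rw [← Complex.exp_add]; push_cast; ring_nf
    rw [this]; ring
  have e3 : pt k r α - pt k₀ ρ t =
      Complex.exp ((ang k₀ + t : ℝ) * Complex.I) * (r * Complex.exp ((-τ : ℝ) * Complex.I) - ρ) := by
    rw [pt_eq, pt_eq, e1, mul_sub]
    have : Complex.exp ((ang k + α : ℝ) * Complex.I) =
      Complex.exp ((ang k + α + τ : ℝ) * Complex.I) * Complex.exp ((-τ : ℝ) * Complex.I) := by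
      rw [← Complex.exp_add]; push_cast; ring_nf
    rw [this]; ring
  constructor
  · rw [e3, norm_mul, Complex.norm_exp_ofReal_mul_I, one_mul]
    refine le_trans ?_ (Complex.abs_im_le_norm _)
    have : (r * Complex.exp ((-τ : ℝ) * Complex.I) - ρ : ℂ).im = - (r * Real.sin τ) := by
      rw [Complex.sub_im, Complex.im_ofReal_mul, Complex.exp_ofReal_mul_I_im]
      simp
    rw [this, abs_neg, abs_mul, abs_of_pos hr]
    nlinarith
  · rw [e2, norm_mul, Complex.norm_exp_ofReal_mul_I, one_mul]
    refine le_trans ?_ (Complex.abs_im_le_norm _)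
    have : (r - ρ * Complex.exp (τ * Complex.I) : ℂ).im = - (ρ * Real.sin τ) := by
      rw [Complex.sub_im, Complex.im_ofReal_mul, Complex.exp_ofReal_mul_I_im]
      simp
    rw [this, abs_neg, abs_mul, abs_of_pos hρ]
    nlinarith


/-! ### Cauchy's formula for sectorially holomorphic functions -/

section Cauchy

open MeasureTheory Set

variable {E : Type*} [NormedAddCommGroup E] [NormedSpace ℂ E]

/-- Cauchy's theorem for the part `ε ≤ |z| ≤ ρ` of a closed sector of opening `π / 3`, which is the
image of a rectangle under the exponential function. -/
lemma integral_boundary_sector_eq_zero [CompleteSpace E] {H : ℂ → E} {k : Fin 6} {α ε ρ : ℝ}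
    (hε : 0 < ε) (hερ : ε ≤ ρ)
    (hH : ∀ r t, ε ≤ r → r ≤ ρ → α ≤ t → t ≤ α + Real.pi / 3 → DifferentiableAt ℂ H (pt k r t)) :
    (∫ r in ε..ρ, pt k 1 α • H (pt k r α)) -
      (∫ r in ε..ρ, pt (k + 1) 1 α • H (pt (k + 1) r α)) +
      ((∫ t in α..α + Real.pi / 3, (Complex.I * pt k ρ t) • H (pt k ρ t)) -
        ∫ t in α..α + Real.pi / 3, (Complex.I * pt k ε t) • H (pt k ε t)) = 0 := by
  have hpi := Real.pi_pos
  have hρ : 0 < ρ := hε.trans_le hερ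
  have hlog : Real.log ε ≤ Real.log ρ := Real.log_le_log hε hερ
  have hpt : ∀ x t : ℝ, dir k * Complex.exp (x + t * Complex.I) = pt k (Real.exp x) t := by
    intro x t
    rw [pt, Complex.exp_add]; push_cast; ring
  set F : ℂ → E := fun w => (dir k * Complex.exp w) • H (dir k * Complex.exp w) with hF
  have hFpt : ∀ x t : ℝ, F (x + t * Complex.I) = pt k (Real.exp x) t • H (pt k (Real.exp x) t) := by
    intro x t; simp only [hF]; rw [hpt]
  have hrect := Complex.integral_boundary_rect_eq_zero_of_differentiableOn F
    ⟨Real.log ε, α⟩ ⟨Real.log ρ, α + Real.pi / 3⟩ (by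
      rintro w ⟨hw1, hw2⟩
      simp only [mem_preimage] at hw1 hw2
      rw [uIcc_of_le hlog] at hw1
      rw [uIcc_of_le (by linarith)] at hw2
      have hw : dir k * Complex.exp w = pt k (Real.exp w.re) w.im := by
        rw [← hpt, Complex.re_add_im]
      have h1 : DifferentiableAt ℂ H (dir k * Complex.exp w) := by
        rw [hw]
        refine hH _ _ ?_ ?_ hw2.1 hw2.2
        · rw [← Real.exp_log hε]; exact Real.exp_le_exp.2 hw1.1
        · rw [← Real.exp_log hρ]; exact Real.exp_le_exp.2 hw1.2
      have h2 : DifferentiableAt ℂ (fun w => dir k * Complex.exp w) w := by fun_prop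
      exact (h2.smul (DifferentiableAt.comp (𝕜 := ℂ) (g := H) w h1 h2)).differentiableWithinAt)
  simp only [hFpt, Real.exp_log hε, Real.exp_log hρ] at hrect
  have hsub : ∀ t, α ≤ t → t ≤ α + Real.pi / 3 →
      (∫ x in Real.log ε..Real.log ρ, pt k (Real.exp x) t • H (pt k (Real.exp x) t)) =
        ∫ r in ε..ρ, pt k 1 t • H (pt k r t) := by
    intro t ht1 ht2
    have := intervalIntegral.integral_deriv_smul_comp'' (a := Real.log ε) (b := Real.log ρ)
      (f := Real.exp) (f' := Real.exp) (g := fun r => pt k 1 t • H (pt k r t))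
      Real.continuous_exp.continuousOn (fun x _ => (Real.hasDerivAt_exp x).hasDerivWithinAt)
      Real.continuous_exp.continuousOn (by
        rintro _ ⟨x, hx, rfl⟩
        rw [uIcc_of_le hlog] at hx
        refine ContinuousAt.continuousWithinAt (continuousAt_const.smul ?_)
        refine ContinuousAt.comp (g := H) (hH _ _ ?_ ?_ ht1 ht2).continuousAt ?_
        · rw [← Real.exp_log hε]; exact Real.exp_le_exp.2 hx.1
        · rw [← Real.exp_log hρ]; exact Real.exp_le_exp.2 hx.2
        · exact ((continuous_pt k).comp (continuous_id.prodMk continuous_const)).continuousAt)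
    rw [Real.exp_log hε, Real.exp_log hρ] at this
    rw [← this]
    refine intervalIntegral.integral_congr fun x _ => ?_
    simp only [Function.comp]
    rw [pt_eq_mul k (Real.exp x), ← Complex.coe_smul, smul_smul]
  rw [hsub α le_rfl (by linarith), hsub _ (by linarith) le_rfl] at hrect
  simp only [pt_add_one]
  rw [← hrect]
  simp only [mul_smul, intervalIntegral.integral_smul]
  abel

lemma tendsto_intervalIntegral_Ioi_zero {g : ℝ → E} (hg : IntegrableOn g (Ioi 0)) :
    Tendsto (fun x : ℝ => ∫ r in x⁻¹..x, g r) atTop (𝓝 (∫ r in Ioi 0, g r)) := by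
  have hc : AECover (volume.restrict (Ioi (0 : ℝ))) atTop fun x : ℝ => Ioi x⁻¹ ∩ Iic x :=
    (aecover_Ioi_of_Ioi tendsto_inv_atTop_zero).inter (aecover_Iic tendsto_id)
  refine (hc.integral_tendsto_of_countably_generated hg).congr' ?_
  filter_upwards [eventually_ge_atTop 1] with x hx
  have hx0 : 0 < x := by linarith
  have h1 : x⁻¹ ≤ x := (inv_le_one_of_one_le₀ hx).trans hx
  rw [intervalIntegral.integral_of_le h1, Ioi_inter_Iic, Measure.restrict_restrict measurableSet_Ioc,
    inter_eq_left.2 fun y hy => ?_]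
  exact lt_trans (inv_pos.2 hx0) hy.1

/-- The arcs of large radius contribute the value at infinity. -/
lemma tendsto_integral_outer_arc [CompleteSpace E] {f : ℂ → E} {a b : E} {lam : ℂ} {k : Fin 6} {α : ℝ}
    (hinf : ∀ e > 0, ∃ R, ∀ r ≥ R, ∀ t ∈ Icc α (α + Real.pi / 3), ‖f (pt k r t) - a‖ ≤ e)
    (hf : Continuous f) :
    Tendsto (fun ρ : ℝ => ∫ t in α..α + Real.pi / 3,
      (Complex.I * pt k ρ t) • ((pt k ρ t - lam)⁻¹ • (f (pt k ρ t) - b))) atTop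
      (𝓝 ((Real.pi / 3 : ℝ) • (Complex.I • (a - b)))) := by
  have hpi := Real.pi_pos
  rw [Metric.tendsto_atTop]
  intro e he
  set e' : ℝ := e / (4 * Real.pi) with he'
  have he'0 : 0 < e' := by positivity
  obtain ⟨R, hR⟩ := hinf e' he'0
  refine ⟨max R (max (2 * ‖lam‖ + 1) (2 * ‖lam‖ * ‖a - b‖ / e')), fun ρ hρ => ?_⟩
  have h1 : R ≤ ρ := (le_max_left _ _).trans hρ
  have h2 : 2 * ‖lam‖ + 1 ≤ ρ := (le_max_left _ _).trans ((le_max_right _ _).trans hρ)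
  have h3 : 2 * ‖lam‖ * ‖a - b‖ / e' ≤ ρ := (le_max_right _ _).trans ((le_max_right _ _).trans hρ)
  have hl := norm_nonneg lam
  have hρ0 : 0 < ρ := by linarith
  have hconst : (Real.pi / 3 : ℝ) • (Complex.I • (a - b)) =
      ∫ t in α..α + Real.pi / 3, Complex.I • (a - b) := by
    rw [intervalIntegral.integral_const]; congr 1; ring
  have hsep : ∀ t, ρ / 2 ≤ ‖pt k ρ t - lam‖ := by
    intro t
    have := norm_sub_norm_le (pt k ρ t) lam
    rw [norm_pt_of_pos k hρ0] at this
    linarith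
  have hne : ∀ t, pt k ρ t - lam ≠ 0 := fun t => by
    rw [← norm_pos_iff]; exact lt_of_lt_of_le (by positivity) (hsep t)
  have hcpt : Continuous fun t => pt k ρ t :=
    (continuous_pt k).comp (continuous_const.prodMk continuous_id)
  have hcont : Continuous fun t =>
      (Complex.I * pt k ρ t) • ((pt k ρ t - lam)⁻¹ • (f (pt k ρ t) - b)) := by
    refine (continuous_const.mul hcpt).smul (Continuous.smul ?_ ?_)
    · exact (hcpt.sub continuous_const).inv₀ hne
    · exact (hf.comp hcpt).sub continuous_const
  rw [dist_eq_norm, hconst, ← intervalIntegral.integral_sub (hcont.intervalIntegrable _ _)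
    (continuous_const.intervalIntegrable _ _)]
  have hbound := intervalIntegral.norm_integral_le_of_norm_le_const (a := α)
    (b := α + Real.pi / 3) (C := 3 * e') (f := fun t =>
      (Complex.I * pt k ρ t) • ((pt k ρ t - lam)⁻¹ • (f (pt k ρ t) - b)) - Complex.I • (a - b)) (by
      intro t ht
      rw [uIoc_of_le (by linarith)] at ht
      have e1 : (Complex.I * pt k ρ t) • ((pt k ρ t - lam)⁻¹ • (f (pt k ρ t) - b)) -
          Complex.I • (a - b) =
          (Complex.I * (pt k ρ t * (pt k ρ t - lam)⁻¹)) • (f (pt k ρ t) - a) +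
          (Complex.I * (lam * (pt k ρ t - lam)⁻¹)) • (a - b) := by
        have h0 : pt k ρ t * (pt k ρ t - lam)⁻¹ = 1 + lam * (pt k ρ t - lam)⁻¹ := by
          field_simp [hne t]; ring
        rw [smul_smul, mul_assoc, h0]
        module
      have hinv : ‖(pt k ρ t - lam)⁻¹‖ ≤ 2 / ρ := by
        rw [norm_inv, ← inv_div]
        exact inv_anti₀ (by positivity) (hsep t)
      rw [e1]
      refine (norm_add_le _ _).trans ?_
      rw [norm_smul, norm_smul, norm_mul, norm_mul, norm_mul, norm_mul, Complex.norm_I, one_mul,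
        one_mul, norm_pt_of_pos k hρ0]
      have hA : ρ * ‖(pt k ρ t - lam)⁻¹‖ ≤ 2 := by
        calc _ ≤ ρ * (2 / ρ) := by gcongr
          _ = 2 := by field_simp
      have hB : ‖lam‖ * ‖(pt k ρ t - lam)⁻¹‖ * ‖a - b‖ ≤ e' := by
        calc _ ≤ ‖lam‖ * (2 / ρ) * ‖a - b‖ := by gcongr
          _ = 2 * ‖lam‖ * ‖a - b‖ / ρ := by ring
          _ ≤ e' := by
            rw [div_le_iff₀ hρ0]; rw [div_le_iff₀ he'0] at h3; linarith
      have hC := hR ρ h1 t ⟨ht.1.le, ht.2⟩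
      have := mul_le_mul hA hC (norm_nonneg _) (by norm_num)
      linarith)
  refine hbound.trans_lt ?_
  rw [add_sub_cancel_left, abs_of_pos (by positivity), he']
  rw [show 3 * (e / (4 * Real.pi)) * (Real.pi / 3) = e / 4 by field_simp]
  linarith

lemma tendsto_integral_inner_arc {f : ℂ → E} {b : E} {lam : ℂ} (hlam : lam ≠ 0) {k : Fin 6}
    {α : ℝ} (hf : Continuous f) :
    Tendsto (fun ε : ℝ => ∫ t in α..α + Real.pi / 3,
      (Complex.I * pt k ε t) • ((pt k ε t - lam)⁻¹ • (f (pt k ε t) - b))) (𝓝 0) (𝓝 0) := by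
  have hpi := Real.pi_pos
  have hl : 0 < ‖lam‖ := norm_pos_iff.2 hlam
  obtain ⟨C, hC⟩ := (isCompact_closedBall (0 : ℂ) ‖lam‖).exists_bound_of_continuousOn
    (hf.sub (continuous_const (y := b))).continuousOn
  have hC0 : 0 ≤ C := (norm_nonneg _).trans (hC 0 (by simp))
  have key : ∀ ε : ℝ, |ε| ≤ ‖lam‖ / 2 → ‖∫ t in α..α + Real.pi / 3,
      (Complex.I * pt k ε t) • ((pt k ε t - lam)⁻¹ • (f (pt k ε t) - b))‖ ≤
      |ε| * (2 / ‖lam‖ * C) * (Real.pi / 3) := by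
    intro ε hε
    refine (intervalIntegral.norm_integral_le_of_norm_le_const (C := |ε| * (2 / ‖lam‖ * C))
      fun t _ => ?_).trans ?_
    · have hsep : ‖lam‖ / 2 ≤ ‖pt k ε t - lam‖ := by
        have := norm_sub_norm_le lam (pt k ε t)
        rw [norm_pt, norm_sub_rev] at this
        linarith
      rw [norm_smul, norm_smul, norm_mul, Complex.norm_I, one_mul, norm_pt, norm_inv]
      have hinv : ‖pt k ε t - lam‖⁻¹ ≤ 2 / ‖lam‖ := by
        rw [← inv_div]; exact inv_anti₀ (by positivity) hsep
      have : ‖f (pt k ε t) - b‖ ≤ C := hC (pt k ε t) (by simp [norm_pt]; linarith)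
      gcongr
    · rw [add_sub_cancel_left, abs_of_pos (show 0 < Real.pi / 3 by positivity)]
  refine squeeze_zero_norm' (a := fun ε => |ε| * (2 / ‖lam‖ * C) * (Real.pi / 3)) ?_ ?_
  · have : ∀ᶠ ε : ℝ in 𝓝 0, |ε| < ‖lam‖ / 2 :=
      (continuous_abs.tendsto' (0 : ℝ) 0 abs_zero).eventually_lt_const (by positivity)
    filter_upwards [this] with ε hε
    exact key ε hε.le
  · have : Continuous fun ε : ℝ => |ε| * (2 / ‖lam‖ * C) * (Real.pi / 3) := by fun_prop
    exact this.tendsto' _ _ (by simp)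

/-- Cauchy's formula for a sectorially holomorphic function: the values are recovered from the
value at infinity and the jumps `f k - f (k - 1)` on the rays, all rotated by the angle `α`. -/
theorem cauchy_representation [CompleteSpace E] {f : Fin 6 → ℂ → E}
    (hf : ∀ k, Differentiable ℂ (f k)) {a : E} {α : ℝ}
    (hinf : ∀ k, ∀ e > 0, ∃ R, ∀ r ≥ R, ∀ t ∈ Icc α (α + Real.pi / 3), ‖f k (pt k r t) - a‖ ≤ e)
    (hint : ∀ k, IntegrableOn (fun r => f k (pt k r α) - f (k - 1) (pt k r α)) (Ioi 0))
    {k₀ : Fin 6} {ρ₀ t₀ : ℝ} (hρ₀ : 0 < ρ₀) (ht₀ : t₀ ∈ Ioo α (α + Real.pi / 3)) :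
    f k₀ (pt k₀ ρ₀ t₀) = a + (2 * Real.pi * Complex.I)⁻¹ • ∑ k, ∫ r in Ioi 0,
      (pt k 1 α * (pt k r α - pt k₀ ρ₀ t₀)⁻¹) • (f k (pt k r α) - f (k - 1) (pt k r α)) := by
  have hpi := Real.pi_pos
  set lam := pt k₀ ρ₀ t₀ with hlam
  have hlam0 : lam ≠ 0 := pt_ne_zero k₀ hρ₀ t₀
  set b := f k₀ lam with hb
  -- The quotient `(f - b) / (z - lam)` has no pole in any of the closed sectors.
  set H : Fin 6 → ℂ → E := fun k s =>
    if k = k₀ then dslope (f k) lam s else (s - lam)⁻¹ • (f k s - b) with hH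
  have hHne : ∀ k s, s ≠ lam → H k s = (s - lam)⁻¹ • (f k s - b) := by
    intro k s hs
    by_cases hk : k = k₀
    · subst hk; simp only [hH, if_true]; rw [dslope_of_ne _ hs, slope_def_module]
    · simp only [hH, if_neg hk]
  have hptne : ∀ k r t, 0 < r → α ≤ t → t ≤ α + Real.pi / 3 → k ≠ k₀ → pt k r t ≠ lam := by
    intro k r t hr h1 h2 hk h
    refine hk (pt_injective hr hρ₀ ?_ h).1
    rw [abs_lt]; constructor <;> linarith [ht₀.1, ht₀.2]
  have hHd : ∀ k r t, 0 < r → α ≤ t → t ≤ α + Real.pi / 3 →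
      DifferentiableAt ℂ (H k) (pt k r t) := by
    intro k r t hr h1 h2
    by_cases hk : k = k₀
    · simp only [hH, if_pos hk]
      exact ((Complex.differentiableOn_dslope (univ_mem)).2 (hf k).differentiableOn).differentiableAt
        univ_mem
    · simp only [hH, if_neg hk]
      have := sub_ne_zero.2 (hptne k r t hr h1 h2 hk)
      have h3 : DifferentiableAt ℂ (fun s => (s - lam)⁻¹) (pt k r t) :=
        DifferentiableAt.inv (by fun_prop) this
      exact h3.smul ((hf k _).sub_const _)
  have hrayne : ∀ k r, 0 < r → pt k r α ≠ lam := by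
    intro k r hr h
    have := (pt_injective hr hρ₀ (by rw [abs_lt]; constructor <;> linarith [ht₀.1, ht₀.2]) h).2.2
    linarith [ht₀.1]
  have hsum : ∀ ε ρ : ℝ, 0 < ε → ε ≤ ρ →
      (∑ k, ∫ r in ε..ρ, (pt k 1 α * (pt k r α - lam)⁻¹) •
        (f k (pt k r α) - f (k - 1) (pt k r α))) +
      ((∑ k, ∫ t in α..α + Real.pi / 3, (Complex.I * pt k ρ t) • H k (pt k ρ t)) -
        ∑ k, ∫ t in α..α + Real.pi / 3, (Complex.I * pt k ε t) • H k (pt k ε t)) = 0 := by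
    intro ε ρ hε hερ
    have h := Finset.sum_eq_zero (s := Finset.univ) fun (k : Fin 6) _ =>
      integral_boundary_sector_eq_zero (H := H k) (k := k) (α := α) hε hερ
        fun r t hr _ h1 h2 => hHd k r t (hε.trans_le hr) h1 h2
    have hshift : ∑ k : Fin 6, ∫ r in ε..ρ, pt (k + 1) 1 α • H k (pt (k + 1) r α) =
        ∑ k : Fin 6, ∫ r in ε..ρ, pt k 1 α • H (k - 1) (pt k r α) :=
      Fintype.sum_equiv (Equiv.addRight 1) _ _ fun k => by simp
    rw [Finset.sum_add_distrib, Finset.sum_sub_distrib, Finset.sum_sub_distrib, hshift,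
      ← Finset.sum_sub_distrib] at h
    rw [← h]
    congr 1
    refine Finset.sum_congr rfl fun k _ => ?_
    have hq : ∀ j, EqOn (fun r => pt k 1 α • H j (pt k r α))
        (fun r => pt k 1 α • ((pt k r α - lam)⁻¹ • (f j (pt k r α) - b))) (uIcc ε ρ) := by
      intro j r hr
      rw [uIcc_of_le hερ] at hr
      simp only [hHne j _ (hrayne k r (hε.trans_le hr.1))]
    have hcont : ∀ j, ContinuousOn
        (fun r => pt k 1 α • ((pt k r α - lam)⁻¹ • (f j (pt k r α) - b))) (uIcc ε ρ) := by
      intro j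
      rw [uIcc_of_le hερ]
      have hcpt : Continuous fun r => pt k r α :=
        (continuous_pt k).comp (continuous_id.prodMk continuous_const)
      refine continuousOn_const.smul (ContinuousOn.smul ?_ ?_)
      · exact (hcpt.sub continuous_const).continuousOn.inv₀ fun r hr =>
          sub_ne_zero.2 (hrayne k r (hε.trans_le hr.1))
      · exact (((hf j).continuous.comp hcpt).sub continuous_const).continuousOn
    rw [intervalIntegral.integral_congr (hq k), intervalIntegral.integral_congr (hq (k - 1)),
      ← intervalIntegral.integral_sub (hcont k).intervalIntegrable
        (hcont (k - 1)).intervalIntegrable]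
    refine intervalIntegral.integral_congr fun r _ => ?_
    module
  have hinter : ∀ k, IntegrableOn (fun r => (pt k 1 α * (pt k r α - lam)⁻¹) •
      (f k (pt k r α) - f (k - 1) (pt k r α))) (Ioi 0) := by
    intro k
    set δ := min (t₀ - α) (α + Real.pi / 3 - t₀) with hδ
    have hδ0 : 0 < δ := lt_min (by linarith [ht₀.1]) (by linarith [ht₀.2])
    have hδ1 : δ ≤ t₀ - α := min_le_left _ _
    have hδ2 : δ ≤ α + Real.pi / 3 - t₀ := min_le_right _ _
    have hsin : 0 < Real.sin δ := Real.sin_pos_of_pos_of_lt_pi hδ0 (by linarith)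
    have hcpt : Continuous fun r => pt k r α :=
        (continuous_pt k).comp (continuous_id.prodMk continuous_const)
    refine Integrable.bdd_smul (φ := fun r => pt k 1 α * (pt k r α - lam)⁻¹) (hint k)
      (Real.sin δ * ρ₀)⁻¹ ?_ ?_
    · refine ContinuousOn.aestronglyMeasurable ?_ measurableSet_Ioi
      exact continuousOn_const.mul ((hcpt.sub continuous_const).continuousOn.inv₀ fun r hr =>
          sub_ne_zero.2 (hrayne k r hr))
    · refine (ae_restrict_mem measurableSet_Ioi).mono fun r hr => ?_
      rw [norm_mul, norm_pt_of_pos k one_pos, one_mul, norm_inv]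
      exact inv_anti₀ (by positivity)
        (le_norm_sub_pt hr hρ₀ hδ0.le hδ1 (by linarith)).2
  have hlim1 := tendsto_finsetSum (Finset.univ : Finset (Fin 6)) fun k _ =>
    tendsto_intervalIntegral_Ioi_zero (hinter k)
  have hout := tendsto_finsetSum (Finset.univ : Finset (Fin 6)) fun k _ =>
    tendsto_integral_outer_arc (b := b) (lam := lam) (hinf k) (hf k).continuous
  have hin := (tendsto_finsetSum (Finset.univ : Finset (Fin 6)) fun k _ =>
    tendsto_integral_inner_arc (k := k) (α := α) (b := b) hlam0 (hf k).continuous).comp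
      tendsto_inv_atTop_zero
  have hzero : ∀ᶠ x : ℝ in atTop, (∑ k, ∫ r in x⁻¹..x, (pt k 1 α * (pt k r α - lam)⁻¹) •
        (f k (pt k r α) - f (k - 1) (pt k r α))) +
      ((∑ k, ∫ t in α..α + Real.pi / 3, (Complex.I * pt k x t) •
          ((pt k x t - lam)⁻¹ • (f k (pt k x t) - b))) -
        ∑ k, ∫ t in α..α + Real.pi / 3, (Complex.I * pt k x⁻¹ t) •
          ((pt k x⁻¹ t - lam)⁻¹ • (f k (pt k x⁻¹ t) - b))) = 0 := by
    filter_upwards [eventually_ge_atTop 1, eventually_gt_atTop ρ₀, eventually_gt_atTop ρ₀⁻¹]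
      with x hx1 hx2 hx3
    have hx0 : 0 < x := by linarith
    have hle : x⁻¹ ≤ x := (inv_le_one_of_one_le₀ hx1).trans hx1
    have hlt : x⁻¹ < ρ₀ := by
      rw [inv_lt_comm₀ hx0 hρ₀]; exact hx3
    have hne : ∀ k t y, 0 < y → y ≠ ρ₀ → pt k y t ≠ lam := by
      intro k t y hy hyρ h
      apply hyρ
      rw [← norm_pt_of_pos k hy t, h, hlam, norm_pt_of_pos k₀ hρ₀]
    rw [← hsum x⁻¹ x (by positivity) hle]
    congr 2
    · refine Finset.sum_congr rfl fun k _ => intervalIntegral.integral_congr fun t _ => ?_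
      simp only [hHne k _ (hne k t x hx0 hx2.ne')]
    · refine Finset.sum_congr rfl fun k _ => intervalIntegral.integral_congr fun t _ => ?_
      simp only [hHne k _ (hne k t x⁻¹ (by positivity) hlt.ne)]
  have hfin := tendsto_nhds_unique (hlim1.add (hout.sub hin))
    ((tendsto_congr' hzero).2 tendsto_const_nhds)
  simp only [Finset.sum_const_zero, sub_zero, Finset.sum_const, Finset.card_univ,
    Fintype.card_fin] at hfin
  have h2 : ∑ k, ∫ r in Ioi 0, (pt k 1 α * (pt k r α - lam)⁻¹) •
      (f k (pt k r α) - f (k - 1) (pt k r α)) = (2 * Real.pi * Complex.I) • (b - a) := by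
    rw [eq_neg_of_add_eq_zero_left hfin, ← Complex.coe_smul, ← Nat.cast_smul_eq_nsmul ℂ, smul_smul,
      smul_smul, ← smul_neg, neg_sub]
    congr 1; push_cast; ring
  rw [h2, smul_smul, inv_mul_cancel₀ Complex.two_pi_I_ne_zero, one_smul]
  abel

end Cauchy


/-! ### Asymptotic expansions at infinity -/

section Expansion

open MeasureTheory Set

variable {E : Type*} [NormedAddCommGroup E] [NormedSpace ℂ E]

/-- A family of entire functions, one for each sector, that tend to `a` at infinity in their
sectors, and such that the functions of adjacent sectors differ by at most `W |z|` in a wedge of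
half-opening `π / 12` about their common ray. -/
structure SectorialFamily (f : Fin 6 → ℂ → E) (a : E) (W : ℝ → ℝ) : Prop where
  differentiable : ∀ k, Differentiable ℂ (f k)
  tendsto : ∀ k, ∀ e > 0, ∃ R, ∀ r ≥ R, ∀ t ∈ Icc 0 (Real.pi / 3), ‖f k (pt k r t) - a‖ ≤ e
  jump_le : ∀ k r t, 0 < r → |t| ≤ Real.pi / 12 →
    ‖f k (pt k r t) - f (k - 1) (pt k r t)‖ ≤ W r
  integrable : ∀ n : ℕ, IntegrableOn (fun r => r ^ n * W r) (Ioi 0)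
  tendsto_weight : Tendsto W atTop (𝓝 0)

/-- The coefficients of the asymptotic expansion at infinity, as moments of the jumps on the rays
rotated by the angle `α`. -/
noncomputable def coefAt (f : Fin 6 → ℂ → E) (α : ℝ) (n : ℕ) : E :=
  -((2 * Real.pi * Complex.I)⁻¹ • ∑ k, ∫ r in Ioi 0,
    (pt k 1 α * pt k r α ^ (n - 1)) • (f k (pt k r α) - f (k - 1) (pt k r α)))

/-- Uniqueness of asymptotic expansions: an expansion without constant term that is small to every
order on a single point of each large circle is trivial. -/
lemma eq_zero_of_expansion_le {e : ℕ → E}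
    (h : ∀ N, ∃ C, ∀ ρ : ℝ, 1 ≤ ρ → ∃ z : ℂ, ‖z‖ = ρ ∧
      ‖∑ n ∈ Finset.Icc 1 N, (z ^ n)⁻¹ • e n‖ ≤ C * (ρ ^ (N + 1))⁻¹) :
    ∀ n, 1 ≤ n → e n = 0 := by
  intro n
  induction n using Nat.strong_induction_on with
  | _ n ih =>
    intro hn
    obtain ⟨C, hC⟩ := h n
    have hle : ∀ ρ : ℝ, 1 ≤ ρ → ‖e n‖ ≤ C * ρ⁻¹ := by
      intro ρ hρ
      obtain ⟨z, hz, hb⟩ := hC ρ hρ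
      have hρ0 : 0 < ρ := by linarith
      rw [Finset.sum_eq_single_of_mem n (by simp [hn])] at hb
      · rw [norm_smul, norm_inv, norm_pow, hz, pow_succ, mul_inv] at hb
        have : (ρ ^ n)⁻¹ * ‖e n‖ ≤ (ρ ^ n)⁻¹ * (C * ρ⁻¹) := by linarith
        exact le_of_mul_le_mul_left this (by positivity)
      · intro j hj hjn
        rw [Finset.mem_Icc] at hj
        rw [ih j (by omega) hj.1, smul_zero]
    have hlim : Tendsto (fun ρ : ℝ => C * ρ⁻¹) atTop (𝓝 0) := by
      simpa using tendsto_inv_atTop_zero.const_mul C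
    have := ge_of_tendsto hlim ((eventually_ge_atTop 1).mono hle)
    exact norm_le_zero_iff.1 this

namespace SectorialFamily

variable {f : Fin 6 → ℂ → E} {a : E} {W : ℝ → ℝ}

/-- The convergence at infinity persists in the rotated sectors, because adjacent functions differ
by a small quantity in the wedges. -/
lemma tendsto_rotated (h : SectorialFamily f a W) {α : ℝ} (hα : |α| ≤ Real.pi / 12) (k : Fin 6) :
    ∀ e > 0, ∃ R, ∀ r ≥ R, ∀ t ∈ Icc α (α + Real.pi / 3), ‖f k (pt k r t) - a‖ ≤ e := by
  have hpi := Real.pi_pos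
  intro e he
  obtain ⟨R₁, h₁⟩ := h.tendsto k e he
  obtain ⟨R₂, h₂⟩ := h.tendsto (k - 1) (e / 2) (by positivity)
  obtain ⟨R₃, h₃⟩ := h.tendsto (k + 1) (e / 2) (by positivity)
  obtain ⟨R₄, h₄⟩ := eventually_atTop.1 (h.tendsto_weight.eventually_le_const
    (show (0 : ℝ) < e / 2 by positivity))
  rw [abs_le] at hα
  refine ⟨max (max R₁ R₂) (max R₃ (max R₄ 1)), fun r hr t ht => ?_⟩
  simp only [ge_iff_le, max_le_iff] at hr
  obtain ⟨⟨hr1, hr2⟩, hr3, hr4, hr5⟩ := hr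
  have hr0 : 0 < r := by linarith
  have hW := h₄ r hr4
  rcases lt_or_ge t 0 with h0 | h0
  · have e1 := h.jump_le k r t hr0 (by rw [abs_le]; constructor <;> linarith [ht.1])
    have e2 := h₂ r hr2 (t + Real.pi / 3) ⟨by linarith [ht.1], by linarith⟩
    rw [pt_sub_one] at e2
    have := norm_add_le (f k (pt k r t) - f (k - 1) (pt k r t)) (f (k - 1) (pt k r t) - a)
    rw [sub_add_sub_cancel] at this
    linarith
  rcases le_or_gt t (Real.pi / 3) with h1 | h1
  · exact h₁ r hr1 t ⟨h0, h1⟩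
  · have e1 := h.jump_le (k + 1) r (t - Real.pi / 3) hr0
      (by rw [abs_le]; constructor <;> linarith [ht.2])
    have e2 := h₃ r hr3 (t - Real.pi / 3) ⟨by linarith, by linarith [ht.2]⟩
    rw [pt_add_one, sub_add_cancel] at e1 e2
    rw [add_sub_cancel_right, norm_sub_rev] at e1
    have := norm_add_le (f k (pt k r t) - f (k + 1) (pt k r t)) (f (k + 1) (pt k r t) - a)
    rw [sub_add_sub_cancel] at this
    linarith

lemma continuous_ray (k : Fin 6) (α : ℝ) : Continuous fun r => pt k r α :=
  (continuous_pt k).comp (continuous_id.prodMk continuous_const)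

lemma integrable_moment (h : SectorialFamily f a W) {α : ℝ} (hα : |α| ≤ Real.pi / 12) (k : Fin 6)
    (n : ℕ) : IntegrableOn (fun r => (pt k 1 α * pt k r α ^ n) •
      (f k (pt k r α) - f (k - 1) (pt k r α))) (Ioi 0) := by
  have hc := continuous_ray k α
  refine (h.integrable n).mono' ?_ ((ae_restrict_mem measurableSet_Ioi).mono fun r hr => ?_)
  · refine Continuous.aestronglyMeasurable ?_
    exact (continuous_const.mul (hc.pow n)).smul
      (((h.differentiable k).continuous.comp hc).sub ((h.differentiable (k - 1)).continuous.comp hc))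
  · rw [norm_smul, norm_mul, norm_pow, norm_pt_of_pos k one_pos, norm_pt_of_pos k hr, one_mul]
    exact mul_le_mul_of_nonneg_left (h.jump_le k r α hr hα) (pow_nonneg (le_of_lt hr) n)

/-- The kernel of the remainder is integrable: a point inside a rotated sector keeps a distance to
the rotated rays that is comparable to its modulus. -/
lemma integrable_quotient (h : SectorialFamily f a W) {α : ℝ} (hα : |α| ≤ Real.pi / 12)
    {k₀ : Fin 6} {ρ₀ t₀ δ : ℝ} (hρ₀ : 0 < ρ₀) (hδ : 0 < δ) (h1 : δ ≤ t₀ - α)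
    (h2 : t₀ - α ≤ Real.pi / 3 - δ) (k : Fin 6) (n : ℕ) :
    IntegrableOn (fun r => (pt k 1 α * pt k r α ^ n * (pt k r α - pt k₀ ρ₀ t₀)⁻¹) •
      (f k (pt k r α) - f (k - 1) (pt k r α))) (Ioi 0) := by
  have hpi := Real.pi_pos
  have hc := continuous_ray k α
  have hsin : 0 < Real.sin δ := Real.sin_pos_of_pos_of_lt_pi hδ (by linarith)
  have := Integrable.bdd_smul (φ := fun r => (pt k r α - pt k₀ ρ₀ t₀)⁻¹)
    (h.integrable_moment hα k n) (Real.sin δ * ρ₀)⁻¹ ?_ ?_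
  · refine this.congr (ae_of_all _ fun r => ?_)
    simp only [Pi.smul_apply', smul_smul]
    congr 1; ring
  · refine ContinuousOn.aestronglyMeasurable ?_ measurableSet_Ioi
    refine (hc.sub continuous_const).continuousOn.inv₀ fun r hr => ?_
    rw [← norm_pos_iff]
    exact lt_of_lt_of_le (by positivity) (le_norm_sub_pt hr hρ₀ hδ.le h1 h2).2
  · refine (ae_restrict_mem measurableSet_Ioi).mono fun r hr => ?_
    rw [norm_inv]
    exact inv_anti₀ (by positivity) (le_norm_sub_pt hr hρ₀ hδ.le h1 h2).2

/-- The asymptotic expansion at infinity with an exact remainder. -/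
lemma expansion_eq [CompleteSpace E] (h : SectorialFamily f a W) {α : ℝ}
    (hα : |α| ≤ Real.pi / 12) {k₀ : Fin 6} {ρ₀ t₀ δ : ℝ} (hρ₀ : 0 < ρ₀) (hδ : 0 < δ)
    (h1 : δ ≤ t₀ - α) (h2 : t₀ - α ≤ Real.pi / 3 - δ) (N : ℕ) :
    f k₀ (pt k₀ ρ₀ t₀) = a + ∑ n ∈ Finset.Icc 1 N, (pt k₀ ρ₀ t₀ ^ n)⁻¹ • coefAt f α n +
      ((2 * Real.pi * Complex.I)⁻¹ * (pt k₀ ρ₀ t₀ ^ N)⁻¹) • ∑ k, ∫ r in Ioi 0,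
        (pt k 1 α * pt k r α ^ N * (pt k r α - pt k₀ ρ₀ t₀)⁻¹) •
          (f k (pt k r α) - f (k - 1) (pt k r α)) := by
  have hpi := Real.pi_pos
  have hsin : 0 < Real.sin δ := Real.sin_pos_of_pos_of_lt_pi hδ (by linarith)
  induction N with
  | zero =>
    rw [cauchy_representation h.differentiable (h.tendsto_rotated hα) (fun k => ?_) hρ₀
      (t₀ := t₀) ⟨by linarith, by linarith⟩]
    · simp
    · have hc := continuous_ray k α
      refine ((h.integrable 0).mono' ?_ ((ae_restrict_mem measurableSet_Ioi).mono fun r hr => ?_))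
      · exact (((h.differentiable k).continuous.comp hc).sub
          ((h.differentiable (k - 1)).continuous.comp hc)).aestronglyMeasurable
      · rw [pow_zero, one_mul]; exact h.jump_le k r α hr hα
  | succ N ih =>
    have hlam : pt k₀ ρ₀ t₀ ≠ 0 := pt_ne_zero k₀ hρ₀ t₀
    rw [ih, Finset.sum_Icc_succ_top (by omega), coefAt, Nat.add_sub_cancel]
    set lam := pt k₀ ρ₀ t₀ with hl
    have hstep : ∀ k, (∫ r in Ioi 0, (pt k 1 α * pt k r α ^ N * (pt k r α - lam)⁻¹) •
          (f k (pt k r α) - f (k - 1) (pt k r α))) =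
        lam⁻¹ • (∫ r in Ioi 0, (pt k 1 α * pt k r α ^ (N + 1) * (pt k r α - lam)⁻¹) •
          (f k (pt k r α) - f (k - 1) (pt k r α))) -
        lam⁻¹ • ∫ r in Ioi 0, (pt k 1 α * pt k r α ^ N) •
          (f k (pt k r α) - f (k - 1) (pt k r α)) := by
      intro k
      have i1 := (h.integrable_quotient (k₀ := k₀) hα hρ₀ hδ h1 h2 k (N + 1)).smul lam⁻¹
      have i2 := (h.integrable_moment hα k N).smul lam⁻¹
      rw [← integral_smul, ← integral_smul, ← integral_sub]
      rotate_left
      · exact i1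
      · exact i2
      refine setIntegral_congr_fun measurableSet_Ioi fun r hr => ?_
      have hne : pt k r α - lam ≠ 0 := by
        rw [← norm_pos_iff]
        exact lt_of_lt_of_le (by positivity) (le_norm_sub_pt hr hρ₀ hδ.le h1 h2).2
      simp only [smul_smul, ← sub_smul]
      congr 1
      field_simp
      ring
    simp only [hstep]
    rw [Finset.sum_sub_distrib, ← Finset.smul_sum, ← Finset.smul_sum]
    simp only [pow_succ, mul_inv]
    module

lemma norm_coefAt_le (h : SectorialFamily f a W) {α : ℝ} (hα : |α| ≤ Real.pi / 12) (n : ℕ) :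
    ‖coefAt f α n‖ ≤ 3 / Real.pi * ∫ r in Ioi 0, r ^ (n - 1) * W r := by
  have hpi := Real.pi_pos
  rw [coefAt, norm_neg, norm_smul]
  have h1 : ‖(2 * Real.pi * Complex.I : ℂ)⁻¹‖ = (2 * Real.pi)⁻¹ := by
    simp [abs_of_pos hpi, mul_comm]
  have h2 : ∀ k, ‖∫ r in Ioi 0, (pt k 1 α * pt k r α ^ (n - 1)) •
      (f k (pt k r α) - f (k - 1) (pt k r α))‖ ≤ ∫ r in Ioi 0, r ^ (n - 1) * W r := by
    intro k
    refine norm_integral_le_of_norm_le (h.integrable _)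
      ((ae_restrict_mem measurableSet_Ioi).mono fun r hr => ?_)
    rw [norm_smul, norm_mul, norm_pow, norm_pt_of_pos k one_pos, norm_pt_of_pos k hr, one_mul]
    exact mul_le_mul_of_nonneg_left (h.jump_le k r α hr hα) (pow_nonneg (le_of_lt hr) _)
  have h3 := (norm_sum_le Finset.univ fun k => ∫ r in Ioi 0, (pt k 1 α * pt k r α ^ (n - 1)) •
      (f k (pt k r α) - f (k - 1) (pt k r α))).trans (Finset.sum_le_sum fun k _ => h2 k)
  rw [Finset.sum_const, Finset.card_univ, Fintype.card_fin, nsmul_eq_mul] at h3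
  rw [h1]
  calc _ ≤ (2 * Real.pi)⁻¹ * ((6 : ℕ) * ∫ r in Ioi 0, r ^ (n - 1) * W r) := by gcongr
    _ = _ := by push_cast; field_simp; ring

/-- The remainder is bounded by the integral of any majorant `V` of the kernel; the choice of `V`
decides whether the estimate is good at infinity or at the origin. -/
lemma norm_remainder_le_of (h : SectorialFamily f a W) {α : ℝ} (hα : |α| ≤ Real.pi / 12)
    {k₀ : Fin 6} {ρ₀ t₀ : ℝ} (hρ₀ : 0 < ρ₀) (N : ℕ) {V : ℝ → ℝ} (hV : IntegrableOn V (Ioi 0))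
    (hle : ∀ k r, 0 < r → r ^ N * ‖(pt k r α - pt k₀ ρ₀ t₀)⁻¹‖ * W r ≤ V r) :
    ‖((2 * Real.pi * Complex.I)⁻¹ * (pt k₀ ρ₀ t₀ ^ N)⁻¹) • ∑ k, ∫ r in Ioi 0,
        (pt k 1 α * pt k r α ^ N * (pt k r α - pt k₀ ρ₀ t₀)⁻¹) •
          (f k (pt k r α) - f (k - 1) (pt k r α))‖ ≤
      3 / Real.pi * (ρ₀ ^ N)⁻¹ * ∫ r in Ioi 0, V r := by
  have hpi := Real.pi_pos
  have h1 : ‖(2 * Real.pi * Complex.I : ℂ)⁻¹‖ = (2 * Real.pi)⁻¹ := by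
    simp [abs_of_pos hpi, mul_comm]
  have h2 : ∀ k, ‖∫ r in Ioi 0, (pt k 1 α * pt k r α ^ N * (pt k r α - pt k₀ ρ₀ t₀)⁻¹) •
      (f k (pt k r α) - f (k - 1) (pt k r α))‖ ≤ ∫ r in Ioi 0, V r := by
    intro k
    refine norm_integral_le_of_norm_le hV ((ae_restrict_mem measurableSet_Ioi).mono fun r hr => ?_)
    rw [norm_smul, norm_mul, norm_mul, norm_pow, norm_pt_of_pos k one_pos, norm_pt_of_pos k hr,
      one_mul]
    refine le_trans ?_ (hle k r hr)
    exact mul_le_mul_of_nonneg_left (h.jump_le k r α hr hα)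
      (mul_nonneg (pow_nonneg (le_of_lt hr) _) (norm_nonneg _))
  have h3 := (norm_sum_le Finset.univ fun k => ∫ r in Ioi 0,
    (pt k 1 α * pt k r α ^ N * (pt k r α - pt k₀ ρ₀ t₀)⁻¹) •
      (f k (pt k r α) - f (k - 1) (pt k r α))).trans (Finset.sum_le_sum fun k _ => h2 k)
  rw [Finset.sum_const, Finset.card_univ, Fintype.card_fin, nsmul_eq_mul] at h3
  rw [norm_smul, norm_mul, h1, norm_inv, norm_pow, norm_pt_of_pos k₀ hρ₀]
  calc _ ≤ (2 * Real.pi)⁻¹ * (ρ₀ ^ N)⁻¹ * ((6 : ℕ) * ∫ r in Ioi 0, V r) := by gcongr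
    _ = _ := by push_cast; field_simp; ring

/-- The expansion with the coefficients of the rays rotated by `α`, at points whose angle differs by
at least `π / 24` from the angles of these rays. -/
lemma norm_sub_expansion_le_at [CompleteSpace E] (h : SectorialFamily f a W) {α : ℝ}
    (hα : |α| ≤ Real.pi / 12) {k₀ : Fin 6} {ρ₀ t₀ : ℝ} (hρ₀ : 0 < ρ₀)
    (h1 : Real.pi / 24 ≤ t₀ - α) (h2 : t₀ - α ≤ Real.pi / 3 - Real.pi / 24) (N : ℕ) :
    ‖f k₀ (pt k₀ ρ₀ t₀) - (a + ∑ n ∈ Finset.Icc 1 N, (pt k₀ ρ₀ t₀ ^ n)⁻¹ • coefAt f α n)‖ ≤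
      (3 / Real.pi * (Real.sin (Real.pi / 24))⁻¹ * ∫ r in Ioi 0, r ^ N * W r) *
        (ρ₀ ^ (N + 1))⁻¹ := by
  have hpi := Real.pi_pos
  have hsin : 0 < Real.sin (Real.pi / 24) :=
    Real.sin_pos_of_pos_of_lt_pi (by positivity) (by linarith)
  rw [h.expansion_eq hα hρ₀ (δ := Real.pi / 24) (by positivity) h1 h2 N, add_sub_cancel_left]
  refine (h.norm_remainder_le_of hα hρ₀ N
    (V := fun r => (Real.sin (Real.pi / 24) * ρ₀)⁻¹ * (r ^ N * W r))
    ((h.integrable N).const_mul _) fun k r hr => ?_).trans_eq ?_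
  · have hW : 0 ≤ W r := (norm_nonneg _).trans (h.jump_le k r α hr hα)
    have := inv_anti₀ (by positivity)
      (le_norm_sub_pt (k := k) (k₀ := k₀) hr hρ₀ (by positivity) h1 h2).2
    rw [norm_inv]
    calc _ ≤ r ^ N * (Real.sin (Real.pi / 24) * ρ₀)⁻¹ * W r := by gcongr
      _ = _ := by ring
  · rw [integral_const_mul, pow_succ, mul_inv, mul_inv]; ring

/-- The coefficients of the asymptotic expansion at infinity. -/
noncomputable def _root_.PIVModel.coef (f : Fin 6 → ℂ → E) (n : ℕ) : E :=
  coefAt f (Real.pi / 12) n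

/-- Rotating the rays does not change the coefficients: on the bisectors of the sectors the
expansions that belong to two admissible angles of rotation are both valid. -/
lemma coefAt_neg [CompleteSpace E] (h : SectorialFamily f a W) {n : ℕ} (hn : 1 ≤ n) :
    coefAt f (-(Real.pi / 12)) n = coef f n := by
  have hpi := Real.pi_pos
  rw [← sub_eq_zero]
  refine eq_zero_of_expansion_le (e := fun n => coefAt f (-(Real.pi / 12)) n - coef f n) ?_ n hn
  intro N
  refine ⟨2 * (3 / Real.pi * (Real.sin (Real.pi / 24))⁻¹ * ∫ r in Ioi 0, r ^ N * W r),
    fun ρ hρ => ⟨pt 0 ρ (Real.pi / 6), norm_pt_of_pos 0 (by linarith) _, ?_⟩⟩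
  have e1 := h.norm_sub_expansion_le_at (α := Real.pi / 12)
    (by rw [abs_of_pos (by positivity)]) (k₀ := 0) (ρ₀ := ρ) (t₀ := Real.pi / 6) (by linarith)
    (by linarith) (by linarith) N
  have e2 := h.norm_sub_expansion_le_at (α := -(Real.pi / 12))
    (by rw [abs_neg, abs_of_pos (by positivity)]) (k₀ := 0) (ρ₀ := ρ) (t₀ := Real.pi / 6)
    (by linarith) (by linarith) (by linarith) N
  simp only [smul_sub, Finset.sum_sub_distrib]
  have e3 := norm_sub_le_of_le e1 e2
  rw [sub_sub_sub_cancel_left, add_sub_add_left_eq_sub] at e3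
  exact e3.trans_eq (by ring)

lemma norm_coef_le (h : SectorialFamily f a W) (n : ℕ) :
    ‖coef f n‖ ≤ 3 / Real.pi * ∫ r in Ioi 0, r ^ (n - 1) * W r :=
  h.norm_coefAt_le (by rw [abs_of_pos (by positivity)]) n

/-- The asymptotic expansion at infinity, in a neighbourhood of each closed sector. -/
theorem norm_sub_expansion_le [CompleteSpace E] (h : SectorialFamily f a W) (k : Fin 6)
    {r t : ℝ} (hr : 0 < r) (h1 : -(Real.pi / 24) ≤ t) (h2 : t ≤ Real.pi / 3 + Real.pi / 24)
    (N : ℕ) :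
    ‖f k (pt k r t) - (a + ∑ n ∈ Finset.Icc 1 N, (pt k r t ^ n)⁻¹ • coef f n)‖ ≤
      (3 / Real.pi * (Real.sin (Real.pi / 24))⁻¹ * ∫ r in Ioi 0, r ^ N * W r) *
        (r ^ (N + 1))⁻¹ := by
  have hpi := Real.pi_pos
  rcases le_total t (Real.pi / 6) with ht | ht
  · have e := h.norm_sub_expansion_le_at (α := -(Real.pi / 12))
      (by rw [abs_neg, abs_of_pos (by positivity)]) (k₀ := k) (t₀ := t) hr
      (by linarith) (by linarith) N
    rwa [Finset.sum_congr rfl fun n hn => by rw [h.coefAt_neg (Finset.mem_Icc.1 hn).1]] at e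
  · exact h.norm_sub_expansion_le_at (α := Real.pi / 12)
      (by rw [abs_of_pos (by positivity)]) (k₀ := k) (t₀ := t) hr (by linarith) (by linarith) N

/-- A bound that is uniform up to the origin, for jumps that vanish there. -/
theorem norm_sub_le [CompleteSpace E] (h : SectorialFamily f a W)
    (hW : IntegrableOn (fun r => r⁻¹ * W r) (Ioi 0)) (k : Fin 6)
    {r t : ℝ} (hr : 0 < r) (h1 : 0 ≤ t) (h2 : t ≤ Real.pi / 3) :
    ‖f k (pt k r t) - a‖ ≤
      3 / Real.pi * (Real.sin (Real.pi / 24))⁻¹ * ∫ r in Ioi 0, r⁻¹ * W r := by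
  have hpi := Real.pi_pos
  have hsin : 0 < Real.sin (Real.pi / 24) :=
    Real.sin_pos_of_pos_of_lt_pi (by positivity) (by linarith)
  obtain ⟨α, hα, h3, h4⟩ : ∃ α, |α| ≤ Real.pi / 12 ∧ Real.pi / 24 ≤ t - α ∧
      t - α ≤ Real.pi / 3 - Real.pi / 24 := by
    rcases le_total t (Real.pi / 6) with ht | ht
    · exact ⟨-(Real.pi / 12), by rw [abs_neg, abs_of_pos (by positivity)], by linarith,
        by linarith⟩
    · exact ⟨Real.pi / 12, by rw [abs_of_pos (by positivity)], by linarith, by linarith⟩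
  have e := h.expansion_eq hα (k₀ := k) hr (δ := Real.pi / 24) (by positivity) h3 h4 0
  rw [e, Finset.Icc_eq_empty (by norm_num), Finset.sum_empty, add_zero, add_sub_cancel_left]
  refine (h.norm_remainder_le_of hα hr 0
    (V := fun r => (Real.sin (Real.pi / 24))⁻¹ * (r⁻¹ * W r)) (hW.const_mul _)
    fun j s hs => ?_).trans_eq ?_
  · have hWs : 0 ≤ W s := (norm_nonneg _).trans (h.jump_le j s α hs hα)
    have := inv_anti₀ (by positivity)
      (le_norm_sub_pt (k := j) (k₀ := k) hs hr (by positivity) h3 h4).1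
    rw [norm_inv, pow_zero, one_mul]
    calc _ ≤ (Real.sin (Real.pi / 24) * s)⁻¹ * W s := by gcongr
      _ = _ := by rw [mul_inv]; ring
  · rw [integral_const_mul, pow_zero]; ring

end SectorialFamily

end Expansion


/-! ### Extension across the contour -/

section Gluing

open Set
open scoped Interval

/-- The open sector between the rays `k` and `k + 1`. -/
def openSector (k : Fin 6) : Set ℂ := leftSide k ∩ rightSide (k + 1)

lemma dir_add_three (j : Fin 6) : dir (j + 3) = -dir j := by
  rw [dir_eq_exp_int (j + 3) ((j : ℕ) + 3 : ℤ) (by revert j; decide), dir,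
    show ((Real.pi / 6 + (((j : ℕ) + 3 : ℤ) : ℂ) * (Real.pi / 3)) * Complex.I : ℂ) =
      (Real.pi / 6 + (j : ℕ) * (Real.pi / 3)) * Complex.I + Real.pi * Complex.I by
        push_cast; ring, Complex.exp_add, Complex.exp_pi_mul_I]
  ring

lemma im_pt_mul_conj_dir (k : Fin 6) (r t : ℝ) :
    (pt k r t * (starRingEnd ℂ) (dir k)).im = r * Real.sin t := by
  have h : dir k * (starRingEnd ℂ) (dir k) = 1 := by
    rw [Complex.mul_conj, Complex.normSq_eq_norm_sq, norm_dir]; simp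
  have : pt k r t * (starRingEnd ℂ) (dir k) = r * Complex.exp (t * Complex.I) := by
    rw [pt]; linear_combination (r * Complex.exp (t * Complex.I)) * h
  rw [this, Complex.im_ofReal_mul, Complex.exp_ofReal_mul_I_im]

lemma pt_mem_leftSide {k : Fin 6} {r t : ℝ} (hr : 0 < r) (h0 : 0 < t) (h1 : t < Real.pi) :
    pt k r t ∈ leftSide k := by
  rw [leftSide, mem_ofPred_eq, im_pt_mul_conj_dir]
  exact mul_pos hr (Real.sin_pos_of_pos_of_lt_pi h0 h1)

lemma pt_mem_rightSide {k : Fin 6} {r t : ℝ} (hr : 0 < r) (h0 : -Real.pi < t) (h1 : t < 0) :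
    pt k r t ∈ rightSide k := by
  rw [rightSide, mem_ofPred_eq, im_pt_mul_conj_dir]
  have := mul_pos hr (Real.sin_pos_of_pos_of_lt_pi (x := -t) (by linarith) (by linarith))
  rw [Real.sin_neg] at this
  linarith

lemma isOpen_leftSide (k : Fin 6) : IsOpen (leftSide k) :=
  isOpen_lt continuous_const (by fun_prop)

lemma isOpen_rightSide (k : Fin 6) : IsOpen (rightSide k) :=
  isOpen_lt (by fun_prop) continuous_const

lemma pt_mem_openSector {k : Fin 6} {r t : ℝ} (hr : 0 < r) (h0 : 0 < t) (h1 : t < Real.pi / 3) :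
    pt k r t ∈ openSector k := by
  have hpi := Real.pi_pos
  refine ⟨pt_mem_leftSide hr h0 (by linarith), ?_⟩
  have := pt_sub_one (k + 1) r (t - Real.pi / 3)
  rw [add_sub_cancel_right, sub_add_cancel] at this
  rw [this]
  exact pt_mem_rightSide hr (by linarith) (by linarith)

lemma exists_pt_of_mem_openSector {k : Fin 6} {z : ℂ} (hz : z ∈ openSector k) :
    ∃ r t, 0 < r ∧ 0 < t ∧ t < Real.pi / 3 ∧ z = pt k r t := by
  have hpi := Real.pi_pos
  obtain ⟨h1, h2⟩ := hz
  set w := z * (starRingEnd ℂ) (dir k) with hw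
  have h : dir k * (starRingEnd ℂ) (dir k) = 1 := by
    rw [Complex.mul_conj, Complex.normSq_eq_norm_sq, norm_dir]; simp
  have hzw : z = pt k ‖w‖ w.arg := by
    have := Complex.norm_mul_exp_arg_mul_I w
    rw [pt, show (‖w‖ : ℂ) * (dir k * Complex.exp (w.arg * Complex.I)) =
      dir k * (‖w‖ * Complex.exp (w.arg * Complex.I)) by ring, this, hw]
    linear_combination -z * h
  have hw0 : 0 < ‖w‖ := by
    rw [norm_pos_iff]; intro h0
    rw [leftSide, mem_ofPred_eq, ← hw, h0] at h1; simp at h1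
  have hs1 : 0 < Real.sin w.arg := by
    rw [leftSide, mem_ofPred_eq, hzw, im_pt_mul_conj_dir] at h1
    exact pos_of_mul_pos_right h1 hw0.le
  have hs2 : Real.sin (w.arg - Real.pi / 3) < 0 := by
    have := pt_sub_one (k + 1) ‖w‖ (w.arg - Real.pi / 3)
    rw [add_sub_cancel_right, sub_add_cancel] at this
    rw [rightSide, mem_ofPred_eq, hzw, this, im_pt_mul_conj_dir] at h2
    by_contra hc
    exact absurd h2 (not_lt.2 (mul_nonneg hw0.le (not_lt.1 hc)))
  have ha0 : 0 < w.arg := by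
    by_contra hc
    have := Real.sin_nonpos_of_nonpos_of_neg_pi_le (not_lt.1 hc) (Complex.neg_pi_lt_arg w).le
    linarith
  refine ⟨‖w‖, w.arg, hw0, ha0, ?_, hzw⟩
  by_contra hc
  have := Real.sin_nonneg_of_nonneg_of_le_pi (x := w.arg - Real.pi / 3) (by linarith)
    (by linarith [Complex.arg_le_pi w])
  linarith

lemma openSector_injective {j k : Fin 6} {z : ℂ} (hj : z ∈ openSector j) (hk : z ∈ openSector k) :
    j = k := by
  obtain ⟨r, t, hr, h0, h1, rfl⟩ := exists_pt_of_mem_openSector hj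
  obtain ⟨r', t', hr', h0', h1', h⟩ := exists_pt_of_mem_openSector hk
  exact (pt_injective hr hr' (by rw [abs_lt]; constructor <;> linarith) h).1

lemma pt_zero_mem_contour (k : Fin 6) {r : ℝ} (hr : 0 ≤ r) : pt k r 0 ∈ contour :=
  ⟨k, r, hr, pt_zero_right k r⟩

lemma mem_openSector_of_notMem_contour {z : ℂ} (hz : z ∉ contour) : ∃ k, z ∈ openSector k := by
  have h0 : z ≠ 0 := by
    rintro rfl
    exact hz ⟨0, 0, le_rfl, by simp⟩
  obtain ⟨k, r, t, hr, ht0, ht1, rfl⟩ := exists_pt h0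
  rcases ht0.eq_or_lt with rfl | ht
  · exact absurd (pt_zero_mem_contour k hr.le) hz
  · exact ⟨k, pt_mem_openSector hr ht ht1⟩

lemma notMem_contour_of_mem_openSector {k : Fin 6} {z : ℂ} (hz : z ∈ openSector k) :
    z ∉ contour := by
  have hpi := Real.pi_pos
  obtain ⟨r, t, hr, h0, h1, rfl⟩ := exists_pt_of_mem_openSector hz
  rintro ⟨j, s, hs, h⟩
  rw [← pt_zero_right] at h
  have hs0 : 0 < s := by
    have := norm_pt_of_pos k hr t
    rw [h, norm_pt, abs_of_nonneg hs] at this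
    linarith
  have := (pt_injective hr hs0 (by rw [abs_lt]; constructor <;> linarith) h).2.2
  linarith

lemma compl_contour_eq : contourᶜ = ⋃ k, openSector k := by
  ext z
  simp only [mem_compl_iff, mem_iUnion]
  exact ⟨mem_openSector_of_notMem_contour, fun ⟨_, hk⟩ => notMem_contour_of_mem_openSector hk⟩

lemma isOpen_openSector (k : Fin 6) : IsOpen (openSector k) :=
  (isOpen_leftSide k).inter (isOpen_rightSide _)

lemma isOpen_compl_contour : IsOpen contourᶜ := by
  rw [compl_contour_eq]; exact isOpen_iUnion isOpen_openSector

lemma exists_pt_zero_of_mem_contour {z : ℂ} (hz : z ∈ contour) (h0 : z ≠ 0) :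
    ∃ j r, 0 < r ∧ z = pt j r 0 := by
  obtain ⟨j, r, hr, rfl⟩ := hz
  refine ⟨j, r, hr.lt_of_ne ?_, (pt_zero_right j r).symm⟩
  rintro rfl; simp at h0

/-- A disc about a point of the ray number `j` that meets no other ray. -/
lemma exists_ball_ray (j : Fin 6) {r : ℝ} (hr : 0 < r) : ∃ ε > 0, ∀ z ∈ Metric.ball (pt j r 0) ε,
    z ≠ 0 ∧ (z ∈ leftSide j → z ∈ openSector j) ∧ (z ∈ rightSide j → z ∈ openSector (j - 1)) := by
  have hpi := Real.pi_pos
  have h1 : pt j r 0 ∈ rightSide (j + 1) := by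
    have := pt_sub_one (j + 1) r (-(Real.pi / 3))
    rw [add_sub_cancel_right, neg_add_cancel] at this
    rw [this]; exact pt_mem_rightSide hr (by linarith) (by linarith)
  have h2 : pt j r 0 ∈ leftSide (j - 1) := by
    have := pt_sub_one j r 0
    rw [zero_add] at this
    rw [← this]; exact pt_mem_leftSide hr (by linarith) (by linarith)
  have h3 : rightSide (j + 1) ∩ leftSide (j - 1) ∩ {0}ᶜ ∈ 𝓝 (pt j r 0) :=
    (((isOpen_rightSide _).inter (isOpen_leftSide _)).inter isOpen_compl_singleton).mem_nhds
      ⟨⟨h1, h2⟩, pt_ne_zero j hr 0⟩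
  obtain ⟨ε, hε, hsub⟩ := Metric.mem_nhds_iff.1 h3
  refine ⟨ε, hε, fun z hz => ⟨(hsub hz).2, fun hl => ⟨hl, (hsub hz).1.1⟩,
    fun hl => ⟨(hsub hz).1.2, ?_⟩⟩⟩
  rwa [sub_add_cancel]

lemma dense_compl_contour_ne_zero {z : ℂ} (hz : z ≠ 0) : z ∈ closure contourᶜ := by
  have hpi := Real.pi_pos
  by_cases h : z ∈ contour
  · obtain ⟨j, r, hr, rfl⟩ := exists_pt_zero_of_mem_contour h hz
    have hc : Tendsto (fun t => pt j r t) (𝓝[>] 0) (𝓝 (pt j r 0)) :=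
      (((continuous_pt j).comp (continuous_const.prodMk continuous_id)).tendsto 0).mono_left
        nhdsWithin_le_nhds
    refine mem_closure_of_tendsto hc ?_
    filter_upwards [Ioo_mem_nhdsGT (show (0 : ℝ) < Real.pi / 3 by positivity)] with t ht
    exact notMem_contour_of_mem_openSector (pt_mem_openSector hr ht.1 ht.2)
  · exact subset_closure h

/-- A continuous function on a disc that is holomorphic off the real axis is holomorphic. -/
lemma differentiableOn_ball_of_off_real_axis {g : ℂ → ℂ} {c : ℂ} {ε : ℝ}
    (hc : ContinuousOn g (Metric.ball c ε))
    (hd : ∀ w ∈ Metric.ball c ε, w.im ≠ 0 → DifferentiableAt ℂ g w) :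
    DifferentiableOn ℂ g (Metric.ball c ε) := by
  have hdir : ∀ z w : ℂ, Complex.Rectangle z w ⊆ Metric.ball c ε →
      (0 : ℝ) ∉ Ioo (min z.im w.im) (max z.im w.im) →
      (∫ x : ℝ in z.re..w.re, g (x + z.im * Complex.I)) -
        (∫ x : ℝ in z.re..w.re, g (x + w.im * Complex.I)) +
        Complex.I • (∫ y : ℝ in z.im..w.im, g (w.re + y * Complex.I)) -
        Complex.I • (∫ y : ℝ in z.im..w.im, g (z.re + y * Complex.I)) = 0 := by
    intro z w hsub h0
    refine Complex.integral_boundary_rect_eq_zero_of_continuousOn_of_differentiableOn g z w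
      (hc.mono hsub) fun p hp => (hd p (hsub ?_) ?_).differentiableWithinAt
    · exact ⟨Ioo_subset_Icc_self hp.1, Ioo_subset_Icc_self hp.2⟩
    · rintro h; exact h0 (h ▸ hp.2)
  refine Complex.IsExactOn.differentiableOn Metric.isOpen_ball
    (Complex.IsConservativeOn.isExactOn_ball hc fun z w hsub => ?_)
  rw [← add_eq_zero_iff_eq_neg, Complex.wedgeIntegral_add_wedgeIntegral_eq]
  by_cases h0 : (0 : ℝ) ∈ Ioo (min z.im w.im) (max z.im w.im)
  · have h0' : (0 : ℝ) ∈ [[z.im, w.im]] := Ioo_subset_Icc_self h0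
    have hs1 : [[z.im, 0]] ⊆ [[z.im, w.im]] := uIcc_subset_uIcc_left h0'
    have hs2 : [[0, w.im]] ⊆ [[z.im, w.im]] := uIcc_subset_uIcc_right h0'
    have e1 := hdir z ⟨w.re, 0⟩ (fun p hp => hsub ⟨hp.1, hs1 hp.2⟩) (by
      rintro ⟨h1, h2⟩
      rcases min_lt_iff.1 h1 with h | h <;> rcases lt_max_iff.1 h2 with h' | h' <;>
        linarith [show (⟨w.re, 0⟩ : ℂ).im = 0 from rfl])
    have e2 := hdir ⟨z.re, 0⟩ w (fun p hp => hsub ⟨hp.1, hs2 hp.2⟩) (by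
      rintro ⟨h1, h2⟩
      rcases min_lt_iff.1 h1 with h | h <;> rcases lt_max_iff.1 h2 with h' | h' <;>
        linarith [show (⟨z.re, 0⟩ : ℂ).im = 0 from rfl])
    have hint : ∀ x ∈ [[z.re, w.re]], ∀ a b, [[a, b]] ⊆ [[z.im, w.im]] →
        IntervalIntegrable (fun y : ℝ => g (x + y * Complex.I)) MeasureTheory.volume a b := by
      intro x hx a b hab
      refine ContinuousOn.intervalIntegrable ?_
      refine hc.comp (f := fun y : ℝ => (x + y * Complex.I : ℂ)) (by fun_prop) fun y hy => hsub ?_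
      exact ⟨by simpa using hx, by simpa using hab hy⟩
    have i1 := intervalIntegral.integral_add_adjacent_intervals
      (hint w.re right_mem_uIcc _ _ hs1) (hint w.re right_mem_uIcc _ _ hs2)
    have i2 := intervalIntegral.integral_add_adjacent_intervals
      (hint z.re left_mem_uIcc _ _ hs1) (hint z.re left_mem_uIcc _ _ hs2)
    rw [← i1, ← i2]
    simp only [smul_eq_mul] at e1 e2 ⊢
    linear_combination e1 + e2
  · exact hdir z w hsub h0

/-- A function that is holomorphic off the contour, has equal limits from both sides of the rays
and is bounded at the origin extends to an entire function. -/
theorem exists_entire_extension {F : ℂ → ℂ} (hF : DifferentiableOn ℂ F contourᶜ)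
    (hlim : ∀ j r, 0 < r → ∃ L, Tendsto F (𝓝[leftSide j] (pt j r 0)) (𝓝 L) ∧
      Tendsto F (𝓝[rightSide j] (pt j r 0)) (𝓝 L))
    (h0 : F =O[𝓝 0 ⊓ 𝓟 contourᶜ] fun _ => (1 : ℂ)) :
    ∃ G : ℂ → ℂ, Differentiable ℂ G ∧ ∀ z ∉ contour, G z = F z := by
  have hFt : ∀ z ≠ 0, ∃ L, Tendsto F (𝓝[contourᶜ] z) (𝓝 L) := by
    intro z hz
    by_cases h : z ∈ contour
    · obtain ⟨j, r, hr, rfl⟩ := exists_pt_zero_of_mem_contour h hz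
      obtain ⟨L, h1, h2⟩ := hlim j r hr
      refine ⟨L, (h1.sup h2).mono_left ?_⟩
      rw [← nhdsWithin_union]
      refine nhdsWithin_le_iff.2 ?_
      obtain ⟨ε, hε, hball⟩ := exists_ball_ray j hr
      rw [mem_nhdsWithin]
      refine ⟨Metric.ball (pt j r 0) ε, Metric.isOpen_ball, Metric.mem_ball_self hε, ?_⟩
      rintro w ⟨hw, hwc⟩
      obtain ⟨k, s, t, hs, ht0, ht1, rfl⟩ := exists_pt (hball w hw).1
      by_contra hn
      rw [mem_union, not_or] at hn
      apply hwc
      have him : (pt k s t * (starRingEnd ℂ) (dir j)).im = 0 :=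
        le_antisymm (not_lt.1 hn.1) (not_lt.1 hn.2)
      -- A point on the line of the ray `j` is on the ray `j` or on the opposite ray `j + 3`.
      have hd : dir j * (starRingEnd ℂ) (dir j) = 1 := by
        rw [Complex.mul_conj, Complex.normSq_eq_norm_sq, norm_dir]; simp
      set x := (pt k s t * (starRingEnd ℂ) (dir j)).re with hx
      have hzx : pt k s t = x * dir j := by
        have : (x : ℂ) = pt k s t * (starRingEnd ℂ) (dir j) :=
          Complex.ext (by simp [hx]) (by rw [him]; simp)
        rw [this]; linear_combination -pt k s t * hd
      rcases le_total 0 x with hx0 | hx0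
      · exact ⟨j, x, hx0, hzx⟩
      · refine ⟨j + 3, -x, by linarith, ?_⟩
        rw [hzx, dir_add_three]; push_cast; ring
    · exact ⟨F z, (hF.continuousOn z h)⟩
  set G₀ := extendFrom contourᶜ F with hG₀
  have hcont : ContinuousOn G₀ {0}ᶜ :=
    continuousOn_extendFrom (fun z hz => dense_compl_contour_ne_zero hz) hFt
  have hEq : ∀ z ∉ contour, G₀ z = F z := fun z hz =>
    extendFrom_extends hF.continuousOn z hz
  have hdiff : ∀ z ∉ contour, DifferentiableAt ℂ G₀ z := by
    intro z hz
    have hn := isOpen_compl_contour.mem_nhds (show z ∈ contourᶜ from hz)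
    refine (hF.differentiableAt hn).congr_of_eventuallyEq ?_
    filter_upwards [hn] with w hw using hEq w hw
  have hdiff0 : ∀ z ≠ 0, DifferentiableAt ℂ G₀ z := by
    intro z hz
    by_cases h : z ∈ contour
    · obtain ⟨j, r, hr, rfl⟩ := exists_pt_zero_of_mem_contour h hz
      obtain ⟨ε, hε, hball⟩ := exists_ball_ray j hr
      have hd : dir j * (starRingEnd ℂ) (dir j) = 1 := by
        rw [Complex.mul_conj, Complex.normSq_eq_norm_sq, norm_dir]; simp
      have hdist : ∀ w : ℂ, dist (dir j * w) (pt j r 0) = dist w r := by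
        intro w
        rw [pt_zero_right, dist_eq_norm, dist_eq_norm,
          show dir j * w - r * dir j = dir j * (w - r) by ring, norm_mul, norm_dir, one_mul]
      have hg : DifferentiableOn ℂ (fun w => G₀ (dir j * w)) (Metric.ball (r : ℂ) ε) := by
        refine differentiableOn_ball_of_off_real_axis ?_ fun w hw him => ?_
        · refine hcont.comp (f := fun w => dir j * w) (by fun_prop) fun w hw => ?_
          exact (hball _ (by rw [Metric.mem_ball, hdist]; exact hw)).1
        · have hb := hball (dir j * w) (by rw [Metric.mem_ball, hdist]; exact hw)
          have him' : (dir j * w * (starRingEnd ℂ) (dir j)).im = w.im := by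
            rw [show dir j * w * (starRingEnd ℂ) (dir j) = w by linear_combination w * hd]
          have hnc : dir j * w ∉ contour := by
            rcases lt_or_gt_of_ne him with h' | h'
            · exact notMem_contour_of_mem_openSector
                (hb.2.2 (by rw [rightSide, mem_ofPred_eq, him']; exact h'))
            · exact notMem_contour_of_mem_openSector
                (hb.2.1 (by rw [leftSide, mem_ofPred_eq, him']; exact h'))
          exact DifferentiableAt.comp w (hdiff _ hnc) (by fun_prop)
      have hgr : DifferentiableAt ℂ (fun w => G₀ (dir j * w)) r :=
        hg.differentiableAt (Metric.ball_mem_nhds _ hε)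
      have hcomp : G₀ = (fun w => G₀ (dir j * w)) ∘ fun z => (dir j)⁻¹ * z := by
        funext z; simp [mul_inv_cancel_left₀ (dir_ne_zero j)]
      rw [hcomp]
      refine DifferentiableAt.comp _ ?_ (by fun_prop)
      have : (dir j)⁻¹ * pt j r 0 = r := by
        rw [pt_zero_right]; field_simp [dir_ne_zero j]
      rw [this]; exact hgr
    · exact hdiff z h
  obtain ⟨C, hC⟩ := h0.bound
  obtain ⟨ε, hε, hball⟩ : ∃ ε > 0, ∀ z ∈ Metric.ball (0 : ℂ) ε, z ∉ contour → ‖F z‖ ≤ C := by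
    rw [eventually_inf_principal] at hC
    obtain ⟨ε, hε, hb⟩ := Metric.eventually_nhds_iff_ball.1 hC
    exact ⟨ε, hε, fun z hz hzc => by simpa using hb z hz hzc⟩
  have hrem := Complex.differentiableOn_update_limUnder_of_bddAbove (f := G₀)
    (Metric.ball_mem_nhds (0 : ℂ) hε)
    (fun z hz => (hdiff0 z hz.2).differentiableWithinAt) (by
      refine ⟨C, ?_⟩
      rintro _ ⟨z, ⟨hz, hz0⟩, rfl⟩
      have ht : Tendsto F (𝓝[contourᶜ] z) (𝓝 (G₀ z)) := tendsto_extendFrom (hFt z hz0)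
      have hne : (𝓝[contourᶜ] z).NeBot :=
        mem_closure_iff_nhdsWithin_neBot.1 (dense_compl_contour_ne_zero hz0)
      refine le_of_tendsto ht.norm ?_
      filter_upwards [self_mem_nhdsWithin,
        mem_nhdsWithin_of_mem_nhds (Metric.isOpen_ball.mem_nhds hz)] with w hw1 hw2
      exact hball w hw2 hw1)
  refine ⟨Function.update G₀ 0 (limUnder (𝓝[≠] 0) G₀), fun z => ?_, fun z hz => ?_⟩
  · by_cases hz : z = 0
    · subst hz; exact hrem.differentiableAt (Metric.ball_mem_nhds _ hε)
    · refine (hdiff0 z hz).congr_of_eventuallyEq ?_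
      filter_upwards [isOpen_compl_singleton.mem_nhds (show z ∈ ({0}ᶜ : Set ℂ) from hz)] with w hw
      exact Function.update_of_ne hw _ _
  · have hz0 : z ≠ 0 := by
      rintro rfl
      exact hz ⟨0, 0, le_rfl, by simp⟩
    rw [Function.update_of_ne hz0, hEq z hz]

end Gluing


/-! ### Matrix norms and adjugates -/

section Matrices

open Matrix Set
open scoped Matrix.Norms.Operator

lemma norm_entry_le (A : Matrix (Fin 3) (Fin 3) ℂ) (i j : Fin 3) : ‖A i j‖ ≤ ‖A‖ := by
  rw [Matrix.linfty_opNorm_def]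
  have h1 : ‖A i j‖₊ ≤ ∑ l, ‖A i l‖₊ :=
    Finset.single_le_sum (f := fun l => ‖A i l‖₊) (fun _ _ => zero_le) (Finset.mem_univ j)
  have h2 : ∑ l, ‖A i l‖₊ ≤ Finset.univ.sup fun i => ∑ l, ‖A i l‖₊ :=
    Finset.le_sup (f := fun i => ∑ l, ‖A i l‖₊) (Finset.mem_univ i)
  exact_mod_cast h1.trans h2

lemma norm_le_of_entry_le {A : Matrix (Fin 3) (Fin 3) ℂ} {c : ℝ} (hc : 0 ≤ c)
    (h : ∀ i j, ‖A i j‖ ≤ c) : ‖A‖ ≤ 3 * c := by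
  rw [Matrix.linfty_opNorm_def]
  lift c to NNReal using hc
  have : (Finset.univ.sup fun i => ∑ l, ‖A i l‖₊) ≤ 3 * c := by
    refine Finset.sup_le fun i _ => ?_
    rw [Fin.sum_univ_three]
    have h' : ∀ j, ‖A i j‖₊ ≤ c := fun j => by exact_mod_cast h i j
    calc _ ≤ c + c + c := add_le_add (add_le_add (h' 0) (h' 1)) (h' 2)
      _ = 3 * c := by ring
  exact_mod_cast this

lemma norm_adjugate_le (A : Matrix (Fin 3) (Fin 3) ℂ) : ‖A.adjugate‖ ≤ 6 * ‖A‖ ^ 2 := by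
  have key : ∀ a b c d : ℂ, ‖a‖ ≤ ‖A‖ → ‖b‖ ≤ ‖A‖ → ‖c‖ ≤ ‖A‖ → ‖d‖ ≤ ‖A‖ →
      ‖a * b - c * d‖ ≤ 2 * ‖A‖ ^ 2 ∧ ‖-(a * b) + c * d‖ ≤ 2 * ‖A‖ ^ 2 := by
    intro a b c d ha hb hc hd
    have h1 : ‖a * b‖ ≤ ‖A‖ * ‖A‖ := by rw [norm_mul]; gcongr
    have h2 : ‖c * d‖ ≤ ‖A‖ * ‖A‖ := by rw [norm_mul]; gcongr
    refine ⟨(norm_sub_le _ _).trans (by linarith), (norm_add_le _ _).trans ?_⟩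
    rw [norm_neg]; linarith
  have := norm_le_of_entry_le (A := A.adjugate) (c := 2 * ‖A‖ ^ 2) (by positivity) fun i j => by
    rw [Matrix.adjugate_fin_three]
    fin_cases i <;> fin_cases j <;> simp <;>
      first
      | exact (key _ _ _ _ (norm_entry_le A _ _) (norm_entry_le A _ _) (norm_entry_le A _ _)
          (norm_entry_le A _ _)).1
      | exact (key _ _ _ _ (norm_entry_le A _ _) (norm_entry_le A _ _) (norm_entry_le A _ _)
          (norm_entry_le A _ _)).2
  linarith

lemma differentiable_matrix_iff {f : ℂ → Matrix (Fin 3) (Fin 3) ℂ} :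
    Differentiable ℂ f ↔ ∀ i j, Differentiable ℂ fun z => f z i j := by
  constructor
  · intro h i j
    let L : Matrix (Fin 3) (Fin 3) ℂ →ₗ[ℂ] ℂ := Matrix.entryLinearMap ℂ ℂ i j
    exact (L.toContinuousLinearMap.differentiable).comp h
  · intro h
    have : f = fun z => ∑ i, ∑ j, f z i j • Matrix.single i j (1 : ℂ) := by
      funext z
      conv_lhs => rw [Matrix.matrix_eq_sum_single (f z)]
      simp [Matrix.smul_single]
    rw [this]
    exact Differentiable.fun_sum fun i _ => Differentiable.fun_sum fun j _ =>
      (h i j).smul_const _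

lemma differentiable_adjugate {f : ℂ → Matrix (Fin 3) (Fin 3) ℂ} (h : Differentiable ℂ f) :
    Differentiable ℂ fun z => (f z).adjugate := by
  rw [differentiable_matrix_iff] at h ⊢
  intro i j
  simp only [Matrix.adjugate_fin_three]
  fin_cases i <;> fin_cases j <;> simp <;> fun_prop

/-! ### The jump matrices -/

lemma det_stokes (s₁ s₃ : ℂ) (k : Fin 6) : (stokes s₁ s₃ k).det = 1 := by
  fin_cases k <;> simp [stokes, Matrix.det_fin_three]

lemma stokes_sub_one (s₁ s₃ : ℂ) (k : Fin 6) : stokes s₁ s₃ k - 1 =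
    (![!![0, 0, 0; s₁, 0, s₃; 0, 0, 0],
      !![0, 0, 0; 0, 0, 0; -(starRingEnd ℂ) s₁, -(starRingEnd ℂ) s₃, 0],
      !![0, s₃, s₁; 0, 0, 0; 0, 0, 0],
      !![0, 0, 0; -(starRingEnd ℂ) s₃, 0, -(starRingEnd ℂ) s₁; 0, 0, 0],
      !![0, 0, 0; 0, 0, 0; s₃, s₁, 0],
      !![0, -(starRingEnd ℂ) s₁, -(starRingEnd ℂ) s₃; 0, 0, 0; 0, 0, 0]] :
      Fin 6 → Matrix (Fin 3) (Fin 3) ℂ) k := by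
  rw [Matrix.one_fin_three]
  ext i j
  fin_cases k <;> fin_cases i <;> fin_cases j <;> simp [stokes]

/-- The only row of `S_k - I` that is not zero. -/
def stokesRow : Fin 6 → Fin 3 := ![1, 2, 0, 1, 2, 0]

lemma stokes_sub_one_apply_of_ne (s₁ s₃ : ℂ) (k : Fin 6) {i : Fin 3} (hi : i ≠ stokesRow k)
    (j : Fin 3) : (stokes s₁ s₃ k - 1) i j = 0 := by
  rw [stokes_sub_one]
  fin_cases k <;> fin_cases i <;> first
    | exact absurd rfl hi
    | (fin_cases j <;> simp)

lemma stokes_sub_one_apply_row (s₁ s₃ : ℂ) (k : Fin 6) (i : Fin 3) :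
    (stokes s₁ s₃ k - 1) i (stokesRow k) = 0 := by
  rw [stokes_sub_one]
  fin_cases k <;> fin_cases i <;> simp [stokesRow]

/-- Only one row of `S - I` is not zero, and the diagonal entry of that row is zero; hence the
product vanishes for every diagonal matrix in between. -/
lemma stokes_sub_one_mul_diagonal_mul (s₁ s₃ : ℂ) (k : Fin 6) (d : Fin 3 → ℂ) :
    (stokes s₁ s₃ k - 1) * Matrix.diagonal d * (stokes s₁ s₃ k - 1) = 0 := by
  ext i j
  rw [Matrix.mul_apply]
  refine Finset.sum_eq_zero fun l _ => ?_
  rw [Matrix.mul_diagonal]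
  by_cases hl : l = stokesRow k
  · rw [hl, stokes_sub_one_apply_row]; simp
  · rw [stokes_sub_one_apply_of_ne s₁ s₃ k hl, mul_zero]

lemma norm_stokes_sub_one_apply_le (s₁ s₃ : ℂ) (k : Fin 6) (i j : Fin 3) :
    ‖(stokes s₁ s₃ k - 1) i j‖ ≤ ‖s₁‖ + ‖s₃‖ := by
  have h1 := norm_nonneg s₁
  have h3 := norm_nonneg s₃
  rw [stokes_sub_one]
  fin_cases k <;> fin_cases i <;> fin_cases j <;> simp <;> linarith

/-- A quantity that does not change across any ray is the same in all sectors. -/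
lemma eq_apply_zero_of_eq_sub_one {α : Type*} {g : Fin 6 → α} (h : ∀ k, g k = g (k - 1)) (k : Fin 6) :
    g k = g 0 := by
  have h1 : g 1 = g 0 := h 1
  have h2 : g 2 = g 1 := h 2
  have h3 : g 3 = g 2 := h 3
  have h4 : g 4 = g 3 := h 4
  have h5 : g 5 = g 4 := h 5
  fin_cases k
  exacts [rfl, h1, h2.trans h1, h3.trans (h2.trans h1), h4.trans (h3.trans (h2.trans h1)),
    h5.trans (h4.trans (h3.trans (h2.trans h1)))]

/-- The partial products of six factors close up after one turn if the full product is `1`. -/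
lemma exists_partial_prod {M : Type*} [Monoid M] {S : Fin 6 → M}
    (h : S 0 * S 1 * S 2 * S 3 * S 4 * S 5 = 1) :
    ∃ Q : Fin 6 → M, Q 0 = S 0 ∧ ∀ k, Q k = Q (k - 1) * S k := by
  refine ⟨![S 0, S 0 * S 1, S 0 * S 1 * S 2, S 0 * S 1 * S 2 * S 3, S 0 * S 1 * S 2 * S 3 * S 4,
    S 0 * S 1 * S 2 * S 3 * S 4 * S 5], rfl, fun k => ?_⟩
  fin_cases k
  · change S 0 = (S 0 * S 1 * S 2 * S 3 * S 4 * S 5) * S 0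
    rw [h, one_mul]
  all_goals rfl

/-- The matrix `e^X`, where `X = 3 y z J + (27/4) z² J²`. -/
noncomputable def expX (y : ℝ) (z : ℂ) : Matrix (Fin 3) (Fin 3) ℂ :=
  Matrix.diagonal fun i => Complex.exp (phase y z i)

/-- The matrix `e^{-X}`. -/
noncomputable def expNegX (y : ℝ) (z : ℂ) : Matrix (Fin 3) (Fin 3) ℂ :=
  Matrix.diagonal fun i => Complex.exp (-phase y z i)

lemma expX_mul_expNegX (y : ℝ) (z : ℂ) : expX y z * expNegX y z = 1 := by
  rw [expX, expNegX, Matrix.diagonal_mul_diagonal, ← Matrix.diagonal_one]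
  congr 1; funext i; rw [← Complex.exp_add, add_neg_cancel, Complex.exp_zero]

lemma expNegX_mul_expX (y : ℝ) (z : ℂ) : expNegX y z * expX y z = 1 := by
  rw [expX, expNegX, Matrix.diagonal_mul_diagonal, ← Matrix.diagonal_one]
  congr 1; funext i; rw [← Complex.exp_add, neg_add_cancel, Complex.exp_zero]

lemma jump_eq (s₁ s₃ : ℂ) (k : Fin 6) (y : ℝ) (z : ℂ) :
    jump s₁ s₃ k y z = expX y z * stokes s₁ s₃ k * expNegX y z := rfl

/-- The nilpotent part `v - I` of the jump matrix. -/
noncomputable def jumpSubOne (s₁ s₃ : ℂ) (k : Fin 6) (y : ℝ) (z : ℂ) :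
    Matrix (Fin 3) (Fin 3) ℂ :=
  expX y z * (stokes s₁ s₃ k - 1) * expNegX y z

lemma jump_eq_one_add (s₁ s₃ : ℂ) (k : Fin 6) (y : ℝ) (z : ℂ) :
    jump s₁ s₃ k y z = 1 + jumpSubOne s₁ s₃ k y z := by
  rw [jump_eq, jumpSubOne, mul_sub, sub_mul, mul_one, expX_mul_expNegX, add_sub_cancel]

lemma jumpSubOne_mul_jumpSubOne (s₁ s₃ : ℂ) (k : Fin 6) (y y' : ℝ) (z : ℂ) :
    jumpSubOne s₁ s₃ k y z * jumpSubOne s₁ s₃ k y' z = 0 := by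
  have h : expNegX y z * expX y' z =
      Matrix.diagonal fun i => Complex.exp (-phase y z i) * Complex.exp (phase y' z i) := by
    rw [expX, expNegX, Matrix.diagonal_mul_diagonal]
  calc _ = expX y z * ((stokes s₁ s₃ k - 1) * (expNegX y z * expX y' z) * (stokes s₁ s₃ k - 1)) *
        expNegX y' z := by simp only [jumpSubOne, mul_assoc]
    _ = 0 := by rw [h, stokes_sub_one_mul_diagonal_mul]; simp

lemma adjugate_jump (s₁ s₃ : ℂ) (k : Fin 6) (y : ℝ) (z : ℂ) :
    (jump s₁ s₃ k y z).adjugate = 1 - jumpSubOne s₁ s₃ k y z := by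
  have hdet : (jump s₁ s₃ k y z).det = 1 := by
    have h := congr_arg Matrix.det (expX_mul_expNegX y z)
    rw [Matrix.det_mul, Matrix.det_one] at h
    rw [jump_eq, Matrix.det_mul, Matrix.det_mul, det_stokes, mul_one, h]
  have h1 : jump s₁ s₃ k y z * (1 - jumpSubOne s₁ s₃ k y z) = 1 := by
    rw [jump_eq_one_add, add_mul, one_mul, mul_sub, mul_one, jumpSubOne_mul_jumpSubOne]; abel
  have h2 := Matrix.adjugate_mul (jump s₁ s₃ k y z)
  rw [hdet, one_smul] at h2
  calc _ = (jump s₁ s₃ k y z).adjugate * (jump s₁ s₃ k y z * (1 - jumpSubOne s₁ s₃ k y z)) := by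
        rw [h1, mul_one]
    _ = _ := by rw [← mul_assoc, h2, one_mul]

lemma jumpSubOne_apply (s₁ s₃ : ℂ) (k : Fin 6) (y : ℝ) (z : ℂ) (i j : Fin 3) :
    jumpSubOne s₁ s₃ k y z i j =
      Complex.exp (phase y z i - phase y z j) * (stokes s₁ s₃ k - 1) i j := by
  rw [jumpSubOne, expX, expNegX, Matrix.mul_diagonal, Matrix.diagonal_mul,
    sub_eq_add_neg (phase y z i), Complex.exp_add]
  ring

end Matrices


/-! ### The continuation of a solution out of the sectors -/

section Pieces

open Matrix Set

lemma mul_diagonal_mul_apply (A B : Matrix (Fin 3) (Fin 3) ℂ) (d : Fin 3 → ℂ) (i j : Fin 3) :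
    (A * Matrix.diagonal d * B) i j = ∑ l, A i l * d l * B l j := by
  rw [Matrix.mul_apply]
  exact Finset.sum_congr rfl fun l _ => by rw [Matrix.mul_diagonal]

lemma mul_adjugate_of_det_eq_one {A : Matrix (Fin 3) (Fin 3) ℂ} (h : A.det = 1) :
    A * A.adjugate = 1 := by
  rw [Matrix.mul_adjugate, h, one_smul]

lemma adjugate_mul_of_det_eq_one {A : Matrix (Fin 3) (Fin 3) ℂ} (h : A.det = 1) :
    A.adjugate * A = 1 := by
  rw [Matrix.adjugate_mul, h, one_smul]

/-- The functions `m e^X Q⁻¹`, with a constant matrix `Q` in each sector, are the restriction of one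
entire function. -/
lemma IsSolution.exists_entire {s₁ s₃ : ℂ} {y : ℝ} {m : ℂ → Matrix (Fin 3) (Fin 3) ℂ}
    (hm : IsSolution s₁ s₃ y m) {Q : Fin 6 → Matrix (Fin 3) (Fin 3) ℂ}
    (hQ : ∀ k, Q k = Q (k - 1) * stokes s₁ s₃ k) :
    ∃ G : ℂ → Matrix (Fin 3) (Fin 3) ℂ, (∀ i j, Differentiable ℂ fun z => G z i j) ∧
      ∀ k, ∀ z ∈ openSector k, G z = m z * expX y z * (Q k).adjugate := by
  classical
  set idx : ℂ → Fin 6 := fun z => if h : ∃ k, z ∈ openSector k then h.choose else 0 with hidx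
  have hidx_eq : ∀ k, ∀ z ∈ openSector k, idx z = k := by
    intro k z hz
    have h : ∃ k, z ∈ openSector k := ⟨k, hz⟩
    simp only [hidx, dif_pos h]
    exact openSector_injective h.choose_spec hz
  set F : ℂ → Matrix (Fin 3) (Fin 3) ℂ := fun z => m z * expX y z * (Q (idx z)).adjugate with hF
  have hFk : ∀ k, ∀ z ∈ openSector k, F z = m z * expX y z * (Q k).adjugate := by
    intro k z hz
    simp only [hF, hidx_eq k z hz]
  have hexp : ∀ l, Differentiable ℂ fun z => Complex.exp (phase y z l) := by
    intro l; unfold phase; fun_prop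
  have hentry : ∀ i j, ∃ g : ℂ → ℂ, Differentiable ℂ g ∧ ∀ z ∉ contour, g z = F z i j := by
    intro i j
    refine exists_entire_extension ?_ ?_ ?_
    · intro z hz
      obtain ⟨k, hk⟩ := mem_openSector_of_notMem_contour hz
      have hn := (isOpen_openSector k).mem_nhds hk
      have hd : DifferentiableAt ℂ (fun z => (m z * expX y z * (Q k).adjugate) i j) z := by
        simp only [expX, mul_diagonal_mul_apply]
        refine DifferentiableAt.fun_sum fun l _ => ?_
        have h1 : DifferentiableAt ℂ (fun z => m z i l) z :=
          (hm.analytic i l).differentiableAt (isOpen_compl_contour.mem_nhds hz)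
        exact (h1.mul (hexp l z)).mul_const _
      refine (hd.congr_of_eventuallyEq ?_).differentiableWithinAt
      filter_upwards [hn] with w hw
      rw [hFk k w hw]
    · intro j' r hr
      obtain ⟨mp, mm, hp, hmm, hrel⟩ := hm.jump_rel j' r hr
      rw [← pt_zero_right] at hp hmm hrel
      obtain ⟨ε, hε, hball⟩ := exists_ball_ray j' hr
      have hX : Continuous fun z => expX y z :=
        Continuous.matrix_diagonal (continuous_pi fun l => (hexp l).continuous)
      have hlim : ∀ (s : Set ℂ) (k : Fin 6) (M : Matrix (Fin 3) (Fin 3) ℂ),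
          (∀ z ∈ Metric.ball (pt j' r 0) ε, z ∈ s → z ∈ openSector k) →
          Tendsto m (𝓝[s] (pt j' r 0)) (𝓝 M) →
          Tendsto (fun z => F z i j) (𝓝[s] (pt j' r 0))
            (𝓝 ((M * expX y (pt j' r 0) * (Q k).adjugate) i j)) := by
        intro s k M hs hM
        have h1 : Tendsto (fun z => m z * expX y z * (Q k).adjugate) (𝓝[s] (pt j' r 0))
            (𝓝 (M * expX y (pt j' r 0) * (Q k).adjugate)) :=
          (hM.mul (hX.continuousWithinAt (s := s))).mul tendsto_const_nhds
        have h2 := ((continuous_id.matrix_elem i j).tendsto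
          (M * expX y (pt j' r 0) * (Q k).adjugate)).comp h1
        refine h2.congr' ?_
        filter_upwards [self_mem_nhdsWithin,
          mem_nhdsWithin_of_mem_nhds (Metric.ball_mem_nhds _ hε)] with w hw1 hw2
        simp only [Function.comp, id, hFk k w (hs w hw2 hw1)]
      refine ⟨_, hlim _ j' mp (fun z hz => (hball z hz).2.1) hp, ?_⟩
      have heq : mp * expX y (pt j' r 0) * (Q j').adjugate =
          mm * expX y (pt j' r 0) * (Q (j' - 1)).adjugate := by
        rw [hrel, jump_eq, hQ j', Matrix.adjugate_mul_distrib]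
        calc _ = mm * expX y (pt j' r 0) * (stokes s₁ s₃ j' *
              (expNegX y (pt j' r 0) * expX y (pt j' r 0)) * (stokes s₁ s₃ j').adjugate) *
              (Q (j' - 1)).adjugate := by simp only [mul_assoc]
          _ = _ := by
            rw [expNegX_mul_expX, mul_one, mul_adjugate_of_det_eq_one (det_stokes s₁ s₃ j'),
              mul_one]
      rw [heq]
      exact hlim _ (j' - 1) mm (fun z hz => (hball z hz).2.2) hmm
    · simp only [hF, expX, mul_diagonal_mul_apply]
      refine IsBigO.fun_sum fun l _ => ?_
      have h1 := hm.at_zero i l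
      have h2 : (fun z => Complex.exp (phase y z l)) =O[𝓝 0 ⊓ 𝓟 contourᶜ] fun _ => (1 : ℂ) :=
        (((hexp l).continuous.tendsto 0).isBigO_one ℂ).mono inf_le_left
      have h3 : (fun z => (Q (idx z)).adjugate l j) =O[𝓝 0 ⊓ 𝓟 contourᶜ] fun _ => (1 : ℂ) := by
        refine IsBigO.of_bound (∑ k, ‖(Q k).adjugate l j‖) (Eventually.of_forall fun z => ?_)
        rw [norm_one, mul_one]
        exact Finset.single_le_sum (f := fun k => ‖(Q k).adjugate l j‖)
          (fun _ _ => norm_nonneg _) (Finset.mem_univ _)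
      simpa using (h1.mul h2).mul h3
  choose g hg hgF using hentry
  refine ⟨fun z => Matrix.of fun i j => g i j z, fun i j => hg i j, fun k z hz => ?_⟩
  ext i j
  change g i j z = _
  rw [hgF i j z (notMem_contour_of_mem_openSector hz), hFk k z hz]

open scoped Matrix.Norms.Operator

/-- The functions that a solution of the Riemann–Hilbert problem induces in the six sectors,
continued to entire functions. -/
structure SolutionPieces (s₁ s₃ : ℂ) (y : ℝ) (M : Fin 6 → ℂ → Matrix (Fin 3) (Fin 3) ℂ) :
    Prop where
  differentiable : ∀ k, Differentiable ℂ (M k)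
  jump : ∀ k z, M k z = M (k - 1) z * jump s₁ s₃ k y z
  det : ∀ k z, (M k z).det = 1
  tendsto : ∀ k, ∀ e > 0, ∃ R, ∀ r ≥ R, ∀ t ∈ Icc 0 (Real.pi / 3), ‖M k (pt k r t) - 1‖ ≤ e

lemma det_jump (s₁ s₃ : ℂ) (k : Fin 6) (y : ℝ) (z : ℂ) : (PIVModel.jump s₁ s₃ k y z).det = 1 := by
  have h := congr_arg Matrix.det (expX_mul_expNegX y z)
  rw [Matrix.det_mul, Matrix.det_one] at h
  rw [jump_eq, Matrix.det_mul, Matrix.det_mul, det_stokes, mul_one, h]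

/-- The convergence at infinity extends from the open sectors to their closures by continuity. -/
lemma tendsto_of_at_infty {m : ℂ → Matrix (Fin 3) (Fin 3) ℂ}
    (h : ∀ i k, (fun z => (m z - 1) i k) =O[cobounded ℂ ⊓ 𝓟 contourᶜ] (fun z => z⁻¹))
    {k : Fin 6} {M : ℂ → Matrix (Fin 3) (Fin 3) ℂ} (hM : Continuous M)
    (hmM : ∀ z ∈ openSector k, m z = M z) :
    ∀ e > 0, ∃ R, ∀ r ≥ R, ∀ t ∈ Icc 0 (Real.pi / 3), ‖M (pt k r t) - 1‖ ≤ e := by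
  have hpi := Real.pi_pos
  intro e he
  have hsmall : ∀ i j, ∀ᶠ z in cobounded ℂ ⊓ 𝓟 contourᶜ, ‖(m z - 1) i j‖ < e / 3 := by
    intro i j
    have h0 : Tendsto (fun z : ℂ => z⁻¹) (cobounded ℂ ⊓ 𝓟 contourᶜ) (𝓝 0) :=
      tendsto_inv₀_cobounded.mono_left inf_le_left
    have := ((h i j).trans_tendsto h0).norm
    rw [norm_zero] at this
    exact this.eventually_lt_const (by positivity)
  have hall : ∀ᶠ z in cobounded ℂ ⊓ 𝓟 contourᶜ, ∀ i j, ‖(m z - 1) i j‖ < e / 3 :=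
    eventually_all.2 fun i => eventually_all.2 fun j => hsmall i j
  rw [eventually_inf_principal, ← comap_norm_atTop, eventually_comap] at hall
  obtain ⟨R, hR⟩ := eventually_atTop.1 hall
  refine ⟨max R 1, fun r hr t ht => ?_⟩
  have hr1 : R ≤ r := (le_max_left _ _).trans hr
  have hr0 : 0 < r := by linarith [(le_max_right R 1).trans hr]
  have hopen : ∀ t ∈ Ioo 0 (Real.pi / 3), ‖M (pt k r t) - 1‖ ≤ e := by
    intro t ht
    have hs := pt_mem_openSector (k := k) hr0 ht.1 ht.2
    rw [← hmM _ hs]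
    have := norm_le_of_entry_le (A := m (pt k r t) - 1) (c := e / 3) (by positivity)
      fun i j => (hR r hr1 _ (norm_pt_of_pos k hr0 t) (notMem_contour_of_mem_openSector hs) i j).le
    linarith
  have hcl : IsClosed {t | ‖M (pt k r t) - 1‖ ≤ e} :=
    isClosed_le ((hM.comp ((continuous_pt k).comp
      (continuous_const.prodMk continuous_id))).sub continuous_const).norm continuous_const
  have := closure_minimal (s := Ioo 0 (Real.pi / 3)) hopen hcl
  rw [closure_Ioo (by positivity)] at this
  exact this ht

/-- A function of the sectors that is one entire function and tends to `c` at infinity is equal to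
`c`. -/
lemma eq_of_tendsto_in_sectors {E : Type*} [NormedAddCommGroup E] [NormedSpace ℂ E] {d : ℂ → E}
    (hd : Differentiable ℂ d) {c : E}
    (h : ∀ k : Fin 6, ∀ e > 0, ∃ R, ∀ r ≥ R, ∀ t ∈ Icc 0 (Real.pi / 3), ‖d (pt k r t) - c‖ ≤ e)
    (z : ℂ) : d z = c := by
  refine hd.apply_eq_of_tendsto_cocompact z ?_
  rw [← Metric.cobounded_eq_cocompact, Metric.tendsto_nhds]
  intro e he
  choose R hR using fun k => h k (e / 2) (by positivity)
  rw [← comap_norm_atTop, eventually_comap]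
  filter_upwards [eventually_ge_atTop (∑ k, |R k| + 1)] with x hx w hw
  have hsum : ∀ k, R k ≤ x := fun k => by
    have := Finset.single_le_sum (f := fun k => |R k|) (fun _ _ => abs_nonneg _)
      (Finset.mem_univ k)
    linarith [le_abs_self (R k)]
  have hx1 : 0 < x := by
    have : 0 ≤ ∑ k, |R k| := Finset.sum_nonneg fun _ _ => abs_nonneg _
    linarith
  obtain ⟨k, r, t, hr, h0, h1, rfl⟩ := exists_pt (z := w) (by rw [← norm_pos_iff, hw]; exact hx1)
  rw [norm_pt_of_pos k hr] at hw
  subst hw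
  rw [dist_eq_norm]
  exact (hR k r (hsum k) t ⟨h0, h1.le⟩).trans_lt (by linarith)

/-- A solution continues from each sector to an entire function. The determinant is unchanged
across the rays, and is therefore an entire function that tends to `1`. -/
theorem IsSolution.exists_pieces {s₁ s₃ : ℂ} {y : ℝ} {m : ℂ → Matrix (Fin 3) (Fin 3) ℂ}
    (hs : stokes s₁ s₃ 0 * stokes s₁ s₃ 1 * stokes s₁ s₃ 2 *
      stokes s₁ s₃ 3 * stokes s₁ s₃ 4 * stokes s₁ s₃ 5 = 1)
    (hm : IsSolution s₁ s₃ y m) :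
    ∃ M, SolutionPieces s₁ s₃ y M ∧ ∀ k, ∀ z ∈ openSector k, m z = M k z := by
  obtain ⟨Q, hQ0, hQ⟩ := exists_partial_prod hs
  have hQdet : ∀ k, (Q k).det = 1 := by
    intro k
    have := eq_apply_zero_of_eq_sub_one (g := fun k => (Q k).det)
      (fun k => by simp only [hQ k, Matrix.det_mul, det_stokes, mul_one]) k
    rw [this, hQ0, det_stokes]
  obtain ⟨G, hG, hGm⟩ := hm.exists_entire hQ
  set M : Fin 6 → ℂ → Matrix (Fin 3) (Fin 3) ℂ := fun k z => G z * Q k * expNegX y z with hM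
  have hmM : ∀ k, ∀ z ∈ openSector k, m z = M k z := by
    intro k z hz
    simp only [hM, hGm k z hz]
    rw [mul_assoc (m z * expX y z), adjugate_mul_of_det_eq_one (hQdet k), mul_one, mul_assoc,
      expX_mul_expNegX, mul_one]
  have hMd : ∀ k, Differentiable ℂ (M k) := by
    intro k
    rw [differentiable_matrix_iff]
    intro i j
    have hMij : (fun z => M k z i j) =
        fun z => (∑ l, G z i l * Q k l j) * Complex.exp (-phase y z j) := by
      funext z
      simp only [hM, expNegX]
      rw [Matrix.mul_diagonal, Matrix.mul_apply]
    rw [hMij]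
    have hexp : Differentiable ℂ fun z => Complex.exp (-phase y z j) := by unfold phase; fun_prop
    exact (Differentiable.fun_sum fun l _ => (hG i l).mul_const _).mul hexp
  have hjump : ∀ k z, M k z = M (k - 1) z * PIVModel.jump s₁ s₃ k y z := by
    intro k z
    simp only [hM]
    rw [jump_eq, hQ k]
    calc _ = G z * Q (k - 1) * 1 * stokes s₁ s₃ k * expNegX y z := by
          simp only [mul_assoc, one_mul]
      _ = _ := by rw [← expNegX_mul_expX y z]; simp only [mul_assoc]
  have htend : ∀ k, ∀ e > 0, ∃ R, ∀ r ≥ R, ∀ t ∈ Icc 0 (Real.pi / 3),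
      ‖M k (pt k r t) - 1‖ ≤ e := fun k =>
    tendsto_of_at_infty hm.at_infty (hMd k).continuous (hmM k)
  have hdetk : ∀ k z, (M k z).det = (M 0 z).det := fun k z =>
    eq_apply_zero_of_eq_sub_one (g := fun k => (M k z).det)
      (fun k => by rw [hjump k z, Matrix.det_mul, det_jump, mul_one]) k
  have hdet0 : ∀ z, (M 0 z).det = 1 := by
    refine fun z => eq_of_tendsto_in_sectors (d := fun z => (M 0 z).det) ?_ ?_ z
    · have := differentiable_matrix_iff.1 (hMd 0)
      simp only [Matrix.det_fin_three]
      fun_prop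
    · intro k e he
      have hc : ContinuousAt (fun A : Matrix (Fin 3) (Fin 3) ℂ => A.det) 1 :=
        (continuous_id.matrix_det).continuousAt
      obtain ⟨δ, hδ, hball⟩ := Metric.continuousAt_iff.1 hc e he
      obtain ⟨R, hR⟩ := htend k (δ / 2) (by positivity)
      refine ⟨R, fun r hr t ht => ?_⟩
      have := hball (x := M k (pt k r t))
        (by rw [dist_eq_norm]; exact (hR r hr t ht).trans_lt (by linarith))
      simp only [Matrix.det_one, dist_eq_norm] at this
      rw [← hdetk k]
      exact this.le
  exact ⟨M, ⟨hMd, hjump, fun k z => (hdetk k z).trans (hdet0 z), htend⟩, hmM⟩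

end Pieces


/-! ### The Gaussian weight -/

section Estimates

open Matrix Set MeasureTheory
open scoped Matrix.Norms.Operator

/-- The Gaussian weight that bounds the jumps in a wedge about each ray. -/
noncomputable def gauss (K r : ℝ) : ℝ := Real.exp (K * r - 5 * r ^ 2)

lemma gauss_pos (K r : ℝ) : 0 < gauss K r := Real.exp_pos _

lemma integrableOn_pow_mul_gauss (K : ℝ) (n : ℕ) :
    IntegrableOn (fun r => r ^ n * gauss K r) (Ioi 0) := by
  have h := (integrableOn_rpow_mul_exp_neg_mul_sq (b := 1) one_pos (s := n)
    (by have : (0 : ℝ) ≤ n := n.cast_nonneg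
        linarith)).const_mul (Real.exp (K ^ 2 / 16))
  refine h.mono' (by unfold gauss; fun_prop) ((ae_restrict_mem measurableSet_Ioi).mono
    fun r hr => ?_)
  have hr0 : 0 < r := hr
  rw [Real.rpow_natCast, Real.norm_of_nonneg (mul_nonneg (pow_nonneg hr0.le n) (gauss_pos K r).le)]
  have : gauss K r ≤ Real.exp (K ^ 2 / 16) * Real.exp (-1 * r ^ 2) := by
    rw [gauss, ← Real.exp_add]
    refine Real.exp_le_exp.2 ?_
    nlinarith [sq_nonneg (K / 4 - 2 * r)]
  calc _ ≤ r ^ n * (Real.exp (K ^ 2 / 16) * Real.exp (-1 * r ^ 2)) := by gcongr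
    _ = _ := by ring

lemma tendsto_gauss (K : ℝ) : Tendsto (gauss K) atTop (𝓝 0) := by
  refine Real.tendsto_exp_atBot.comp ?_
  refine tendsto_atBot_mono' atTop ?_ tendsto_neg_atTop_atBot
  filter_upwards [eventually_ge_atTop (max 1 (K + 1))] with r hr
  have h1 : 1 ≤ r := (le_max_left _ _).trans hr
  have h2 : K + 1 ≤ r := (le_max_right _ _).trans hr
  nlinarith

lemma mul_gauss_le (K r : ℝ) : r * gauss K r ≤ gauss (K + 1) r := by
  have h1 : gauss (K + 1) r = Real.exp r * gauss K r := by
    rw [gauss, gauss, ← Real.exp_add]; ring_nf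
  rw [h1]
  have h2 : r ≤ Real.exp r := by linarith [Real.add_one_le_exp r]
  exact mul_le_mul_of_nonneg_right h2 (gauss_pos K r).le

/-! ### Exponential decay in the wedges -/

lemma omega_eq : omega = -1 / 2 + √3 / 2 * Complex.I := by
  have h : omega = Complex.exp ((2 * Real.pi / 3 : ℝ) * Complex.I) := by
    rw [omega]; congr 1; push_cast; ring
  have h2 : 2 * Real.pi / 3 = Real.pi - Real.pi / 3 := by ring
  rw [h, Complex.exp_mul_I, ← Complex.ofReal_cos, ← Complex.ofReal_sin, h2, Real.cos_pi_sub,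
    Real.sin_pi_sub, Real.cos_pi_div_three, Real.sin_pi_div_three]
  push_cast; ring

lemma sqrt_three_sq : ((√3 : ℝ) : ℂ) ^ 2 = 3 := by
  exact_mod_cast Real.sq_sqrt (show (0 : ℝ) ≤ 3 by norm_num)

lemma omega_sq_add : omega ^ 2 + omega + 1 = 0 := by
  rw [omega_eq]
  linear_combination (1 / 4 * Complex.I ^ 2) * sqrt_three_sq + (3 / 4) * Complex.I_sq

lemma omega_cube : omega ^ 3 = 1 := by
  linear_combination (omega - 1) * omega_sq_add

lemma dir_sq (k : Fin 6) : dir k ^ 2 = -omega ^ ((k : ℕ) + 2) := by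
  have h : -omega ^ ((k : ℕ) + 2) =
      Complex.exp (Real.pi * Complex.I) * omega ^ ((k : ℕ) + 2) := by
    rw [Complex.exp_pi_mul_I]; ring
  rw [h, omega, ← Complex.exp_nat_mul, ← Complex.exp_add, dir, ← Complex.exp_nat_mul,
    Complex.exp_eq_exp_iff_exists_int]
  exact ⟨-1, by push_cast; ring⟩

/-- The exponents of the nonzero entries of the jump matrix on a ray. -/
lemma J_sq_sub_mul_dir_sq (k : Fin 6) {j : Fin 3} (hj : j ≠ stokesRow k) :
    (J (stokesRow k) ^ 2 - J j ^ 2) * dir k ^ 2 = omega - 1 ∨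
      (J (stokesRow k) ^ 2 - J j ^ 2) * dir k ^ 2 = omega ^ 2 - 1 := by
  have h3 := omega_cube
  have h4 : omega ^ 4 = omega := by linear_combination omega * h3
  have h5 : omega ^ 5 = omega ^ 2 := by linear_combination omega ^ 2 * h3
  have h6 : omega ^ 6 = 1 := by linear_combination (omega ^ 3 + 1) * h3
  have h7 : omega ^ 7 = omega := by linear_combination (omega ^ 3 + 1) * omega * h3
  have h8 : omega ^ 8 = omega ^ 2 := by linear_combination (omega ^ 3 + 1) * omega ^ 2 * h3
  have h9 : omega ^ 9 = 1 := by linear_combination (omega ^ 6 + omega ^ 3 + 1) * h3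
  have h10 : omega ^ 10 = omega := by linear_combination (omega ^ 6 + omega ^ 3 + 1) * omega * h3
  have h11 : omega ^ 11 = omega ^ 2 := by
    linear_combination (omega ^ 6 + omega ^ 3 + 1) * omega ^ 2 * h3
  rw [dir_sq]
  fin_cases k <;> fin_cases j <;> first
    | exact absurd rfl hj
    | (simp only [stokesRow, J]; simp; ring_nf
       try simp only [h3, h4, h5, h6, h7, h8, h9, h10, h11, true_or, or_true]
       try first
         | (left; ring1)
         | (right; ring1))

lemma norm_J (i : Fin 3) : ‖J i‖ = 1 := by
  have h : ‖omega‖ = 1 := by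
    rw [omega, show (2 * Real.pi * Complex.I / 3 : ℂ) = (2 * Real.pi / 3 : ℝ) * Complex.I by
      push_cast; ring, Complex.norm_exp_ofReal_mul_I]
  fin_cases i <;> simp [J, h]

/-- In a wedge of half-opening `π / 12` the quadratic part of the exponents decays like `-5 r²`. On
the ray itself the real part is `-(81/8) r²`. -/
lemma quadratic_phase_re_le (k : Fin 6) {j : Fin 3} (hj : j ≠ stokesRow k) {r t : ℝ}
    (ht : |t| ≤ Real.pi / 12) :
    (27 / 4 * pt k r t ^ 2 * (J (stokesRow k) ^ 2 - J j ^ 2)).re ≤ -(5 * r ^ 2) := by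
  have hpi := Real.pi_pos
  have hs3 : (1.7 : ℝ) ≤ √3 := Real.le_sqrt_of_sq_le (by norm_num)
  have hs3' : √3 ^ 2 = 3 := Real.sq_sqrt (by norm_num)
  have hcos : √3 / 2 ≤ Real.cos (2 * t) := by
    rw [← Real.cos_pi_div_six, ← Real.cos_abs (2 * t)]
    refine Real.cos_le_cos_of_nonneg_of_le_pi (abs_nonneg _) (by linarith) ?_
    rw [abs_mul, abs_two]; linarith
  have hsin : |Real.sin (2 * t)| ≤ 1 / 2 := by
    have h1 := Real.sin_sq_add_cos_sq (2 * t)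
    rw [abs_le]; constructor <;> nlinarith
  have he : Complex.exp (t * Complex.I) ^ 2 = Complex.exp ((2 * t : ℝ) * Complex.I) := by
    rw [← Complex.exp_nat_mul]; congr 1; push_cast; ring
  have key : ∀ s : ℝ, |s| = 1 → ((27 / 4 * r ^ 2 : ℝ) * ((-3 / 2 + (s * √3 / 2 : ℝ) * Complex.I) *
      Complex.exp ((2 * t : ℝ) * Complex.I))).re ≤ -(5 * r ^ 2) := by
    intro s hs
    rw [Complex.re_ofReal_mul, Complex.mul_re, Complex.exp_ofReal_mul_I_re,
      Complex.exp_ofReal_mul_I_im]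
    have e1 : (-3 / 2 + (s * √3 / 2 : ℝ) * Complex.I : ℂ).re = -3 / 2 := by
      rw [Complex.add_re, Complex.re_ofReal_mul, Complex.I_re]; norm_num
    have e2 : (-3 / 2 + (s * √3 / 2 : ℝ) * Complex.I : ℂ).im = s * √3 / 2 := by
      rw [Complex.add_im, Complex.im_ofReal_mul, Complex.I_im]; norm_num
    rw [e1, e2]
    have h1 : -(s * Real.sin (2 * t)) ≤ 1 / 2 := by
      refine (neg_le_abs _).trans ?_
      rw [abs_mul, hs, one_mul]; exact hsin
    have h2 : -3 / 2 * Real.cos (2 * t) - s * √3 / 2 * Real.sin (2 * t) ≤ -(√3 / 2) := by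
      nlinarith
    have h3 : -3 / 2 * Real.cos (2 * t) - s * √3 / 2 * Real.sin (2 * t) ≤ -(20 / 27) := by linarith
    nlinarith [sq_nonneg r]
  have hz : ∀ c : ℂ, (J (stokesRow k) ^ 2 - J j ^ 2) * dir k ^ 2 = c →
      27 / 4 * pt k r t ^ 2 * (J (stokesRow k) ^ 2 - J j ^ 2) =
      (27 / 4 * r ^ 2 : ℝ) * (c * Complex.exp ((2 * t : ℝ) * Complex.I)) := by
    intro c hc
    rw [← he, ← hc, pt]; push_cast; ring
  rcases J_sq_sub_mul_dir_sq k hj with h | h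
  · rw [hz _ h]
    convert key 1 (by simp) using 4
    rw [omega_eq]; push_cast; ring
  · rw [hz _ h]
    convert key (-1) (by simp) using 4
    have := omega_sq_add
    rw [show omega ^ 2 - 1 = -omega - 2 by linear_combination this, omega_eq]; push_cast; ring

lemma norm_linear_phase_le (k : Fin 6) (i j : Fin 3) {r : ℝ} (hr : 0 < r) (t : ℝ) :
    ‖3 * pt k r t * (J i - J j)‖ ≤ 6 * r := by
  rw [norm_mul, norm_mul, norm_pt_of_pos k hr]
  have : ‖J i - J j‖ ≤ 2 := (norm_sub_le _ _).trans (by rw [norm_J, norm_J]; norm_num)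
  have h3 : ‖(3 : ℂ)‖ = 3 := by norm_num
  rw [h3]; nlinarith

lemma norm_exp_sub_one_le_mul (u : ℂ) : ‖Complex.exp u - 1‖ ≤ ‖u‖ * Real.exp ‖u‖ := by
  simpa using Complex.norm_exp_sub_sum_le_norm_mul_exp u 1

/-- Gaussian decay of `v - I` in the wedge; the constant `K` absorbs the part of the exponents that
is linear in `z`. -/
lemma norm_jumpSubOne_le (s₁ s₃ : ℂ) (k : Fin 6) {y K : ℝ} (hK : 6 * |y| ≤ K) {r t : ℝ}
    (hr : 0 < r) (ht : |t| ≤ Real.pi / 12) :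
    ‖jumpSubOne s₁ s₃ k y (pt k r t)‖ ≤ 3 * (‖s₁‖ + ‖s₃‖) * gauss K r := by
  have hσ : 0 ≤ ‖s₁‖ + ‖s₃‖ := by positivity
  rw [mul_assoc]
  refine norm_le_of_entry_le (mul_nonneg hσ (gauss_pos K r).le) fun i j => ?_
  rw [jumpSubOne_apply, norm_mul]
  by_cases hi : i = stokesRow k
  · subst hi
    by_cases hj : j = stokesRow k
    · rw [hj, stokes_sub_one_apply_row, norm_zero, mul_zero]
      exact mul_nonneg hσ (gauss_pos K r).le
    · have h1 := quadratic_phase_re_le k hj (r := r) ht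
      have h2 := norm_linear_phase_le k (stokesRow k) j hr t
      have h3 : ‖Complex.exp (phase y (pt k r t) (stokesRow k) - phase y (pt k r t) j)‖ ≤
          gauss K r := by
        rw [Complex.norm_exp, gauss]
        refine Real.exp_le_exp.2 ?_
        have e : phase y (pt k r t) (stokesRow k) - phase y (pt k r t) j =
            y * (3 * pt k r t * (J (stokesRow k) - J j)) +
            27 / 4 * pt k r t ^ 2 * (J (stokesRow k) ^ 2 - J j ^ 2) := by
          unfold phase; ring
        rw [e, Complex.add_re]
        have h4 : (y * (3 * pt k r t * (J (stokesRow k) - J j)) : ℂ).re ≤ |y| * (6 * r) := by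
          refine (Complex.re_le_norm _).trans ?_
          rw [norm_mul, Complex.norm_real, Real.norm_eq_abs]
          gcongr
        nlinarith
      rw [mul_comm]
      exact mul_le_mul (norm_stokes_sub_one_apply_le s₁ s₃ k _ j) h3 (norm_nonneg _) hσ
  · rw [stokes_sub_one_apply_of_ne s₁ s₃ k hi, norm_zero, mul_zero]
    exact mul_nonneg hσ (gauss_pos K r).le

/-- The jump matrices depend on `y` in a Lipschitz way, with a constant that vanishes at the
origin. -/
lemma norm_jumpSubOne_sub_le (s₁ s₃ : ℂ) (k : Fin 6) {y y₀ : ℝ} (hy : |y - y₀| ≤ 1) {r t : ℝ}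
    (hr : 0 < r) (ht : |t| ≤ Real.pi / 12) :
    ‖jumpSubOne s₁ s₃ k y (pt k r t) - jumpSubOne s₁ s₃ k y₀ (pt k r t)‖ ≤
      18 * (‖s₁‖ + ‖s₃‖) * |y - y₀| * (r * gauss (6 * |y₀| + 6) r) := by
  have hσ : 0 ≤ ‖s₁‖ + ‖s₃‖ := by positivity
  have hg := (gauss_pos (6 * |y₀| + 6) r).le
  rw [show 18 * (‖s₁‖ + ‖s₃‖) * |y - y₀| * (r * gauss (6 * |y₀| + 6) r) =
    3 * ((‖s₁‖ + ‖s₃‖) * (6 * |y - y₀| * r * gauss (6 * |y₀| + 6) r)) by ring]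
  refine norm_le_of_entry_le (by positivity) fun i j => ?_
  rw [Matrix.sub_apply, jumpSubOne_apply, jumpSubOne_apply, ← sub_mul, norm_mul]
  by_cases hi : i = stokesRow k
  · subst hi
    by_cases hj : j = stokesRow k
    · rw [hj, stokes_sub_one_apply_row, norm_zero, mul_zero]
      positivity
    · have h1 := quadratic_phase_re_le k hj (r := r) ht
      have h2 := norm_linear_phase_le k (stokesRow k) j hr t
      set β := 3 * pt k r t * (J (stokesRow k) - J j) with hβ
      set q := 27 / 4 * pt k r t ^ 2 * (J (stokesRow k) ^ 2 - J j ^ 2) with hq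
      have e : ∀ y : ℝ, phase y (pt k r t) (stokesRow k) - phase y (pt k r t) j =
          y * β + q := by
        intro y; rw [hβ, hq]; unfold phase; ring
      have h3 : ‖Complex.exp (phase y (pt k r t) (stokesRow k) - phase y (pt k r t) j) -
          Complex.exp (phase y₀ (pt k r t) (stokesRow k) - phase y₀ (pt k r t) j)‖ ≤
          6 * |y - y₀| * r * gauss (6 * |y₀| + 6) r := by
        rw [e, e]
        have e2 : Complex.exp (y * β + q) - Complex.exp (y₀ * β + q) =
            Complex.exp q * Complex.exp (y₀ * β) * (Complex.exp ((y - y₀ : ℝ) * β) - 1) := by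
          rw [mul_sub, ← Complex.exp_add, ← Complex.exp_add, mul_one]
          congr 2 <;> push_cast <;> ring
        rw [e2, norm_mul, norm_mul, Complex.norm_exp, Complex.norm_exp]
        have n1 : ‖((y - y₀ : ℝ) : ℂ) * β‖ ≤ |y - y₀| * (6 * r) := by
          rw [norm_mul, Complex.norm_real, Real.norm_eq_abs]; gcongr
        have n2 : ‖((y - y₀ : ℝ) : ℂ) * β‖ ≤ 6 * r := by nlinarith
        have n3 : ‖Complex.exp ((y - y₀ : ℝ) * β) - 1‖ ≤ |y - y₀| * (6 * r) * Real.exp (6 * r) :=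
          (norm_exp_sub_one_le_mul _).trans
            (mul_le_mul n1 (Real.exp_le_exp.2 n2) (Real.exp_pos _).le (by positivity))
        have n4 : (y₀ * β : ℂ).re ≤ |y₀| * (6 * r) := by
          refine (Complex.re_le_norm _).trans ?_
          rw [norm_mul, Complex.norm_real, Real.norm_eq_abs]
          gcongr
        calc _ ≤ Real.exp (-(5 * r ^ 2)) * Real.exp (|y₀| * (6 * r)) *
              (|y - y₀| * (6 * r) * Real.exp (6 * r)) := by
              gcongr
          _ = |y - y₀| * (6 * r) *
              (Real.exp (-(5 * r ^ 2)) * Real.exp (|y₀| * (6 * r)) * Real.exp (6 * r)) := by ring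
          _ = _ := by
              rw [← Real.exp_add, ← Real.exp_add, gauss]
              ring_nf
      rw [mul_comm]
      exact mul_le_mul (norm_stokes_sub_one_apply_le s₁ s₃ k _ j) h3 (norm_nonneg _) hσ
  · rw [stokes_sub_one_apply_of_ne s₁ s₃ k hi, norm_zero, mul_zero]
    positivity

end Estimates


/-! ### Uniform bounds for the solutions -/

section Bounds

open Matrix Set MeasureTheory
open scoped Matrix.Norms.Operator

namespace SolutionPieces

variable {s₁ s₃ : ℂ} {y y₀ : ℝ} {M M₀ : Fin 6 → ℂ → Matrix (Fin 3) (Fin 3) ℂ}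

lemma exists_bound (h : SolutionPieces s₁ s₃ y M) :
    ∃ B, 0 ≤ B ∧ ∀ k r t, 0 < r → t ∈ Icc 0 (Real.pi / 3) → ‖M k (pt k r t)‖ ≤ B := by
  have hk : ∀ k, ∃ B, ∀ r t, 0 < r → t ∈ Icc 0 (Real.pi / 3) → ‖M k (pt k r t)‖ ≤ B := by
    intro k
    obtain ⟨R, hR⟩ := h.tendsto k 1 one_pos
    obtain ⟨C, hC⟩ := (isCompact_closedBall (0 : ℂ) |R|).exists_bound_of_continuousOn
      (h.differentiable k).continuous.continuousOn
    refine ⟨max C (1 + ‖(1 : Matrix (Fin 3) (Fin 3) ℂ)‖), fun r t hr ht => ?_⟩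
    rcases le_total R r with hRr | hRr
    · refine le_max_of_le_right ?_
      have := norm_add_le (M k (pt k r t) - 1) 1
      rw [sub_add_cancel] at this
      linarith [hR r hRr t ht]
    · refine le_max_of_le_left (hC _ ?_)
      rw [mem_closedBall_zero_iff, norm_pt_of_pos k hr]
      exact hRr.trans (le_abs_self R)
  choose B hB using hk
  refine ⟨∑ k, |B k|, Finset.sum_nonneg fun _ _ => abs_nonneg _, fun k r t hr ht => ?_⟩
  have := Finset.single_le_sum (f := fun k => |B k|) (fun _ _ => abs_nonneg _) (Finset.mem_univ k)
  exact (hB k r t hr ht).trans ((le_abs_self _).trans this)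

lemma eq_add (h : SolutionPieces s₁ s₃ y M) (k : Fin 6) (z : ℂ) :
    M k z = M (k - 1) z + M (k - 1) z * jumpSubOne s₁ s₃ k y z := by
  rw [h.jump k z, jump_eq_one_add, mul_add, mul_one]

/-- The difference of adjacent functions in terms of the left one; `eq_add` gives it in terms of the
right one. The two forms agree because `(v - I)² = 0`. -/
lemma sub_eq (h : SolutionPieces s₁ s₃ y M) (k : Fin 6) (z : ℂ) :
    M k z - M (k - 1) z = M k z * jumpSubOne s₁ s₃ k y z := by
  rw [h.eq_add k z, add_mul, mul_assoc, jumpSubOne_mul_jumpSubOne]; simp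

lemma adjugate_eq (h : SolutionPieces s₁ s₃ y M) (k : Fin 6) (z : ℂ) :
    (M k z).adjugate =
      (M (k - 1) z).adjugate - jumpSubOne s₁ s₃ k y z * (M (k - 1) z).adjugate := by
  rw [h.jump k z, Matrix.adjugate_mul_distrib, adjugate_jump, sub_mul, one_mul]

lemma adjugate_sub_eq (h : SolutionPieces s₁ s₃ y M) (k : Fin 6) (z : ℂ) :
    (M (k - 1) z).adjugate =
      (M k z).adjugate + jumpSubOne s₁ s₃ k y z * (M k z).adjugate := by
  rw [h.adjugate_eq k z, mul_sub, ← mul_assoc, jumpSubOne_mul_jumpSubOne]; simp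

/-- In each half of the wedge one of the two adjacent functions is in its own sector, where it is
known to be bounded. -/
lemma norm_le_or {B : ℝ}
    (hB : ∀ k r t, 0 < r → t ∈ Icc 0 (Real.pi / 3) → ‖M k (pt k r t)‖ ≤ B) (k : Fin 6) {r t : ℝ}
    (hr : 0 < r) (ht : |t| ≤ Real.pi / 12) :
    (0 ≤ t → ‖M k (pt k r t)‖ ≤ B) ∧ (t ≤ 0 → ‖M (k - 1) (pt k r t)‖ ≤ B) := by
  have hpi := Real.pi_pos
  rw [abs_le] at ht
  refine ⟨fun h => hB k r t hr ⟨h, by linarith⟩, fun h => ?_⟩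
  rw [← pt_sub_one]
  exact hB _ r _ hr ⟨by linarith, by linarith⟩

/-- The continued functions have an asymptotic expansion whose constants depend on the solution only
through a bound `B` in the sectors. -/
theorem sectorialFamily (h : SolutionPieces s₁ s₃ y M) {B K : ℝ} (hK : 6 * |y| ≤ K)
    (hB0 : 0 ≤ B)
    (hB : ∀ k r t, 0 < r → t ∈ Icc 0 (Real.pi / 3) → ‖M k (pt k r t)‖ ≤ B) :
    SectorialFamily M 1 fun r => B * (3 * (‖s₁‖ + ‖s₃‖)) * gauss K r where
  differentiable := h.differentiable
  tendsto := h.tendsto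
  jump_le k r t hr ht := by
    have hw := norm_jumpSubOne_le s₁ s₃ k hK hr ht
    rcases le_total 0 t with h0 | h0
    · rw [h.sub_eq, mul_assoc B]
      exact (norm_mul_le _ _).trans
        (mul_le_mul ((norm_le_or hB k hr ht).1 h0) hw (norm_nonneg _) hB0)
    · rw [h.eq_add, add_sub_cancel_left, mul_assoc B]
      exact (norm_mul_le _ _).trans
        (mul_le_mul ((norm_le_or hB k hr ht).2 h0) hw (norm_nonneg _) hB0)
  integrable n := by
    refine ((integrableOn_pow_mul_gauss K n).const_mul (B * (3 * (‖s₁‖ + ‖s₃‖)))).congr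
      (Eventually.of_forall fun r => ?_)
    simp only; ring
  tendsto_weight := by
    simpa using (tendsto_gauss K).const_mul (B * (3 * (‖s₁‖ + ‖s₃‖)))

/-- The quotients of the solutions at two values of `y` have jumps that are small when these values
are close to each other. -/
lemma quotient_sectorialFamily (h₀ : SolutionPieces s₁ s₃ y₀ M₀) (h : SolutionPieces s₁ s₃ y M)
    (hy : |y - y₀| ≤ 1) {A B : ℝ} (hA0 : 0 ≤ A) (hB0 : 0 ≤ B)
    (hA : ∀ k r t, 0 < r → t ∈ Icc 0 (Real.pi / 3) → ‖(M₀ k (pt k r t)).adjugate‖ ≤ A)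
    (hB : ∀ k r t, 0 < r → t ∈ Icc 0 (Real.pi / 3) → ‖M k (pt k r t)‖ ≤ B) :
    SectorialFamily (fun k z => M k z * (M₀ k z).adjugate) 1 fun r =>
      B * (18 * (‖s₁‖ + ‖s₃‖) * |y - y₀|) * A * (r * gauss (6 * |y₀| + 6) r) where
  differentiable k := (h.differentiable k).mul (differentiable_adjugate (h₀.differentiable k))
  tendsto k e he := by
    obtain ⟨R, hR⟩ := h.tendsto k (e / (2 * (A + 1))) (by positivity)
    obtain ⟨R₀, hR₀⟩ := h₀.tendsto k (e / (2 * (A + 1))) (by positivity)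
    refine ⟨max (max R R₀) 1, fun r hr t ht => ?_⟩
    simp only [ge_iff_le, max_le_iff] at hr
    have e1 : M k (pt k r t) * (M₀ k (pt k r t)).adjugate - 1 =
        ((M k (pt k r t) - 1) - (M₀ k (pt k r t) - 1)) * (M₀ k (pt k r t)).adjugate := by
      rw [sub_sub_sub_cancel_right, sub_mul, mul_adjugate_of_det_eq_one (h₀.det k _)]
    rw [e1]
    have e2 : ‖(M k (pt k r t) - 1) - (M₀ k (pt k r t) - 1)‖ ≤ e / (A + 1) := by
      refine (norm_sub_le _ _).trans ?_
      have := hR r hr.1.1 t ht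
      have := hR₀ r hr.1.2 t ht
      have : e / (2 * (A + 1)) + e / (2 * (A + 1)) = e / (A + 1) := by field_simp; norm_num
      linarith
    refine (norm_mul_le _ _).trans ((mul_le_mul e2
      (hA k r t (by linarith [hr.2]) ht) (norm_nonneg _) (by positivity)).trans ?_)
    rw [div_mul_eq_mul_div, div_le_iff₀ (by positivity)]
    nlinarith
  jump_le k r t hr ht := by
    have hw := norm_jumpSubOne_sub_le s₁ s₃ k hy hr ht
    set w := jumpSubOne s₁ s₃ k y (pt k r t) with hwdef
    set w₀ := jumpSubOne s₁ s₃ k y₀ (pt k r t) with hw₀def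
    have z1 : w * w₀ = 0 := jumpSubOne_mul_jumpSubOne _ _ _ _ _ _
    have z2 : w * w = 0 := jumpSubOne_mul_jumpSubOne _ _ _ _ _ _
    have z3 : w₀ * w₀ = 0 := jumpSubOne_mul_jumpSubOne _ _ _ _ _ _
    have hg := (gauss_pos (6 * |y₀| + 6) r).le
    have hprod : ∀ X Z : Matrix (Fin 3) (Fin 3) ℂ, ‖X‖ ≤ B → ‖Z‖ ≤ A → ‖X * (w - w₀) * Z‖ ≤
        B * (18 * (‖s₁‖ + ‖s₃‖) * |y - y₀|) * A * (r * gauss (6 * |y₀| + 6) r) := by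
      intro X Z hX hZ
      calc _ ≤ ‖X‖ * ‖w - w₀‖ * ‖Z‖ :=
            (norm_mul_le _ _).trans (mul_le_mul_of_nonneg_right (norm_mul_le _ _) (norm_nonneg _))
        _ ≤ B * (18 * (‖s₁‖ + ‖s₃‖) * |y - y₀| * (r * gauss (6 * |y₀| + 6) r)) * A := by gcongr
        _ = _ := by ring
    rcases le_total 0 t with h0 | h0
    · have e1 : M k (pt k r t) * (M₀ k (pt k r t)).adjugate -
          M (k - 1) (pt k r t) * (M₀ (k - 1) (pt k r t)).adjugate =
          M k (pt k r t) * (w - w₀) * (M₀ k (pt k r t)).adjugate := by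
        have e2 : M (k - 1) (pt k r t) = M k (pt k r t) - M k (pt k r t) * w := by
          rw [hwdef, ← h.sub_eq, sub_sub_cancel]
        have e3 : M k (pt k r t) * w * (w₀ * (M₀ k (pt k r t)).adjugate) = 0 := by
          rw [mul_assoc, ← mul_assoc w, z1]; simp
        rw [h₀.adjugate_sub_eq k (pt k r t), e2, ← hw₀def, mul_add, sub_mul, sub_mul, e3, mul_sub,
          sub_mul, ← mul_assoc]
        abel
      rw [e1]
      refine hprod _ _ ((norm_le_or hB k hr ht).1 h0) ?_
      exact (norm_le_or (M := fun k z => (M₀ k z).adjugate) hA k hr ht).1 h0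
    · have e1 : M k (pt k r t) * (M₀ k (pt k r t)).adjugate -
          M (k - 1) (pt k r t) * (M₀ (k - 1) (pt k r t)).adjugate =
          M (k - 1) (pt k r t) * (w - w₀) * (M₀ (k - 1) (pt k r t)).adjugate := by
        have e3 : M (k - 1) (pt k r t) * w * (w₀ * (M₀ (k - 1) (pt k r t)).adjugate) = 0 := by
          rw [mul_assoc, ← mul_assoc w, z1]; simp
        rw [h₀.adjugate_eq k (pt k r t), h.eq_add k, ← hwdef, ← hw₀def, mul_sub, add_mul, add_mul,
          e3, mul_sub, sub_mul, ← mul_assoc]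
        abel
      rw [e1]
      refine hprod _ _ ((norm_le_or hB k hr ht).2 h0) ?_
      exact (norm_le_or (M := fun k z => (M₀ k z).adjugate) hA k hr ht).2 h0
  integrable n := by
    refine ((integrableOn_pow_mul_gauss (6 * |y₀| + 6) (n + 1)).const_mul
      (B * (18 * (‖s₁‖ + ‖s₃‖) * |y - y₀|) * A)).congr (Eventually.of_forall fun r => ?_)
    simp only; ring
  tendsto_weight := by
    have h1 : Tendsto (fun r => r * gauss (6 * |y₀| + 6) r) atTop (𝓝 0) := by
      refine squeeze_zero' ?_ (Eventually.of_forall fun r => mul_gauss_le _ r)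
        (tendsto_gauss (6 * |y₀| + 6 + 1))
      filter_upwards [eventually_ge_atTop 0] with r hr
      exact mul_nonneg hr (gauss_pos _ r).le
    simpa using h1.const_mul (B * (18 * (‖s₁‖ + ‖s₃‖) * |y - y₀|) * A)

/-- Solutions at nearby values of `y` are bounded uniformly: the quotient by the solution at `y₀`
satisfies an estimate that improves any bound. -/
theorem exists_uniform_bound (h₀ : SolutionPieces s₁ s₃ y₀ M₀) :
    ∃ δ, 0 < δ ∧ δ ≤ 1 ∧ ∃ B, 0 ≤ B ∧ ∀ y, |y - y₀| ≤ δ → ∀ M, SolutionPieces s₁ s₃ y M →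
      ∀ k r t, 0 < r → t ∈ Icc 0 (Real.pi / 3) → ‖M k (pt k r t)‖ ≤ B := by
  obtain ⟨B₀, hB₀0, hB₀⟩ := h₀.exists_bound
  have hpi := Real.pi_pos
  set A := 6 * B₀ ^ 2 with hAdef
  have hA0 : 0 ≤ A := by positivity
  have hA : ∀ k r t, 0 < r → t ∈ Icc 0 (Real.pi / 3) → ‖(M₀ k (pt k r t)).adjugate‖ ≤ A := by
    intro k r t hr ht
    refine (norm_adjugate_le _).trans ?_
    have := hB₀ k r t hr ht
    rw [hAdef]; gcongr
  set n₁ := ‖(1 : Matrix (Fin 3) (Fin 3) ℂ)‖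
  set K := 6 * |y₀| + 6 with hKdef
  set C := 3 / Real.pi * (Real.sin (Real.pi / 24))⁻¹ * ((18 * (‖s₁‖ + ‖s₃‖)) * A * B₀ *
    ∫ r in Ioi 0, gauss K r) with hCdef
  have hsin : 0 < Real.sin (Real.pi / 24) :=
    Real.sin_pos_of_pos_of_lt_pi (by positivity) (by linarith)
  have hC : 0 ≤ C := by
    have : 0 ≤ ∫ r in Ioi 0, gauss K r := integral_nonneg fun r => (gauss_pos K r).le
    positivity
  refine ⟨min 1 (1 / (2 * C + 1)), by positivity, min_le_left _ _, 2 * n₁ * B₀, by positivity, ?_⟩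
  intro y hy M h
  have hy1 : |y - y₀| ≤ 1 := hy.trans (min_le_left _ _)
  have hy2 : C * |y - y₀| ≤ 1 / 2 := by
    have h2 := hy.trans (min_le_right _ _)
    rw [le_div_iff₀ (by positivity)] at h2
    nlinarith [abs_nonneg (y - y₀)]
  -- a bound `b` for the quotients gives the bound `n₁ + b / 2`
  have step : ∀ b, 0 ≤ b →
      (∀ k r t, 0 < r → t ∈ Icc 0 (Real.pi / 3) →
        ‖M k (pt k r t) * (M₀ k (pt k r t)).adjugate‖ ≤ b) →
      (∀ k r t, 0 < r → t ∈ Icc 0 (Real.pi / 3) →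
        ‖M k (pt k r t) * (M₀ k (pt k r t)).adjugate‖ ≤ n₁ + b / 2) := by
    intro b hb0 hb k r t hr ht
    have hM : ∀ k r t, 0 < r → t ∈ Icc 0 (Real.pi / 3) → ‖M k (pt k r t)‖ ≤ b * B₀ := by
      intro k r t hr ht
      have e1 : M k (pt k r t) = M k (pt k r t) * (M₀ k (pt k r t)).adjugate * M₀ k (pt k r t) := by
        rw [mul_assoc, adjugate_mul_of_det_eq_one (h₀.det k _), mul_one]
      rw [e1]
      exact (norm_mul_le _ _).trans (mul_le_mul (hb k r t hr ht) (hB₀ k r t hr ht)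
        (norm_nonneg _) hb0)
    have hfam := quotient_sectorialFamily h₀ h hy1 hA0 (mul_nonneg hb0 hB₀0) hA hM
    have hfun : (fun r : ℝ => r⁻¹ * (b * B₀ * (18 * (‖s₁‖ + ‖s₃‖) * |y - y₀|) * A *
        (r * gauss K r))) =ᵐ[volume.restrict (Ioi 0)]
        fun r => (b * B₀ * (18 * (‖s₁‖ + ‖s₃‖) * |y - y₀|) * A) * gauss K r := by
      filter_upwards [ae_restrict_mem measurableSet_Ioi] with r hr
      have : r ≠ 0 := ne_of_gt hr
      field_simp
    have hgi : IntegrableOn (gauss K) (Ioi 0) := by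
      simpa using integrableOn_pow_mul_gauss K 0
    have hint := (hgi.const_mul (b * B₀ * (18 * (‖s₁‖ + ‖s₃‖) * |y - y₀|) * A)).congr hfun.symm
    have hle := hfam.norm_sub_le hint k hr ht.1 ht.2
    rw [integral_congr_ae hfun, integral_const_mul] at hle
    have e2 : 3 / Real.pi * (Real.sin (Real.pi / 24))⁻¹ *
        ((b * B₀ * (18 * (‖s₁‖ + ‖s₃‖) * |y - y₀|) * A) * ∫ r in Ioi 0, gauss K r) =
        C * |y - y₀| * b := by rw [hCdef]; ring
    rw [e2] at hle
    have := norm_add_le (M k (pt k r t) * (M₀ k (pt k r t)).adjugate - 1) 1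
    rw [sub_add_cancel] at this
    nlinarith
  obtain ⟨b, hb0, hb⟩ := h.exists_bound
  have hn1 : 0 ≤ n₁ := norm_nonneg _
  -- `2 n₁` is the fixed point of `b ↦ n₁ + b / 2`
  have iter : ∀ n : ℕ, ∀ k r t, 0 < r → t ∈ Icc 0 (Real.pi / 3) →
      ‖M k (pt k r t) * (M₀ k (pt k r t)).adjugate‖ ≤ 2 * n₁ + b * A * (1 / 2) ^ n := by
    intro n
    induction n with
    | zero =>
      intro k r t hr ht
      have := (norm_mul_le (M k (pt k r t)) (M₀ k (pt k r t)).adjugate).trans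
        (mul_le_mul (hb k r t hr ht) (hA k r t hr ht) (norm_nonneg _) hb0)
      rw [pow_zero, mul_one]; linarith
    | succ n ih =>
      intro k r t hr ht
      have := step _ (by positivity) ih k r t hr ht
      rw [pow_succ]; linarith
  intro k r t hr ht
  have hlim : Tendsto (fun n : ℕ => 2 * n₁ + b * A * (1 / 2 : ℝ) ^ n) atTop (𝓝 (2 * n₁)) := by
    simpa using ((tendsto_pow_atTop_nhds_zero_of_lt_one (r := (1 / 2 : ℝ)) (by norm_num)
      (by norm_num)).const_mul (b * A)).const_add (2 * n₁)
  have hq : ‖M k (pt k r t) * (M₀ k (pt k r t)).adjugate‖ ≤ 2 * n₁ :=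
    ge_of_tendsto hlim (Eventually.of_forall fun n => iter n k r t hr ht)
  have e1 : M k (pt k r t) = M k (pt k r t) * (M₀ k (pt k r t)).adjugate * M₀ k (pt k r t) := by
    rw [mul_assoc, adjugate_mul_of_det_eq_one (h₀.det k _), mul_one]
  rw [e1]
  exact (norm_mul_le _ _).trans (mul_le_mul hq (hB₀ k r t hr ht) (norm_nonneg _) (by positivity))

end SolutionPieces

end Bounds


/-! ### Expansions of products and the dependence on the parameter -/

section NormedAlgebra

variable {R : Type*} [NormedRing R] [NormedAlgebra ℂ R]

/-- The expansion of an inverse. -/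
lemma norm_inverse_sub_le {m n a b : R} {u : ℂ} {A C : ℝ} (hA : 0 ≤ A) (hC : 0 ≤ C) (hu : ‖u‖ ≤ 1)
    (hnm : n * m = 1) (hn : ‖n‖ ≤ A) (ha : ‖a‖ ≤ C) (hb : ‖b‖ ≤ C)
    (hm : ‖m - (1 + u • a + u ^ 2 • b)‖ ≤ C * ‖u‖ ^ 3) :
    ‖n - (1 - u • a + u ^ 2 • (a * a - b))‖ ≤
      A * (2 * C * (C ^ 2 + C) + C ^ 2 + C * (‖(1 : R)‖ + 2 * C + C ^ 2)) * ‖u‖ ^ 3 := by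
  set c := a * a - b with hcdef
  set ρ := m - (1 + u • a + u ^ 2 • b) with hρ
  have hc : ‖c‖ ≤ C ^ 2 + C := by
    refine (norm_sub_le _ _).trans (add_le_add ((norm_mul_le _ _).trans ?_) hb)
    rw [sq]; gcongr
  have hu0 := norm_nonneg u
  have hm' : m = ρ + (1 + u • a + u ^ 2 • b) := by rw [hρ]; abel
  have hq : ‖1 - u • a + u ^ 2 • c‖ ≤ ‖(1 : R)‖ + 2 * C + C ^ 2 := by
    have h1 : ‖u • a‖ ≤ C := by
      rw [norm_smul]; nlinarith [norm_nonneg a]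
    have h2 : ‖u ^ 2 • c‖ ≤ C ^ 2 + C := by
      rw [norm_smul, norm_pow]
      have : ‖u‖ ^ 2 ≤ 1 := pow_le_one₀ hu0 hu
      nlinarith [norm_nonneg c]
    have h3 := norm_add_le (1 - u • a) (u ^ 2 • c)
    have h4 := norm_sub_le 1 (u • a)
    linarith
  have e1 : n - (1 - u • a + u ^ 2 • c) =
      -(n * (u ^ 3 • (a * c) - u ^ 3 • (b * a) + u ^ 4 • (b * c) +
        ρ * (1 - u • a + u ^ 2 • c))) := by
    have e2 : u ^ 3 • (a * c) - u ^ 3 • (b * a) + u ^ 4 • (b * c) +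
        ρ * (1 - u • a + u ^ 2 • c) = m * (1 - u • a + u ^ 2 • c) - 1 := by
      rw [hm', hcdef]
      simp only [mul_add, add_mul, mul_sub, smul_mul_assoc, mul_smul_comm, mul_one, one_mul,
        smul_sub, ← mul_assoc]
      module
    rw [e2, mul_sub, ← mul_assoc, hnm, one_mul, mul_one]
    abel
  rw [e1, norm_neg]
  have hu3 : 0 ≤ ‖u‖ ^ 3 := by positivity
  have hu4 : ‖u‖ ^ 4 ≤ ‖u‖ ^ 3 := pow_le_pow_of_le_one hu0 hu (by norm_num)
  have t1 : ‖u ^ 3 • (a * c)‖ ≤ C * (C ^ 2 + C) * ‖u‖ ^ 3 := by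
    rw [norm_smul, norm_pow, mul_comm]
    exact mul_le_mul_of_nonneg_right ((norm_mul_le _ _).trans (by gcongr)) hu3
  have t2 : ‖u ^ 3 • (b * a)‖ ≤ C ^ 2 * ‖u‖ ^ 3 := by
    rw [norm_smul, norm_pow, mul_comm, sq]
    exact mul_le_mul_of_nonneg_right ((norm_mul_le _ _).trans (by gcongr)) hu3
  have t3 : ‖u ^ 4 • (b * c)‖ ≤ C * (C ^ 2 + C) * ‖u‖ ^ 3 := by
    rw [norm_smul, norm_pow, mul_comm]
    exact mul_le_mul ((norm_mul_le _ _).trans (by gcongr)) hu4 (by positivity) (by positivity)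
  have t4 : ‖ρ * (1 - u • a + u ^ 2 • c)‖ ≤ C * ‖u‖ ^ 3 * (‖(1 : R)‖ + 2 * C + C ^ 2) :=
    (norm_mul_le _ _).trans (by gcongr)
  calc _ ≤ ‖n‖ * ‖u ^ 3 • (a * c) - u ^ 3 • (b * a) + u ^ 4 • (b * c) +
        ρ * (1 - u • a + u ^ 2 • c)‖ := norm_mul_le _ _
    _ ≤ A * (C * (C ^ 2 + C) * ‖u‖ ^ 3 + C ^ 2 * ‖u‖ ^ 3 + C * (C ^ 2 + C) * ‖u‖ ^ 3 +
        C * ‖u‖ ^ 3 * (‖(1 : R)‖ + 2 * C + C ^ 2)) := by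
      refine mul_le_mul hn ?_ (norm_nonneg _) hA
      refine (norm_add_le _ _).trans (add_le_add ((norm_add_le _ _).trans (add_le_add
        ((norm_sub_le _ _).trans (add_le_add t1 t2)) t3)) t4)
    _ = _ := by ring

/-- The leading terms of the product of two expansions, with a bounded factor in between. -/
lemma norm_mul_mul_sub_le {m n a b a' b' D : R} {u : ℂ} {C : ℝ} (hu : ‖u‖ ≤ 1)
    (hC : 0 ≤ C) (ha : ‖a‖ ≤ C) (hb : ‖b‖ ≤ C) (ha' : ‖a'‖ ≤ C) (hb' : ‖b'‖ ≤ C) (hD : ‖D‖ ≤ C)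
    (hn : ‖n‖ ≤ C) (hm : ‖m - (1 + u • a + u ^ 2 • b)‖ ≤ C * ‖u‖ ^ 3)
    (hn' : ‖n - (1 + u • a' + u ^ 2 • b')‖ ≤ C * ‖u‖ ^ 3) :
    ‖m * D * n - (D + u • (a * D + D * a') + u ^ 2 • (a * D * a' + b * D + D * b'))‖ ≤
      (6 * C ^ 3 + ‖(1 : R)‖ * C ^ 2) * ‖u‖ ^ 3 := by
  set ρ := m - (1 + u • a + u ^ 2 • b) with hρ
  set ρ' := n - (1 + u • a' + u ^ 2 • b') with hρ'
  have hu0 := norm_nonneg u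
  have hm' : m = ρ + (1 + u • a + u ^ 2 • b) := by rw [hρ]; abel
  have hu3 : 0 ≤ ‖u‖ ^ 3 := by positivity
  have hu4 : ‖u‖ ^ 4 ≤ ‖u‖ ^ 3 := pow_le_pow_of_le_one hu0 hu (by norm_num)
  have hp : ‖1 + u • a + u ^ 2 • b‖ ≤ ‖(1 : R)‖ + 2 * C := by
    have h1 : ‖u • a‖ ≤ C := by
      rw [norm_smul]; nlinarith [norm_nonneg a]
    have h2 : ‖u ^ 2 • b‖ ≤ C := by
      rw [norm_smul, norm_pow]
      have : ‖u‖ ^ 2 ≤ 1 := pow_le_one₀ hu0 hu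
      nlinarith [norm_nonneg b]
    have h3 := norm_add_le (1 + u • a) (u ^ 2 • b)
    have h4 := norm_add_le 1 (u • a)
    linarith
  have hmul3 : ∀ x z : R, ‖x‖ ≤ C → ‖z‖ ≤ C → ‖x * D * z‖ ≤ C ^ 3 := by
    intro x z hx hz
    calc _ ≤ ‖x‖ * ‖D‖ * ‖z‖ :=
          (norm_mul_le _ _).trans (mul_le_mul_of_nonneg_right (norm_mul_le _ _) (norm_nonneg _))
      _ ≤ C * C * C := by gcongr
      _ = C ^ 3 := by ring
  have e1 : m * D * n - (D + u • (a * D + D * a') + u ^ 2 • (a * D * a' + b * D + D * b')) =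
      ρ * D * n + (1 + u • a + u ^ 2 • b) * D * ρ' + u ^ 3 • (a * D * b') + u ^ 3 • (b * D * a') +
        u ^ 4 • (b * D * b') := by
    have e2 : m * D * n = ρ * D * n + (1 + u • a + u ^ 2 • b) * D * n := by
      rw [hm', add_mul, add_mul]
    have e3 : n = ρ' + (1 + u • a' + u ^ 2 • b') := by rw [hρ']; abel
    have e4 : (1 + u • a + u ^ 2 • b) * D * n = (1 + u • a + u ^ 2 • b) * D * ρ' +
        (1 + u • a + u ^ 2 • b) * D * (1 + u • a' + u ^ 2 • b') := by
      rw [← mul_add, ← e3]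
    have e5 : (1 + u • a + u ^ 2 • b) * D * (1 + u • a' + u ^ 2 • b') =
        D + u • (a * D + D * a') + u ^ 2 • (a * D * a' + b * D + D * b') + u ^ 3 • (a * D * b') +
          u ^ 3 • (b * D * a') + u ^ 4 • (b * D * b') := by
      simp only [mul_add, add_mul, smul_mul_assoc, mul_smul_comm, mul_one, one_mul]
      module
    rw [e2, e4, e5]; abel
  rw [e1]
  have t1 : ‖ρ * D * n‖ ≤ C ^ 3 * ‖u‖ ^ 3 := by
    calc _ ≤ ‖ρ‖ * ‖D‖ * ‖n‖ :=
          (norm_mul_le _ _).trans (mul_le_mul_of_nonneg_right (norm_mul_le _ _) (norm_nonneg _))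
      _ ≤ C * ‖u‖ ^ 3 * C * C := by gcongr
      _ = _ := by ring
  have t2 : ‖(1 + u • a + u ^ 2 • b) * D * ρ'‖ ≤ (‖(1 : R)‖ + 2 * C) * C ^ 2 * ‖u‖ ^ 3 := by
    calc _ ≤ ‖1 + u • a + u ^ 2 • b‖ * ‖D‖ * ‖ρ'‖ :=
          (norm_mul_le _ _).trans (mul_le_mul_of_nonneg_right (norm_mul_le _ _) (norm_nonneg _))
      _ ≤ (‖(1 : R)‖ + 2 * C) * C * (C * ‖u‖ ^ 3) := by gcongr
      _ = _ := by ring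
  have t3 : ‖u ^ 3 • (a * D * b')‖ ≤ C ^ 3 * ‖u‖ ^ 3 := by
    rw [norm_smul, norm_pow, mul_comm]
    exact mul_le_mul_of_nonneg_right (hmul3 _ _ ha hb') hu3
  have t4 : ‖u ^ 3 • (b * D * a')‖ ≤ C ^ 3 * ‖u‖ ^ 3 := by
    rw [norm_smul, norm_pow, mul_comm]
    exact mul_le_mul_of_nonneg_right (hmul3 _ _ hb ha') hu3
  have t5 : ‖u ^ 4 • (b * D * b')‖ ≤ C ^ 3 * ‖u‖ ^ 3 := by
    rw [norm_smul, norm_pow, mul_comm]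
    exact mul_le_mul (hmul3 _ _ hb hb') hu4 (by positivity) (by positivity)
  have := norm_add_le (ρ * D * n + (1 + u • a + u ^ 2 • b) * D * ρ' + u ^ 3 • (a * D * b') +
    u ^ 3 • (b * D * a')) (u ^ 4 • (b * D * b'))
  have := norm_add_le (ρ * D * n + (1 + u • a + u ^ 2 • b) * D * ρ' + u ^ 3 • (a * D * b'))
    (u ^ 3 • (b * D * a'))
  have := norm_add_le (ρ * D * n + (1 + u • a + u ^ 2 • b) * D * ρ') (u ^ 3 • (a * D * b'))
  have := norm_add_le (ρ * D * n) ((1 + u • a + u ^ 2 • b) * D * ρ')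
  linarith

end NormedAlgebra

section Parameter

open Matrix Set MeasureTheory
open scoped Matrix.Norms.Operator

/-- The matrix `e^{3 τ J}`. -/
noncomputable def expJ (τ : ℂ) : Matrix (Fin 3) (Fin 3) ℂ :=
  Matrix.diagonal fun i => Complex.exp (3 * τ * J i)

lemma expJ_zero : expJ 0 = 1 := by
  simp [expJ]

lemma norm_expJ_le {τ : ℂ} (hτ : ‖τ‖ ≤ 1) : ‖expJ τ‖ ≤ 3 * Real.exp 3 := by
  refine norm_le_of_entry_le (Real.exp_pos _).le fun i j => ?_
  rw [expJ, Matrix.diagonal_apply]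
  split_ifs with h
  · refine (Complex.norm_exp_le_exp_norm _).trans (Real.exp_le_exp.2 ?_)
    rw [norm_mul, norm_mul, norm_J]
    have : ‖(3 : ℂ)‖ = 3 := by norm_num
    rw [this]; linarith
  · rw [norm_zero]; exact (Real.exp_pos _).le

lemma hasDerivAt_expJ (h : ℂ) :
    HasDerivAt (fun z => expJ (h * z)) ((3 * h) • Matrix.diagonal J) 0 := by
  have e1 : ∀ d : Fin 3 → ℂ, Matrix.diagonal d = ∑ i, d i • Matrix.single i i (1 : ℂ) := by
    intro d
    rw [← Matrix.sum_single_eq_diagonal]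
    simp [Matrix.smul_single]
  simp only [expJ, e1, Finset.smul_sum]
  refine HasDerivAt.fun_sum fun i _ => ?_
  have h1 : HasDerivAt (fun z => Complex.exp (3 * (h * z) * J i)) (3 * h * J i) 0 := by
    have h2 : HasDerivAt (fun z : ℂ => 3 * (h * z) * J i) (3 * (h * 1) * J i) 0 :=
      (((hasDerivAt_id (0 : ℂ)).const_mul h).const_mul 3).mul_const (J i)
    refine h2.cexp.congr_deriv ?_
    rw [mul_zero, mul_zero, zero_mul, Complex.exp_zero]
    ring
  rw [smul_smul]
  exact h1.smul_const _

lemma differentiable_expJ (h : ℂ) : Differentiable ℂ fun z => expJ (h * z) := by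
  rw [differentiable_matrix_iff]
  intro i j
  simp only [expJ, Matrix.diagonal_apply]
  split_ifs <;> fun_prop

/-- The quadratic parts of the exponents cancel, since they do not depend on `y`. -/
lemma expX_mul_expNegX_eq (y y₀ : ℝ) (z : ℂ) :
    expX y z * expNegX y₀ z = expJ ((y - y₀ : ℝ) * z) := by
  rw [expX, expNegX, Matrix.diagonal_mul_diagonal, expJ]
  congr 1; funext i
  rw [← Complex.exp_add]
  congr 1
  unfold phase; push_cast; ring

namespace SolutionPieces

variable {s₁ s₃ : ℂ} {y y₀ : ℝ} {M M₀ : Fin 6 → ℂ → Matrix (Fin 3) (Fin 3) ℂ}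

/-- The expansion at infinity is uniform for `y` near `y₀`. -/
theorem exists_uniform_expansion (h₀ : SolutionPieces s₁ s₃ y₀ M₀) (N : ℕ) :
    ∃ δ, 0 < δ ∧ δ ≤ 1 ∧ ∃ C, 0 ≤ C ∧ ∀ y, |y - y₀| ≤ δ → ∀ M, SolutionPieces s₁ s₃ y M →
      (∀ n ≤ N, ‖coef M n‖ ≤ C) ∧ ∀ k r t, 0 < r → t ∈ Icc 0 (Real.pi / 3) →
        ‖M k (pt k r t)‖ ≤ C ∧
        ‖M k (pt k r t) - (1 + ∑ n ∈ Finset.Icc 1 N, (pt k r t ^ n)⁻¹ • coef M n)‖ ≤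
          C * (r ^ (N + 1))⁻¹ := by
  have hpi := Real.pi_pos
  obtain ⟨δ, hδ, hδ1, B, hB0, hB⟩ := h₀.exists_uniform_bound
  set K := 6 * |y₀| + 6
  set W : ℝ → ℝ := fun r => B * (3 * (‖s₁‖ + ‖s₃‖)) * gauss K r with hW
  set c : ℕ → ℝ := fun n => 3 / Real.pi * ∫ r in Ioi 0, r ^ (n - 1) * W r with hc
  set c' := 3 / Real.pi * (Real.sin (Real.pi / 24))⁻¹ * ∫ r in Ioi 0, r ^ N * W r with hc'
  refine ⟨δ, hδ, hδ1, B + |c'| + ∑ n ∈ Finset.range (N + 1), |c n|, by positivity, ?_⟩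
  intro y hy M h
  have hfam := h.sectorialFamily (K := K) (by
    have h1 : |y| ≤ |y₀| + 1 := by
      have := abs_add_le (y - y₀) y₀
      rw [sub_add_cancel] at this; linarith
    simp only [K]; linarith) hB0 (hB y hy M h)
  have hs0 : 0 ≤ ∑ n ∈ Finset.range (N + 1), |c n| := Finset.sum_nonneg fun _ _ => abs_nonneg _
  have hc'0 := abs_nonneg c'
  refine ⟨fun n hn => (hfam.norm_coef_le n).trans ?_, fun k r t hr ht => ⟨?_, ?_⟩⟩
  · have := Finset.single_le_sum (f := fun n => |c n|) (fun _ _ => abs_nonneg _)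
      (Finset.mem_range.2 (Nat.lt_succ_of_le hn))
    have h2 : c n ≤ |c n| := le_abs_self _
    simp only [hc, hW] at h2 this ⊢
    linarith
  · exact (hB y hy M h k r t hr ht).trans (by linarith)
  · refine (hfam.norm_sub_expansion_le k hr (by linarith [ht.1]) (by linarith [ht.2]) N).trans ?_
    refine mul_le_mul_of_nonneg_right ?_ (by positivity)
    have h2 : c' ≤ |c'| := le_abs_self _
    simp only [hc', hW] at h2 ⊢
    linarith

/-- The products `m(y) e^{3 (y - y₀) z J} m(y₀)⁻¹` of the six sectors are the same entire
function. -/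
lemma conj_eq (h₀ : SolutionPieces s₁ s₃ y₀ M₀) (h : SolutionPieces s₁ s₃ y M) (k : Fin 6)
    (z : ℂ) : M k z * expJ ((y - y₀ : ℝ) * z) * (M₀ k z).adjugate =
      M 0 z * expJ ((y - y₀ : ℝ) * z) * (M₀ 0 z).adjugate := by
  refine eq_apply_zero_of_eq_sub_one
    (g := fun k => M k z * expJ ((y - y₀ : ℝ) * z) * (M₀ k z).adjugate) (fun k => ?_) k
  rw [h.jump k, h₀.jump k, Matrix.adjugate_mul_distrib, ← expX_mul_expNegX_eq]
  have e1 : PIVModel.jump s₁ s₃ k y z * (expX y z * expNegX y₀ z) =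
      expX y z * expNegX y₀ z * PIVModel.jump s₁ s₃ k y₀ z := by
    rw [jump_eq, jump_eq]
    calc _ = expX y z * stokes s₁ s₃ k * (expNegX y z * expX y z) * expNegX y₀ z := by
          simp only [mul_assoc]
      _ = expX y z * (expNegX y₀ z * expX y₀ z) * stokes s₁ s₃ k * expNegX y₀ z := by
          rw [expNegX_mul_expX, expNegX_mul_expX, mul_one, mul_one]
      _ = _ := by simp only [mul_assoc]
  calc _ = M (k - 1) z * (PIVModel.jump s₁ s₃ k y z * (expX y z * expNegX y₀ z)) *
        ((PIVModel.jump s₁ s₃ k y₀ z).adjugate * (M₀ (k - 1) z).adjugate) := by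
        simp only [mul_assoc]
    _ = M (k - 1) z * (expX y z * expNegX y₀ z) * (PIVModel.jump s₁ s₃ k y₀ z *
        (PIVModel.jump s₁ s₃ k y₀ z).adjugate) * (M₀ (k - 1) z).adjugate := by
        rw [e1]; simp only [mul_assoc]
    _ = _ := by rw [mul_adjugate_of_det_eq_one (det_jump _ _ _ _ _), mul_one]

/-- The expansion of the coefficients in `y - y₀`: the entire function of `conj_eq` is compared with
its expansion on the circle of radius `1 / |y - y₀|`. -/
theorem exists_coef_expansion (h₀ : SolutionPieces s₁ s₃ y₀ M₀) :
    ∃ δ, 0 < δ ∧ ∃ C, ∀ y, |y - y₀| ≤ δ → y ≠ y₀ → ∀ M, SolutionPieces s₁ s₃ y M →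
      ‖coef M 2 - coef M 1 * coef M₀ 1 + (coef M₀ 1 * coef M₀ 1 - coef M₀ 2)‖ ≤ C * |y - y₀| ∧
      ‖coef M 1 - coef M₀ 1 + (3 * ((y - y₀ : ℝ) : ℂ)) • (-(coef M 1 * diagonal J * coef M₀ 1) +
        coef M 2 * diagonal J + diagonal J * (coef M₀ 1 * coef M₀ 1 - coef M₀ 2))‖ ≤
          C * |y - y₀| ^ 2 := by
  obtain ⟨δ, hδ, hδ1, C, hC0, hC⟩ := h₀.exists_uniform_expansion 2
  have h0C := hC y₀ (by simpa using hδ.le) M₀ h₀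
  set a₀ := coef M₀ 1 with ha₀
  set b₀ := coef M₀ 2 with hb₀
  set n₁ := ‖(1 : Matrix (Fin 3) (Fin 3) ℂ)‖
  have hn1 : 0 ≤ n₁ := norm_nonneg _
  set A := 6 * C ^ 2 with hA
  have hA0 : 0 ≤ A := by positivity
  set C' := A * (2 * C * (C ^ 2 + C) + C ^ 2 + C * (n₁ + 2 * C + C ^ 2)) with hC'
  have hC'0 : 0 ≤ C' := by positivity
  set C₁ := C + C' + A + (C ^ 2 + C) + 3 * Real.exp 3 with hC₁
  have he3 := Real.exp_pos 3
  have hCsq : 0 ≤ C ^ 2 + C := by positivity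
  have hC₁0 : 0 ≤ C₁ := by positivity
  refine ⟨δ, hδ, (6 * C₁ ^ 3 + n₁ * C₁ ^ 2), fun y hy hyne M h => ?_⟩
  obtain ⟨hcoef, hexp⟩ := hC y hy M h
  set a := coef M 1 with ha
  set b := coef M 2 with hb
  set H : ℂ := ((y - y₀ : ℝ) : ℂ) with hH
  set r := |y - y₀|⁻¹ with hr
  have hpos : 0 < |y - y₀| := abs_pos.2 (sub_ne_zero.2 hyne)
  have hr1 : 1 ≤ r := (one_le_inv₀ hpos).2 (hy.trans hδ1)
  have hr0 : 0 < r := by linarith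
  have hHn : ‖H‖ = |y - y₀| := by rw [hH, Complex.norm_real, Real.norm_eq_abs]
  set G : ℂ → Matrix (Fin 3) (Fin 3) ℂ := fun z => M 0 z * expJ (H * z) * (M₀ 0 z).adjugate with hG
  have hGd : Differentiable ℂ G :=
    ((h.differentiable 0).mul (differentiable_expJ H)).mul
      (differentiable_adjugate (h₀.differentiable 0))
  set c₀ := a₀ * a₀ - b₀ with hc₀
  -- the difference of `z² G` and its expansion is small on the circle
  set F : ℂ → Matrix (Fin 3) (Fin 3) ℂ := fun z => z ^ 2 • G z - (z ^ 2 • expJ (H * z) +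
    z • (a * expJ (H * z) + expJ (H * z) * (-a₀)) +
    (a * expJ (H * z) * (-a₀) + b * expJ (H * z) + expJ (H * z) * c₀)) with hF
  have hED := differentiable_expJ H
  have hFd : Differentiable ℂ F := by
    simp only [hF]
    fun_prop
  have hsphere : ∀ z ∈ Metric.sphere (0 : ℂ) r,
      ‖F z‖ ≤ (6 * C₁ ^ 3 + n₁ * C₁ ^ 2) * |y - y₀| := by
    intro z hz
    rw [mem_sphere_zero_iff_norm] at hz
    have hz0 : z ≠ 0 := by rw [← norm_pos_iff, hz]; exact hr0
    obtain ⟨k, r', t, hr', ht0, ht1, rfl⟩ := exists_pt hz0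
    rw [norm_pt_of_pos k hr'] at hz
    subst hz
    set z := pt k r t with hzdef
    have ht : t ∈ Icc 0 (Real.pi / 3) := ⟨ht0, ht1.le⟩
    have hzn : ‖z‖ = r := norm_pt_of_pos k hr0 t
    set u := z⁻¹ with hu
    have hun : ‖u‖ = |y - y₀| := by rw [hu, norm_inv, hzn, hr, inv_inv]
    have hu1 : ‖u‖ ≤ 1 := by rw [hun]; exact hy.trans hδ1
    have hr3 : (r ^ (2 + 1))⁻¹ = ‖u‖ ^ 3 := by rw [hun, hr, inv_pow, inv_inv]
    have hsum : ∀ M : Fin 6 → ℂ → Matrix (Fin 3) (Fin 3) ℂ,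
        1 + ∑ n ∈ Finset.Icc 1 2, (z ^ n)⁻¹ • coef M n = 1 + u • coef M 1 + u ^ 2 • coef M 2 := by
      intro M
      rw [show Finset.Icc 1 2 = {1, 2} from rfl, Finset.sum_pair (by norm_num), pow_one, ← inv_pow,
        add_assoc]
    have hm := (hexp k r t hr0 ht).2
    have hm₀ := (h0C.2 k r t hr0 ht).2
    rw [← hzdef, hsum, hr3] at hm hm₀
    have hadj : ‖(M₀ k z).adjugate‖ ≤ A := by
      refine (norm_adjugate_le _).trans ?_
      have := (h0C.2 k r t hr0 ht).1
      rw [hA]; gcongr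
    have hinv := norm_inverse_sub_le hA0 hC0 hu1 (adjugate_mul_of_det_eq_one (h₀.det k z)) hadj
      (h0C.1 1 (by norm_num)) (h0C.1 2 le_rfl) hm₀
    have hD : ‖expJ (H * z)‖ ≤ 3 * Real.exp 3 := by
      refine norm_expJ_le ?_
      rw [norm_mul, hHn, hzn, hr, mul_inv_cancel₀ hpos.ne']
    have hc₀n : ‖c₀‖ ≤ C ^ 2 + C := by
      refine (norm_sub_le _ _).trans (add_le_add ((norm_mul_le _ _).trans ?_) (h0C.1 2 le_rfl))
      rw [sq]
      exact mul_le_mul (h0C.1 1 (by norm_num)) (h0C.1 1 (by norm_num)) (norm_nonneg _) hC0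
    have hprod := norm_mul_mul_sub_le (m := M k z) (n := (M₀ k z).adjugate) (a := a) (b := b)
      (a' := -a₀) (b' := c₀) (D := expJ (H * z)) (u := u) (C := C₁) hu1 hC₁0
      ((hcoef 1 (by norm_num)).trans (by linarith)) ((hcoef 2 le_rfl).trans (by linarith))
      (by rw [norm_neg]; exact (h0C.1 1 (by norm_num)).trans (by linarith))
      (hc₀n.trans (by linarith)) (hD.trans (by linarith)) (hadj.trans (by linarith))
      (hm.trans (mul_le_mul_of_nonneg_right (by linarith) (by positivity)))
      (by
        rw [smul_neg, ← sub_eq_add_neg]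
        exact hinv.trans (mul_le_mul_of_nonneg_right (by linarith) (by positivity)))
    have hGk : G z = M k z * expJ (H * z) * (M₀ k z).adjugate := (conj_eq h₀ h k z).symm
    have hFz : F z = z ^ 2 • (M k z * expJ (H * z) * (M₀ k z).adjugate -
        (expJ (H * z) + u • (a * expJ (H * z) + expJ (H * z) * (-a₀)) +
        u ^ 2 • (a * expJ (H * z) * (-a₀) + b * expJ (H * z) + expJ (H * z) * c₀))) := by
      simp only [hF]
      rw [hGk, smul_sub, smul_add (z ^ 2), smul_add (z ^ 2), smul_smul, smul_smul]
      have e1 : z ^ 2 * u = z := by rw [hu]; field_simp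
      have e2 : z ^ 2 * u ^ 2 = 1 := by rw [hu]; field_simp
      rw [e1, e2, one_smul]
    rw [hFz, norm_smul, norm_pow, hzn]
    calc _ ≤ r ^ 2 * ((6 * C₁ ^ 3 + n₁ * C₁ ^ 2) * ‖u‖ ^ 3) := by gcongr
      _ = _ := by rw [hun, hr]; field_simp
  have hcl : DiffContOnCl ℂ F (Metric.ball 0 r) := hFd.diffContOnCl
  have h0 := Complex.norm_iteratedDeriv_le_of_forall_mem_sphere_norm_le 0 hr0 hcl hsphere
  have h1 := Complex.norm_deriv_le_of_forall_mem_sphere_norm_le hr0 hcl hsphere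
  have hF0 : F 0 = -(b - a * a₀ + c₀) := by
    simp only [hF, mul_zero, expJ_zero, mul_one, one_mul, zero_smul, ne_eq, OfNat.ofNat_ne_zero,
      not_false_eq_true, zero_pow, mul_neg]
    abel
  have hF1 : deriv F 0 = -(a - a₀ + (3 * H) • (-(a * diagonal J * a₀) + b * diagonal J +
      diagonal J * c₀)) := by
    have hE := hasDerivAt_expJ H
    have hz2 : HasDerivAt (fun z : ℂ => z ^ 2) 0 0 := by simpa using hasDerivAt_pow 2 (0 : ℂ)
    have d1 := hz2.smul (hGd 0).hasDerivAt
    have d2 := hz2.smul hE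
    have d3 := (hasDerivAt_id (0 : ℂ)).smul ((hE.const_mul a).add (hE.mul_const (-a₀)))
    have d4 := (((hE.const_mul a).mul_const (-a₀)).add (hE.const_mul b)).add (hE.mul_const c₀)
    have d5 := (d1.sub ((d2.add d3).add d4)).deriv
    refine (Eq.trans ?_ d5).trans ?_
    · rfl
    · simp only [id, Pi.add_apply, mul_zero, expJ_zero, mul_one, one_mul, zero_smul, one_smul, ne_eq,
        OfNat.ofNat_ne_zero, not_false_eq_true, zero_pow, mul_neg, smul_neg, smul_add,
        smul_mul_assoc, mul_smul_comm]
      abel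
  constructor
  · rw [iteratedDeriv_zero, hF0, norm_neg] at h0
    simpa using h0
  · have h1' : ‖deriv F 0‖ ≤ (6 * C₁ ^ 3 + n₁ * C₁ ^ 2) * |y - y₀| / r := h1
    rw [hF1, norm_neg, hr, div_inv_eq_mul] at h1'
    exact h1'.trans_eq (by ring)

end SolutionPieces

end Parameter


/-! ### The derivative of the first coefficient -/

section Derivative

open Matrix Set MeasureTheory
open scoped Matrix.Norms.Operator

/-- The evolution `a' = 3 [J, b] + 3 [a, J] a` of the first coefficient `a` in `y`, where `b` is the
second coefficient. The comparison of expansions gives the difference quotient in terms of the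
coefficients at both values of `y`; its first consequence is that these are Lipschitz at `y₀`. -/
theorem hasDerivAt_coef_one {s₁ s₃ : ℂ} {Y : Set ℝ} (hY : IsOpen Y)
    {M : ℝ → Fin 6 → ℂ → Matrix (Fin 3) (Fin 3) ℂ}
    (hM : ∀ y ∈ Y, SolutionPieces s₁ s₃ y (M y)) {y₀ : ℝ} (hy₀ : y₀ ∈ Y) (i j : Fin 3) :
    HasDerivAt (fun y => coef (M y) 1 i j)
      (((3 : ℂ) • (diagonal J * coef (M y₀) 2 - coef (M y₀) 2 * diagonal J +
        (coef (M y₀) 1 * diagonal J - diagonal J * coef (M y₀) 1) * coef (M y₀) 1)) i j) y₀ := by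
  obtain ⟨δ, hδ, C, hC⟩ := (hM y₀ hy₀).exists_coef_expansion
  obtain ⟨δ', hδ', hδ'1, B, hB0, hB⟩ := (hM y₀ hy₀).exists_uniform_expansion 2
  set a₀ := coef (M y₀) 1 with ha₀
  set b₀ := coef (M y₀) 2 with hb₀
  set D := diagonal J with hD
  set c₀ := a₀ * a₀ - b₀ with hc₀
  set d := ‖D‖
  have hd : 0 ≤ d := norm_nonneg D
  obtain ⟨h0B, -⟩ := hB y₀ (by simpa using hδ'.le) _ (hM y₀ hy₀)
  have ha₀B : ‖a₀‖ ≤ B := h0B 1 (by norm_num)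
  have hb₀B : ‖b₀‖ ≤ B := h0B 2 (by norm_num)
  have hc₀B : ‖c₀‖ ≤ B * B + B :=
    (norm_sub_le _ _).trans (add_le_add ((norm_mul_le _ _).trans (by gcongr)) hb₀B)
  set Ka := |C| + 3 * (B * d * B + B * d + d * (B * B + B)) with hKa
  have hKa0 : 0 ≤ Ka := by positivity
  set Kb := |C| + Ka * B with hKb
  have hKb0 : 0 ≤ Kb := by positivity
  have key : ∀ y ∈ Y, |y - y₀| ≤ min (min δ δ') 1 →
      ‖coef (M y) 1 i j - a₀ i j - (y - y₀) • ((3 : ℂ) • (D * b₀ - b₀ * D +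
        (a₀ * D - D * a₀) * a₀)) i j‖ ≤ (|C| + 3 * (Ka * d * B + Kb * d)) * |y - y₀| ^ 2 := by
    intro y hyY hy
    rcases eq_or_ne y y₀ with rfl | hne
    · simp [ha₀]
    obtain ⟨e2, e1⟩ := hC y (hy.trans ((min_le_left _ _).trans (min_le_left _ _))) hne _ (hM y hyY)
    obtain ⟨hyB, -⟩ := hB y (hy.trans ((min_le_left _ _).trans (min_le_right _ _))) _ (hM y hyY)
    have hy1 : |y - y₀| ≤ 1 := hy.trans (min_le_right _ _)
    set a := coef (M y) 1 with ha
    set b := coef (M y) 2 with hb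
    have haB : ‖a‖ ≤ B := hyB 1 (by norm_num)
    have hbB : ‖b‖ ≤ B := hyB 2 (by norm_num)
    set η := |y - y₀| with hη
    have hη0 : 0 ≤ η := abs_nonneg _
    set H : ℂ := ((y - y₀ : ℝ) : ℂ) with hH
    have hHn : ‖H‖ = η := by rw [hH, Complex.norm_real, Real.norm_eq_abs]
    have h3H : ‖(3 : ℂ) * H‖ = 3 * η := by rw [norm_mul, hHn]; norm_num
    set X := -(a * D * a₀) + b * D + D * c₀ with hX
    have hXn : ‖X‖ ≤ B * d * B + B * d + d * (B * B + B) := by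
      refine (norm_add_le _ _).trans (add_le_add ((norm_add_le _ _).trans (add_le_add ?_ ?_)) ?_)
      · rw [norm_neg]
        calc _ ≤ ‖a‖ * ‖D‖ * ‖a₀‖ := (norm_mul_le _ _).trans
              (mul_le_mul_of_nonneg_right (norm_mul_le _ _) (norm_nonneg _))
          _ ≤ B * d * B := by gcongr
      · exact (norm_mul_le _ _).trans (by gcongr)
      · exact (norm_mul_le _ _).trans (by gcongr)
    have hda : ‖a - a₀‖ ≤ Ka * η := by
      have e : a - a₀ = (a - a₀ + (3 * H) • X) - (3 * H) • X := by abel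
      rw [e]
      refine (norm_sub_le _ _).trans ?_
      rw [norm_smul, h3H]
      have h1 : C * η ^ 2 ≤ |C| * η := by
        calc _ ≤ |C| * η ^ 2 := by gcongr; exact le_abs_self C
          _ ≤ |C| * η := by gcongr; nlinarith
      have h2 : 3 * η * ‖X‖ ≤ 3 * η * (B * d * B + B * d + d * (B * B + B)) := by gcongr
      rw [hKa]
      linarith
    have hdb : ‖b - b₀‖ ≤ Kb * η := by
      have e : b - b₀ = (b - a * a₀ + c₀) + (a - a₀) * a₀ := by rw [hc₀, sub_mul]; abel
      rw [e]
      refine (norm_add_le _ _).trans ?_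
      have h1 : ‖(a - a₀) * a₀‖ ≤ Ka * η * B := (norm_mul_le _ _).trans (by gcongr)
      have h2 : C * η ≤ |C| * η := by gcongr; exact le_abs_self C
      rw [hKb]
      linarith
    have e3 : coef (M y) 1 i j - a₀ i j - (y - y₀) • ((3 : ℂ) • (D * b₀ - b₀ * D +
        (a₀ * D - D * a₀) * a₀)) i j =
        (a - a₀ + (3 * H) • X + (3 * H) • ((a - a₀) * D * a₀ - (b - b₀) * D)) i j := by
      have e4 : (y - y₀) • ((3 : ℂ) • (D * b₀ - b₀ * D +
        (a₀ * D - D * a₀) * a₀)) i j = ((3 * H) • (D * b₀ - b₀ * D +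
        (a₀ * D - D * a₀) * a₀)) i j := by
        rw [Matrix.smul_apply, Matrix.smul_apply, Complex.real_smul, smul_eq_mul, smul_eq_mul]
        ring
      have e5 : a - a₀ + (3 * H) • X + (3 * H) • ((a - a₀) * D * a₀ - (b - b₀) * D) =
          a - a₀ - (3 * H) • (D * b₀ - b₀ * D + (a₀ * D - D * a₀) * a₀) := by
        rw [hX, hc₀]
        simp only [sub_mul, mul_sub, ← mul_assoc]
        module
      rw [e4, e5]
      rfl
    rw [e3]
    refine (norm_entry_le _ _ _).trans ((norm_add_le _ _).trans ?_)
    rw [norm_smul, h3H]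
    have h1 : C * η ^ 2 ≤ |C| * η ^ 2 := by gcongr; exact le_abs_self C
    have h2 : ‖(a - a₀) * D * a₀ - (b - b₀) * D‖ ≤ Ka * η * d * B + Kb * η * d := by
      refine (norm_sub_le _ _).trans (add_le_add ?_ ((norm_mul_le _ _).trans (by gcongr)))
      calc _ ≤ ‖a - a₀‖ * ‖D‖ * ‖a₀‖ := (norm_mul_le _ _).trans
            (mul_le_mul_of_nonneg_right (norm_mul_le _ _) (norm_nonneg _))
        _ ≤ Ka * η * d * B := by gcongr
    have h3 : 3 * η * ‖(a - a₀) * D * a₀ - (b - b₀) * D‖ ≤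
        3 * η * (Ka * η * d * B + Kb * η * d) := by gcongr
    nlinarith
  rw [hasDerivAt_iff_isLittleO]
  refine IsBigO.trans_isLittleO (g := fun y => ‖y - y₀‖ ^ 2) ?_ ?_
  · refine IsBigO.of_bound (|C| + 3 * (Ka * d * B + Kb * d)) ?_
    have hball : Metric.closedBall y₀ (min (min δ δ') 1) ∈ 𝓝 y₀ :=
      Metric.closedBall_mem_nhds _ (by positivity)
    filter_upwards [hY.mem_nhds hy₀, hball] with y hyY hy
    rw [Metric.mem_closedBall, Real.dist_eq] at hy
    rw [norm_pow, norm_norm, Real.norm_eq_abs]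
    exact key y hyY hy
  · exact isLittleO_pow_sub_sub y₀ one_lt_two

variable {E : Type*} [NormedAddCommGroup E] [NormedSpace ℂ E] [CompleteSpace E]

/-- A disc about `pt k r t` whose radius is a small multiple of `r` stays in a slightly wider
sector. -/
lemma exists_disc_in_sector : ∃ ε, 0 < ε ∧ ∀ (k : Fin 6) (r t : ℝ) (w : ℂ), 0 < r →
    ‖w - pt k r t‖ ≤ ε * r → ∃ r' t', r / 2 ≤ r' ∧ |t' - t| ≤ Real.pi / 24 ∧ w = pt k r' t' := by
  have hpi := Real.pi_pos
  have hc : ContinuousAt Complex.arg 1 := Complex.continuousAt_arg (by simp [Complex.slitPlane])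
  obtain ⟨ε, hε, hball⟩ := Metric.continuousAt_iff.1 hc (Real.pi / 24) (by positivity)
  refine ⟨min (ε / 2) (1 / 2), by positivity, fun k r t w hr hw => ?_⟩
  have hp := pt_ne_zero k hr t
  set v := w / pt k r t with hv
  have hwv : w = pt k r t * v := by rw [hv]; field_simp
  have hv1 : ‖v - 1‖ ≤ min (ε / 2) (1 / 2) := by
    rw [hwv, show pt k r t * v - pt k r t = (v - 1) * pt k r t by ring, norm_mul,
      norm_pt_of_pos k hr] at hw
    exact le_of_mul_le_mul_right hw hr
  refine ⟨r * ‖v‖, t + v.arg, ?_, ?_, ?_⟩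
  · have h1 := norm_sub_norm_le 1 v
    rw [norm_one, norm_sub_rev] at h1
    have := hv1.trans (min_le_right _ _)
    nlinarith
  · have := hball (x := v) (by
      rw [dist_eq_norm]; linarith [hv1.trans (min_le_left _ _)])
    rw [Complex.arg_one, dist_zero_right, Real.norm_eq_abs] at this
    rw [add_sub_cancel_left]
    exact this.le
  · rw [hwv]
    conv_lhs => rw [← Complex.norm_mul_exp_arg_mul_I v]
    unfold pt
    push_cast
    rw [add_mul, Complex.exp_add]
    ring

/-- The derivatives decay at infinity, by a Cauchy estimate in a disc of radius comparable to
`r`. -/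
lemma SectorialFamily.exists_deriv_bound {f : Fin 6 → ℂ → E} {a : E} {W : ℝ → ℝ}
    (h : SectorialFamily f a W) : ∃ C, 0 ≤ C ∧ ∀ k r t, 0 < r → t ∈ Icc 0 (Real.pi / 3) →
      ‖deriv (f k) (pt k r t)‖ ≤ C * (r ^ 2)⁻¹ := by
  obtain ⟨ε, hε, hdisc⟩ := exists_disc_in_sector
  set C₀ := |3 / Real.pi * (Real.sin (Real.pi / 24))⁻¹ * ∫ r in Ioi 0, r ^ 0 * W r| with hC₀
  have hC₀0 : 0 ≤ C₀ := abs_nonneg _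
  refine ⟨2 * C₀ / ε, by positivity, fun k r t hr ht => ?_⟩
  set z := pt k r t with hz
  have hεr : 0 < ε * r := by positivity
  have hgd : DiffContOnCl ℂ (fun w => f k w - a) (Metric.ball z (ε * r)) :=
    ((h.differentiable k).sub_const a).diffContOnCl
  have hsphere : ∀ w ∈ Metric.sphere z (ε * r), ‖f k w - a‖ ≤ 2 * C₀ * r⁻¹ := by
    intro w hw
    rw [mem_sphere_iff_norm] at hw
    obtain ⟨r', t', hr', ht', rfl⟩ := hdisc k r t w hr hw.le
    rw [abs_le] at ht'
    have hr0' : 0 < r' := by linarith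
    have := h.norm_sub_expansion_le k hr0' (by linarith [ht.1]) (by linarith [ht.2]) 0 (t := t')
    rw [Finset.Icc_eq_empty (by norm_num), Finset.sum_empty, add_zero, zero_add, pow_one] at this
    refine this.trans ?_
    have h1 : r'⁻¹ ≤ 2 * r⁻¹ := by
      have h2 : (r / 2)⁻¹ = 2 * r⁻¹ := by field_simp
      rw [← h2]
      exact inv_anti₀ (by positivity) hr'
    calc _ ≤ C₀ * (2 * r⁻¹) := mul_le_mul (le_abs_self _) h1 (by positivity) hC₀0
      _ = _ := by ring
  have hd := Complex.norm_deriv_le_of_forall_mem_sphere_norm_le hεr hgd hsphere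
  rw [deriv_sub_const] at hd
  refine hd.trans_eq ?_
  field_simp

end Derivative

section NormedAlgebra

variable {R : Type*} [NormedRing R] [NormedAlgebra ℂ R]

/-- The differential equation `m' + m X' = (X' + [a, X₁]) m` for a truncated expansion, without the
term `m'`; here `X' = Q + X₀` and `Q = z X₁` with `z = u⁻¹`. The terms of order `1` cancel. -/
lemma expansion_identity {a b X₀ X₁ Q : R} {u : ℂ} (hQ : X₁ = u • Q) :
    (1 + (u • a + u ^ 2 • b)) * (Q + X₀) -
      (Q + X₀ + (a * X₁ - X₁ * a)) * (1 + (u • a + u ^ 2 • b)) =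
    u • (b * X₁ - X₁ * b - (a * X₁ - X₁ * a) * a + (a * X₀ - X₀ * a)) +
      u ^ 2 • (b * X₀ - X₀ * b - (a * X₁ - X₁ * a) * b) := by
  subst hQ
  simp only [mul_add, add_mul, sub_mul, smul_mul_assoc, mul_smul_comm, mul_one, one_mul, smul_smul,
    smul_add, smul_sub]
  module

/-- Uniqueness of the first coefficient of an expansion in `u = 1 / z`. -/
lemma eq_zero_of_norm_smul_le {E : Type*} [NormedAddCommGroup E] [NormedSpace ℂ E] {e : E} {C : ℝ}
    (h : ∀ r : ℝ, 1 ≤ r → ∃ u : ℂ, ‖u‖ = r⁻¹ ∧ ‖u • e‖ ≤ C * r⁻¹ ^ 2) : e = 0 := by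
  have hlim : Tendsto (fun r : ℝ => C * r⁻¹) atTop (𝓝 0) := by
    simpa using tendsto_inv_atTop_zero.const_mul C
  refine norm_le_zero_iff.1 (ge_of_tendsto hlim ((eventually_ge_atTop 1).mono fun r hr => ?_))
  obtain ⟨u, hu, hb⟩ := h r hr
  have hr0 : 0 < r := by linarith
  rw [norm_smul, hu] at hb
  refine le_of_mul_le_mul_left (hb.trans_eq ?_) (inv_pos.2 hr0)
  ring

end NormedAlgebra


/-! ### The linear differential equation in the spectral variable -/

section NormedAlgebra

variable {R : Type*} [NormedRing R] [NormedAlgebra ℂ R]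

/-- The expansion of the coefficient matrix `(m' + m X') m⁻¹` up to a term of order `1 / z`. -/
lemma norm_laxMatrix_sub_le {m n d a b X₀ X₁ : R} {u z : ℂ} {C : ℝ} (hzu : z * u = 1)
    (hu : ‖u‖ ≤ 1) (hC : 0 ≤ C) (ha : ‖a‖ ≤ C) (hb : ‖b‖ ≤ C) (h1 : ‖X₁‖ ≤ C) (h0 : ‖X₀‖ ≤ C)
    (hn : ‖n‖ ≤ C) (hm : ‖m - (1 + u • a + u ^ 2 • b)‖ ≤ C * ‖u‖ ^ 3)
    (hn' : ‖n - (1 - u • a + u ^ 2 • (a * a - b))‖ ≤ C * ‖u‖ ^ 3)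
    (hd : ‖d‖ ≤ C * ‖u‖ ^ 2) :
    ‖(d + m * (z • X₁ + X₀)) * n - (z • X₁ + X₀) - (a * X₁ - X₁ * a)‖ ≤
      (2 * (6 * (C ^ 2 + 2 * C) ^ 3 + ‖(1 : R)‖ * (C ^ 2 + 2 * C) ^ 2) + 4 * C ^ 3 + 7 * C ^ 2) *
        ‖u‖ := by
  set c := a * a - b with hc
  set P := C ^ 2 + 2 * C with hP
  set T := 6 * P ^ 3 + ‖(1 : R)‖ * P ^ 2 with hT
  have hCP : C ≤ P := by nlinarith [sq_nonneg C]
  have hP0 : 0 ≤ P := hC.trans hCP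
  have hT0 : 0 ≤ T := by positivity
  have hu0 := norm_nonneg u
  have hu3 : 0 ≤ ‖u‖ ^ 3 := by positivity
  have p3 : ‖u‖ ^ 3 ≤ ‖u‖ := pow_le_of_le_one hu0 hu (by norm_num)
  have p2 : ‖u‖ ^ 2 ≤ ‖u‖ := pow_le_of_le_one hu0 hu (by norm_num)
  have hcn : ‖c‖ ≤ C ^ 2 + C := by
    refine (norm_sub_le _ _).trans (add_le_add ((norm_mul_le _ _).trans ?_) hb)
    rw [sq]; gcongr
  have hprod : ∀ D : R, ‖D‖ ≤ C →
      ‖m * D * n - (D + u • (a * D + D * (-a)) + u ^ 2 • (a * D * (-a) + b * D + D * c))‖ ≤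
        T * ‖u‖ ^ 3 := by
    intro D hD
    refine norm_mul_mul_sub_le hu hP0 (ha.trans hCP) (hb.trans hCP)
      (by rw [norm_neg]; exact ha.trans hCP) (hcn.trans (by linarith)) (hD.trans hCP)
      (hn.trans hCP) (hm.trans (by gcongr)) ?_
    rw [smul_neg, ← sub_eq_add_neg]
    exact hn'.trans (by gcongr)
  have hbd : ∀ D : R, ‖D‖ ≤ C → ‖a * D * (-a) + b * D + D * c‖ ≤ 2 * C ^ 3 + 2 * C ^ 2 := by
    intro D hD
    have i1 : ‖a * D * (-a)‖ ≤ C * C * C := by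
      rw [mul_neg, norm_neg]
      exact (norm_mul_le _ _).trans (mul_le_mul ((norm_mul_le _ _).trans (by gcongr)) ha
        (norm_nonneg _) (by positivity))
    have i2 : ‖b * D‖ ≤ C * C := (norm_mul_le _ _).trans (by gcongr)
    have i3 : ‖D * c‖ ≤ C * (C ^ 2 + C) := (norm_mul_le _ _).trans (by gcongr)
    refine (norm_add_le _ _).trans ((add_le_add ((norm_add_le _ _).trans (add_le_add i1 i2))
      i3).trans (le_of_eq ?_))
    ring
  have b1 := hbd X₁ h1
  have b0 := hbd X₀ h0
  have l0 : ‖a * X₀ + X₀ * (-a)‖ ≤ 2 * C ^ 2 := by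
    have i1 : ‖a * X₀‖ ≤ C * C := (norm_mul_le _ _).trans (by gcongr)
    have i2 : ‖X₀ * (-a)‖ ≤ C * C := by
      rw [mul_neg, norm_neg]; exact (norm_mul_le _ _).trans (by gcongr)
    refine (norm_add_le _ _).trans ((add_le_add i1 i2).trans (le_of_eq ?_))
    ring
  have h1' := hprod X₁ h1
  have h0' := hprod X₀ h0
  set F₁ := a * X₁ * (-a) + b * X₁ + X₁ * c with hF₁
  set F₀ := a * X₀ * (-a) + b * X₀ + X₀ * c with hF₀
  set l := a * X₀ + X₀ * (-a) with hl
  set E₁ := m * X₁ * n - (X₁ + u • (a * X₁ + X₁ * (-a)) + u ^ 2 • F₁) with hE₁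
  set E₀ := m * X₀ * n - (X₀ + u • l + u ^ 2 • F₀) with hE₀
  have e1 : (d + m * (z • X₁ + X₀)) * n - (z • X₁ + X₀) - (a * X₁ - X₁ * a) =
      d * n + z • E₁ + u • F₁ + E₀ + u • l + u ^ 2 • F₀ := by
    have e3 : z • (u • (a * X₁ + X₁ * (-a))) = a * X₁ - X₁ * a := by
      rw [smul_smul, hzu, one_smul, mul_neg, sub_eq_add_neg]
    have e4 : z • (u ^ 2 • F₁) = u • F₁ := by
      rw [smul_smul, sq, ← mul_assoc, hzu, one_mul]
    have e5 : z • E₁ = z • (m * X₁ * n) - (z • X₁ + (a * X₁ - X₁ * a) + u • F₁) := by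
      rw [hE₁, smul_sub, smul_add, smul_add, e3, e4]
    rw [e5, hE₀, mul_add m, mul_smul_comm, add_mul, add_mul, smul_mul_assoc]
    abel
  have hdn : ‖d‖ ≤ C * ‖u‖ := hd.trans (by gcongr)
  rw [e1]
  have t1 : ‖d * n‖ ≤ C * ‖u‖ * C := (norm_mul_le _ _).trans (by gcongr)
  have t2 : ‖z • E₁‖ ≤ T * ‖u‖ := by
    have hz : ‖z‖ * ‖u‖ = 1 := by rw [← norm_mul, hzu, norm_one]
    rw [norm_smul]
    calc _ ≤ ‖z‖ * (T * ‖u‖ ^ 3) := by gcongr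
      _ = (‖z‖ * ‖u‖) * (T * ‖u‖ ^ 2) := by ring
      _ ≤ _ := by rw [hz, one_mul]; gcongr
  have t3 : ‖u • F₁‖ ≤ ‖u‖ * (2 * C ^ 3 + 2 * C ^ 2) := by rw [norm_smul]; gcongr
  have t4 : ‖E₀‖ ≤ T * ‖u‖ := h0'.trans (by gcongr)
  have t5 : ‖u • l‖ ≤ ‖u‖ * (2 * C ^ 2) := by rw [norm_smul]; gcongr
  have t6 : ‖u ^ 2 • F₀‖ ≤ ‖u‖ * (2 * C ^ 3 + 2 * C ^ 2) := by
    rw [norm_smul, norm_pow]; gcongr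
  refine (norm_add_le _ _).trans ((add_le_add ((norm_add_le _ _).trans (add_le_add
    ((norm_add_le _ _).trans (add_le_add ((norm_add_le _ _).trans (add_le_add
    ((norm_add_le _ _).trans (add_le_add t1 t2)) t3)) t4)) t5)) t6).trans (le_of_eq ?_))
  ring

end NormedAlgebra

section Lax

open Matrix Set MeasureTheory
open scoped Matrix.Norms.Operator

lemma hasDerivAt_matrix {f : ℂ → Matrix (Fin 3) (Fin 3) ℂ} {f' : Matrix (Fin 3) (Fin 3) ℂ} {z : ℂ}
    (h : ∀ i j, HasDerivAt (fun z => f z i j) (f' i j) z) : HasDerivAt f f' z := by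
  have h1 : f = fun z => ∑ i, ∑ j, f z i j • Matrix.single i j (1 : ℂ) := by
    funext z
    conv_lhs => rw [Matrix.matrix_eq_sum_single (f z)]
    simp [Matrix.smul_single]
  have h2 : f' = ∑ i, ∑ j, f' i j • Matrix.single i j (1 : ℂ) := by
    conv_lhs => rw [Matrix.matrix_eq_sum_single f']
    simp [Matrix.smul_single]
  rw [h1, h2]
  exact HasDerivAt.fun_sum fun i _ => HasDerivAt.fun_sum fun j _ => (h i j).smul_const _

/-- The derivative in `z` of the exponent `X = 3 y z J + (27/4) z² J²`. -/
noncomputable def derivX (y : ℝ) (z : ℂ) : Matrix (Fin 3) (Fin 3) ℂ :=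
  z • (27 / 2 : ℂ) • Matrix.diagonal (fun i => J i ^ 2) + (3 * y : ℂ) • Matrix.diagonal J

lemma derivX_eq (y : ℝ) (z : ℂ) :
    derivX y z = Matrix.diagonal fun i => 3 * y * J i + 27 / 2 * z * J i ^ 2 := by
  rw [derivX, ← Matrix.diagonal_smul, ← Matrix.diagonal_smul, ← Matrix.diagonal_smul,
    Matrix.diagonal_add]
  congr 1; funext i
  simp only [Pi.smul_apply, smul_eq_mul]; ring

/-- The jump matrix `v = e^X S e^{-X}` satisfies `v' = [X', v]`. -/
lemma hasDerivAt_jump (s₁ s₃ : ℂ) (k : Fin 6) (y : ℝ) (z : ℂ) :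
    HasDerivAt (jump s₁ s₃ k y)
      (derivX y z * jump s₁ s₃ k y z - jump s₁ s₃ k y z * derivX y z) z := by
  have hphase : ∀ i, HasDerivAt (fun z => phase y z i) (3 * y * J i + 27 / 2 * z * J i ^ 2) z := by
    intro i
    unfold phase
    have h1 := ((hasDerivAt_id z).const_mul (3 * (y : ℂ))).mul_const (J i)
    have h2 := ((hasDerivAt_pow 2 z).const_mul (27 / 4 : ℂ)).mul_const (J i ^ 2)
    refine (h1.add h2).congr_deriv ?_
    push_cast
    ring
  refine hasDerivAt_matrix fun i j => ?_
  have hentry : ∀ z, jump s₁ s₃ k y z i j =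
      Complex.exp (phase y z i - phase y z j) * stokes s₁ s₃ k i j := by
    intro z
    rw [jump, Matrix.mul_diagonal, Matrix.diagonal_mul, sub_eq_add_neg, Complex.exp_add]
    ring
  simp only [hentry]
  have h := (((hphase i).sub (hphase j)).cexp).mul_const (stokes s₁ s₃ k i j)
  refine h.congr_deriv ?_
  rw [derivX_eq, Matrix.sub_apply, Matrix.diagonal_mul, Matrix.mul_diagonal, hentry]
  simp only [Pi.sub_apply]
  ring

namespace SolutionPieces

variable {s₁ s₃ : ℂ} {y : ℝ} {M : Fin 6 → ℂ → Matrix (Fin 3) (Fin 3) ℂ}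

/-- The coefficient matrix of the linear differential equation in `z`, computed in any sector. -/
lemma laxMatrix_eq (h : SolutionPieces s₁ s₃ y M) (k : Fin 6) (z : ℂ) :
    (deriv (M k) z + M k z * derivX y z) * (M k z).adjugate =
      (deriv (M 0) z + M 0 z * derivX y z) * (M 0 z).adjugate := by
  refine eq_apply_zero_of_eq_sub_one
    (g := fun k => (deriv (M k) z + M k z * derivX y z) * (M k z).adjugate) (fun k => ?_) k
  have hd : deriv (M k) z = deriv (M (k - 1)) z * PIVModel.jump s₁ s₃ k y z +
      M (k - 1) z * (derivX y z * PIVModel.jump s₁ s₃ k y z -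
        PIVModel.jump s₁ s₃ k y z * derivX y z) := by
    have h1 := ((h.differentiable (k - 1)) z).hasDerivAt.mul (hasDerivAt_jump s₁ s₃ k y z)
    refine Eq.trans ?_ h1.deriv
    congr 1
    funext w
    exact h.jump k w
  have e1 : deriv (M k) z + M k z * derivX y z =
      (deriv (M (k - 1)) z + M (k - 1) z * derivX y z) * PIVModel.jump s₁ s₃ k y z := by
    rw [hd, h.jump k z]
    simp only [mul_sub, add_mul, mul_assoc]
    abel
  change (deriv (M k) z + M k z * derivX y z) * (M k z).adjugate =
    (deriv (M (k - 1)) z + M (k - 1) z * derivX y z) * (M (k - 1) z).adjugate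
  rw [e1, h.jump k z, Matrix.adjugate_mul_distrib]
  calc _ = (deriv (M (k - 1)) z + M (k - 1) z * derivX y z) * (PIVModel.jump s₁ s₃ k y z *
        (PIVModel.jump s₁ s₃ k y z).adjugate) * (M (k - 1) z).adjugate := by
        simp only [mul_assoc]
    _ = _ := by rw [mul_adjugate_of_det_eq_one (det_jump _ _ _ _ _), mul_one]

lemma exists_expansion (h : SolutionPieces s₁ s₃ y M) (N : ℕ) :
    ∃ C, 0 ≤ C ∧ (∀ n ≤ N, ‖coef M n‖ ≤ C) ∧ ∀ k r t, 0 < r → t ∈ Icc 0 (Real.pi / 3) →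
        ‖M k (pt k r t)‖ ≤ C ∧
        ‖M k (pt k r t) - (1 + ∑ n ∈ Finset.Icc 1 N, (pt k r t ^ n)⁻¹ • coef M n)‖ ≤
          C * (r ^ (N + 1))⁻¹ := by
  obtain ⟨δ, hδ, -, C, hC0, hC⟩ := h.exists_uniform_expansion N
  exact ⟨C, hC0, hC y (by simpa using hδ.le) M h⟩

/-- The differential equation in `z`: its coefficient matrix is an entire function that grows
linearly, and is found from the expansion at infinity. -/
theorem lax_equation (h : SolutionPieces s₁ s₃ y M) (k : Fin 6) (z : ℂ) :
    deriv (M k) z + M k z * derivX y z =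
      (derivX y z + (coef M 1 * (27 / 2 : ℂ) • Matrix.diagonal (fun i => J i ^ 2) -
        (27 / 2 : ℂ) • Matrix.diagonal (fun i => J i ^ 2) * coef M 1)) * M k z := by
  set a := coef M 1 with ha
  set b := coef M 2 with hb
  set X₁ : Matrix (Fin 3) (Fin 3) ℂ := (27 / 2 : ℂ) • Matrix.diagonal (fun i => J i ^ 2) with hX₁
  set X₀ : Matrix (Fin 3) (Fin 3) ℂ := (3 * y : ℂ) • Matrix.diagonal J with hX₀
  have hXz : ∀ z, derivX y z = z • X₁ + X₀ := fun _ => rfl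
  set A : ℂ → Matrix (Fin 3) (Fin 3) ℂ := fun z =>
    (deriv (M 0) z + M 0 z * derivX y z) * (M 0 z).adjugate with hA
  suffices hAz : A z - derivX y z = a * X₁ - X₁ * a by
    have e1 : A z = (deriv (M k) z + M k z * derivX y z) * (M k z).adjugate :=
      (h.laxMatrix_eq k z).symm
    rw [← hAz, add_sub_cancel, e1, mul_assoc, adjugate_mul_of_det_eq_one (h.det k z), mul_one]
  have hXd : Differentiable ℂ (derivX y) := by
    have : derivX y = fun z => z • X₁ + X₀ := funext hXz
    rw [this]; fun_prop
  have hdd : Differentiable ℂ (deriv (M 0)) := fun z =>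
    ((h.differentiable 0).differentiableOn.deriv isOpen_univ).differentiableAt univ_mem
  have hAd : Differentiable ℂ A :=
    (hdd.add ((h.differentiable 0).mul hXd)).mul (differentiable_adjugate (h.differentiable 0))
  refine eq_of_tendsto_in_sectors (d := fun z => A z - derivX y z) (hAd.sub hXd) ?_ z
  obtain ⟨C, hC0, hcoef, hexp⟩ := h.exists_expansion 2
  obtain ⟨B, hB0, hB⟩ := h.exists_bound
  obtain ⟨Cd, hCd0, hCd⟩ := (h.sectorialFamily le_rfl hB0 hB).exists_deriv_bound
  have hA₀0 : 0 ≤ 6 * C ^ 2 := by positivity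
  obtain ⟨C₁, hC₁0, l1, l2, l3, l4, l5, l6⟩ : ∃ C₁ : ℝ, 0 ≤ C₁ ∧ C ≤ C₁ ∧ 6 * C ^ 2 ≤ C₁ ∧
      6 * C ^ 2 * (2 * C * (C ^ 2 + C) + C ^ 2 +
        C * (‖(1 : Matrix (Fin 3) (Fin 3) ℂ)‖ + 2 * C + C ^ 2)) ≤ C₁ ∧
      ‖X₁‖ ≤ C₁ ∧ ‖X₀‖ ≤ C₁ ∧ Cd ≤ C₁ :=
    ⟨max (max C (6 * C ^ 2)) (max (max ‖X₁‖ ‖X₀‖) (max Cd (6 * C ^ 2 * (2 * C * (C ^ 2 + C) +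
      C ^ 2 + C * (‖(1 : Matrix (Fin 3) (Fin 3) ℂ)‖ + 2 * C + C ^ 2))))),
      by simp [hC0], by simp, by simp, by simp, by simp, by simp, by simp⟩
  set L := 2 * (6 * (C₁ ^ 2 + 2 * C₁) ^ 3 + ‖(1 : Matrix (Fin 3) (Fin 3) ℂ)‖ *
    (C₁ ^ 2 + 2 * C₁) ^ 2) + 4 * C₁ ^ 3 + 7 * C₁ ^ 2 with hL
  -- the difference is of order `1 / r`
  have hmain : ∀ k r t, 1 ≤ r → t ∈ Icc 0 (Real.pi / 3) →
      ‖A (pt k r t) - derivX y (pt k r t) - (a * X₁ - X₁ * a)‖ ≤ L * r⁻¹ := by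
    intro k r t hr1 ht
    have hr0 : 0 < r := by linarith
    set z := pt k r t with hz
    have hzn : ‖z‖ = r := norm_pt_of_pos k hr0 t
    have hz0 : z ≠ 0 := pt_ne_zero k hr0 t
    set u := z⁻¹ with hu
    have hun : ‖u‖ = r⁻¹ := by rw [hu, norm_inv, hzn]
    have hri : r⁻¹ ≤ 1 := inv_le_one_of_one_le₀ hr1
    have hu1 : ‖u‖ ≤ 1 := by rw [hun]; exact hri
    have hr3 : (r ^ (2 + 1))⁻¹ = ‖u‖ ^ 3 := by rw [hun, inv_pow]
    have hu3 : 0 ≤ ‖u‖ ^ 3 := by positivity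
    have hm := (hexp k r t hr0 ht).2
    rw [← hz, show Finset.Icc 1 2 = {1, 2} from rfl, Finset.sum_pair (by norm_num), pow_one,
      ← inv_pow, ← add_assoc, hr3] at hm
    have hadj : ‖(M k z).adjugate‖ ≤ 6 * C ^ 2 := by
      refine (norm_adjugate_le _).trans ?_
      have := (hexp k r t hr0 ht).1
      gcongr
    have haC : ‖a‖ ≤ C := hcoef 1 (by norm_num)
    have hbC : ‖b‖ ≤ C := hcoef 2 le_rfl
    have hinv := norm_inverse_sub_le hA₀0 hC0 hu1 (adjugate_mul_of_det_eq_one (h.det k z)) hadj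
      haC hbC hm
    have hd := hCd k r t hr0 ht
    rw [← hz, ← inv_pow, ← hun] at hd
    have e2 : A z = (deriv (M k) z + M k z * derivX y z) * (M k z).adjugate :=
      (h.laxMatrix_eq k z).symm
    rw [e2, hXz, ← hun]
    exact norm_laxMatrix_sub_le (mul_inv_cancel₀ hz0) hu1 hC₁0
      (haC.trans l1) (hbC.trans l1) l4 l5 (hadj.trans l2)
      (hm.trans (mul_le_mul_of_nonneg_right l1 hu3))
      (hinv.trans (mul_le_mul_of_nonneg_right l3 hu3))
      (hd.trans (mul_le_mul_of_nonneg_right l6 (by positivity)))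
  clear_value L
  intro k e he
  refine ⟨max 1 (L / e), fun r hr t ht => ?_⟩
  simp only [ge_iff_le, max_le_iff] at hr
  refine (hmain k r t hr.1 ht).trans ?_
  have hr0 : 0 < r := by linarith [hr.1]
  rw [← div_eq_mul_inv, div_le_iff₀ hr0]
  have := (div_le_iff₀ he).1 hr.2
  linarith

/-- The differential equation in `z` at the order `z⁻¹`. It expresses the off-diagonal entries of
the second coefficient `b` by the first coefficient `a`. -/
theorem coef_relation (h : SolutionPieces s₁ s₃ y M) {a b X₀ X₁ : Matrix (Fin 3) (Fin 3) ℂ}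
    (ha : a = coef M 1) (hb : b = coef M 2)
    (hX₁ : X₁ = (27 / 2 : ℂ) • Matrix.diagonal (fun i => J i ^ 2))
    (hX₀ : X₀ = (3 * y : ℂ) • Matrix.diagonal J) :
    b * X₁ - X₁ * b - (a * X₁ - X₁ * a) * a + (a * X₀ - X₀ * a) = 0 := by
  have hpi := Real.pi_pos
  have hXz : ∀ z, derivX y z = z • X₁ + X₀ := fun _ => by rw [hX₁, hX₀]; rfl
  obtain ⟨C, hC0, hcoef, hexp⟩ := h.exists_expansion 2
  obtain ⟨B, hB0, hB⟩ := h.exists_bound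
  obtain ⟨Cd, hCd0, hCd⟩ := (h.sectorialFamily le_rfl hB0 hB).exists_deriv_bound
  set V := a * X₁ - X₁ * a with hV
  refine eq_zero_of_norm_smul_le (C := Cd + ‖b * X₀ - X₀ * b - V * b‖ +
    2 * C * (‖X₁‖ + ‖X₀‖) + ‖V‖ * C) fun r hr1 => ?_
  have hr0 : 0 < r := by linarith
  have ht : Real.pi / 6 ∈ Icc 0 (Real.pi / 3) := ⟨by positivity, by linarith⟩
  set z := pt 0 r (Real.pi / 6) with hz
  have hzn : ‖z‖ = r := norm_pt_of_pos 0 hr0 _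
  have hz0 : z ≠ 0 := pt_ne_zero 0 hr0 _
  set u := z⁻¹ with hu
  have hun : ‖u‖ = r⁻¹ := by rw [hu, norm_inv, hzn]
  have hri : r⁻¹ ≤ 1 := inv_le_one_of_one_le₀ hr1
  refine ⟨u, hun, ?_⟩
  set p := 1 + (u • a + u ^ 2 • b) with hp
  have hm : ‖M 0 z - p‖ ≤ C * r⁻¹ ^ 3 := by
    have := (hexp 0 r _ hr0 ht).2
    rw [show Finset.Icc 1 2 = {1, 2} from rfl, Finset.sum_pair (by norm_num), ← hz, ← ha, ← hb,
      pow_one, ← inv_pow, ← inv_pow, ← hu] at this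
    exact this
  set ρ := M 0 z - p with hρ
  have hd := hCd 0 r _ hr0 ht
  rw [← hz, ← inv_pow] at hd
  have hQ : X₁ = u • (z • X₁) := by rw [smul_smul, hu, inv_mul_cancel₀ hz0, one_smul]
  have hid := expansion_identity (a := a) (b := b) (X₀ := X₀) hQ
  have hlax := h.lax_equation 0 z
  rw [← ha, ← hX₁, hXz] at hlax
  have hMp : M 0 z = p + ρ := by rw [hρ]; abel
  have e1 : u • (b * X₁ - X₁ * b - V * a + (a * X₀ - X₀ * a)) =
      -(deriv (M 0) z + u ^ 2 • (b * X₀ - X₀ * b - V * b) + ρ * (z • X₁ + X₀) -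
        (z • X₁ + X₀) * ρ - V * ρ) := by
    have e2 : deriv (M 0) z + (p + ρ) * (z • X₁ + X₀) - (z • X₁ + X₀ + V) * (p + ρ) = 0 := by
      rw [← hMp, hlax, sub_self]
    have e3 : p * (z • X₁ + X₀) - (z • X₁ + X₀ + V) * p =
        u • (b * X₁ - X₁ * b - V * a + (a * X₀ - X₀ * a)) +
        u ^ 2 • (b * X₀ - X₀ * b - V * b) := hid
    have e4 : deriv (M 0) z + (p * (z • X₁ + X₀) - (z • X₁ + X₀ + V) * p) +
        (ρ * (z • X₁ + X₀) - (z • X₁ + X₀) * ρ - V * ρ) = 0 := by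
      rw [← e2]
      simp only [add_mul, mul_add]
      abel
    rw [e3] at e4
    rw [← sub_eq_zero, ← e4]
    abel
  rw [e1, norm_neg]
  have hXn : ‖z • X₁ + X₀‖ ≤ r * (‖X₁‖ + ‖X₀‖) := by
    refine (norm_add_le _ _).trans ?_
    rw [norm_smul, hzn]
    nlinarith [norm_nonneg X₀]
  have hCn : C * r⁻¹ ^ 3 * (r * (‖X₁‖ + ‖X₀‖)) = C * (‖X₁‖ + ‖X₀‖) * r⁻¹ ^ 2 := by field_simp
  have t1 : ‖u ^ 2 • (b * X₀ - X₀ * b - V * b)‖ = r⁻¹ ^ 2 * ‖b * X₀ - X₀ * b - V * b‖ := by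
    rw [norm_smul, norm_pow, hun]
  have t2 : ‖ρ * (z • X₁ + X₀)‖ ≤ C * (‖X₁‖ + ‖X₀‖) * r⁻¹ ^ 2 := by
    rw [← hCn]
    exact (norm_mul_le _ _).trans (by gcongr)
  have t3 : ‖(z • X₁ + X₀) * ρ‖ ≤ C * (‖X₁‖ + ‖X₀‖) * r⁻¹ ^ 2 := by
    rw [← hCn, mul_comm (C * r⁻¹ ^ 3)]
    exact (norm_mul_le _ _).trans (by gcongr)
  have t4 : ‖V * ρ‖ ≤ ‖V‖ * C * r⁻¹ ^ 2 := by
    have : r⁻¹ ^ 3 ≤ r⁻¹ ^ 2 := pow_le_pow_of_le_one (by positivity) hri (by norm_num)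
    calc _ ≤ ‖V‖ * ‖ρ‖ := norm_mul_le _ _
      _ ≤ ‖V‖ * (C * r⁻¹ ^ 2) := by
        gcongr
        exact hm.trans (by gcongr)
      _ = _ := by ring
  refine (norm_sub_le _ _).trans ?_
  refine (add_le_add ((norm_sub_le _ _).trans (add_le_add ((norm_add_le _ _).trans (add_le_add
    ((norm_add_le _ _).trans (add_le_add hd t1.le)) t2)) t3)) t4).trans (le_of_eq ?_)
  ring

end SolutionPieces

end Lax


/-! ### The symmetries of the first coefficient -/

section Symmetry

open Matrix Set
open scoped Matrix.Norms.Operator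

/-- The asymptotic expansion of the solution itself, off the contour. -/
lemma SolutionPieces.exists_expansion_of_eq {s₁ s₃ : ℂ} {y : ℝ} {m : ℂ → Matrix (Fin 3) (Fin 3) ℂ}
    {M : Fin 6 → ℂ → Matrix (Fin 3) (Fin 3) ℂ} (hM : SolutionPieces s₁ s₃ y M)
    (hmM : ∀ k, ∀ z ∈ openSector k, m z = M k z) (N : ℕ) :
    ∃ C, 0 ≤ C ∧ ∀ z ∉ contour, ‖m z - (1 + ∑ n ∈ Finset.Icc 1 N, (z ^ n)⁻¹ • coef M n)‖ ≤
      C * ‖(z ^ (N + 1))⁻¹‖ := by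
  obtain ⟨C, hC0, -, hC⟩ := hM.exists_expansion N
  refine ⟨C, hC0, fun z hz => ?_⟩
  obtain ⟨k, hk⟩ := mem_openSector_of_notMem_contour hz
  rw [hmM k z hk]
  obtain ⟨r, t, hr, h0, h1, rfl⟩ := exists_pt_of_mem_openSector hk
  rw [norm_inv, norm_pow, norm_pt_of_pos k hr]
  exact (hC k r t hr ⟨h0.le, h1.le⟩).2

lemma ofReal_notMem_contour {r : ℝ} (hr : 0 < r) : (r : ℂ) ∉ contour := by
  have hpi := Real.pi_pos
  have h : (r : ℂ) = pt 5 r (Real.pi / 6) := by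
    have : ((ang 5 + Real.pi / 6 : ℝ) : ℂ) * Complex.I = 2 * Real.pi * Complex.I := by
      have h5 : ((5 : Fin 6) : ℕ) = 5 := rfl
      rw [ang, h5]; push_cast; ring
    rw [pt_eq, this, Complex.exp_two_pi_mul_I, mul_one]
  rw [h]
  exact notMem_contour_of_mem_openSector
    (pt_mem_openSector (k := 5) hr (by positivity) (by linarith))

lemma omega_mul_ofReal_notMem_contour {r : ℝ} (hr : 0 < r) : omega * r ∉ contour := by
  have hpi := Real.pi_pos
  have h : omega * r = pt 1 r (Real.pi / 6) := by
    have : ((ang 1 + Real.pi / 6 : ℝ) : ℂ) * Complex.I = 2 * Real.pi * Complex.I / 3 := by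
      have h1 : ((1 : Fin 6) : ℕ) = 1 := rfl
      rw [ang, h1]; push_cast; ring
    rw [pt_eq, this, omega, mul_comm]
  rw [h]
  exact notMem_contour_of_mem_openSector
    (pt_mem_openSector (k := 1) hr (by positivity) (by linarith))

lemma omega_ne_zero : omega ≠ 0 := Complex.exp_ne_zero _

lemma norm_omega : ‖omega‖ = 1 := norm_J 0

lemma matA_inv_mul : matA⁻¹ * matA = 1 :=
  Matrix.nonsing_inv_mul _ (by simp [matA, Matrix.det_fin_three])

lemma matB_mul_matB : matB * matB = 1 := by
  rw [Matrix.one_fin_three]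
  ext i j
  fin_cases i <;> fin_cases j <;> simp [matB]

section

variable {s₁ s₃ : ℂ} {y : ℝ} {m : ℂ → Matrix (Fin 3) (Fin 3) ℂ}
  {M : Fin 6 → ℂ → Matrix (Fin 3) (Fin 3) ℂ}

/-- The `ℤ₃` symmetry at the order `z⁻¹`. -/
lemma IsSolution.matA_mul_coef_one (hm : IsSolution s₁ s₃ y m) (hM : SolutionPieces s₁ s₃ y M)
    (hmM : ∀ k, ∀ z ∈ openSector k, m z = M k z) :
    matA * coef M 1 = omega • (coef M 1 * matA) := by
  obtain ⟨C, hC0, hC⟩ := SolutionPieces.exists_expansion_of_eq hM hmM 1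
  set a := coef M 1 with ha
  have h0 : omega⁻¹ • (matA * a) - a * matA = 0 := by
    refine eq_zero_of_norm_smul_le (C := C * ‖matA‖ + ‖matA‖ * C) fun r hr1 => ?_
    have hr : 0 < r := by linarith
    refine ⟨(r : ℂ)⁻¹, by rw [norm_inv, Complex.norm_real, Real.norm_of_nonneg hr.le], ?_⟩
    have h1 := hC _ (ofReal_notMem_contour hr)
    have h2 := hC _ (omega_mul_ofReal_notMem_contour hr)
    rw [Finset.Icc_self, Finset.sum_singleton, pow_one, norm_inv, norm_pow] at h1 h2
    rw [norm_mul, norm_omega, one_mul] at h2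
    rw [Complex.norm_real, Real.norm_of_nonneg hr.le, ← inv_pow] at h1 h2
    set R := m r - (1 + (r : ℂ)⁻¹ • a) with hR
    set R' := m (omega * r) - (1 + (omega * r)⁻¹ • a) with hR'
    have h3 : matA * m (omega * r) = m r * matA := by
      rw [← hm.symm_three r (ofReal_notMem_contour hr), mul_assoc _ matA⁻¹, matA_inv_mul, mul_one]
    have e1 : (r : ℂ)⁻¹ • (omega⁻¹ • (matA * a) - a * matA) = R * matA - matA * R' := by
      rw [hR, hR', sub_mul, mul_sub, h3, mul_inv]
      simp only [mul_add, add_mul, mul_one, one_mul, smul_mul_assoc, mul_smul_comm]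
      module
    rw [e1]
    calc _ ≤ ‖R‖ * ‖matA‖ + ‖matA‖ * ‖R'‖ :=
          (norm_sub_le _ _).trans (add_le_add (norm_mul_le _ _) (norm_mul_le _ _))
      _ ≤ C * r⁻¹ ^ (1 + 1) * ‖matA‖ + ‖matA‖ * (C * r⁻¹ ^ (1 + 1)) := by gcongr
      _ = _ := by ring
  rw [← sub_eq_zero.1 h0, smul_smul, mul_inv_cancel₀ omega_ne_zero, one_smul]

lemma norm_map_conj_le (A : Matrix (Fin 3) (Fin 3) ℂ) :
    ‖A.map (starRingEnd ℂ)‖ ≤ 3 * ‖A‖ :=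
  norm_le_of_entry_le (norm_nonneg A) fun i j => by
    rw [Matrix.map_apply, RCLike.norm_conj]; exact norm_entry_le A i j

/-- The `ℤ₂` symmetry at the order `z⁻¹`. -/
lemma IsSolution.coef_one_eq_conj (hm : IsSolution s₁ s₃ y m) (hM : SolutionPieces s₁ s₃ y M)
    (hmM : ∀ k, ∀ z ∈ openSector k, m z = M k z) :
    coef M 1 = matB * (coef M 1).map (starRingEnd ℂ) * matB := by
  obtain ⟨C, hC0, hC⟩ := SolutionPieces.exists_expansion_of_eq hM hmM 1
  set a := coef M 1 with ha
  rw [← sub_eq_zero]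
  refine eq_zero_of_norm_smul_le (C := ‖matB‖ * (3 * C) * ‖matB‖ + C) fun r hr1 => ?_
  have hr : 0 < r := by linarith
  refine ⟨(r : ℂ)⁻¹, by rw [norm_inv, Complex.norm_real, Real.norm_of_nonneg hr.le], ?_⟩
  have h1 := hC _ (ofReal_notMem_contour hr)
  rw [Finset.Icc_self, Finset.sum_singleton, pow_one, norm_inv, norm_pow] at h1
  rw [Complex.norm_real, Real.norm_of_nonneg hr.le, ← inv_pow] at h1
  set R := m r - (1 + (r : ℂ)⁻¹ • a) with hR
  have h3 := hm.symm_two r (ofReal_notMem_contour hr)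
  rw [Complex.conj_ofReal] at h3
  have e2 : R.map (starRingEnd ℂ) = (m r).map (starRingEnd ℂ) -
      (1 + (r : ℂ)⁻¹ • a.map (starRingEnd ℂ)) := by
    ext i j
    simp [hR, Matrix.one_apply, apply_ite]
  have e1 : (r : ℂ)⁻¹ • (a - matB * a.map (starRingEnd ℂ) * matB) =
      matB * R.map (starRingEnd ℂ) * matB - R := by
    rw [e2, mul_sub, sub_mul, ← h3, mul_add, add_mul, mul_one, matB_mul_matB, hR, mul_smul_comm,
      smul_mul_assoc]
    module
  rw [e1]
  calc _ ≤ ‖matB‖ * ‖R.map (starRingEnd ℂ)‖ * ‖matB‖ + ‖R‖ :=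
        (norm_sub_le _ _).trans (add_le_add ((norm_mul_le _ _).trans
          (mul_le_mul_of_nonneg_right (norm_mul_le _ _) (norm_nonneg _))) le_rfl)
    _ ≤ ‖matB‖ * (3 * (C * r⁻¹ ^ (1 + 1))) * ‖matB‖ + C * r⁻¹ ^ (1 + 1) := by
      have := norm_map_conj_le R
      gcongr
      linarith
    _ = _ := by ring

end

/-- The form that the two symmetries give to the first coefficient. -/
lemma eq_of_symmetries {a : Matrix (Fin 3) (Fin 3) ℂ} (hA : matA * a = omega • (a * matA))
    (hB : a = matB * a.map (starRingEnd ℂ) * matB) :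
    a = !![omega ^ 2 * (a 2 2).re, omega ^ 2 * (starRingEnd ℂ) (a 2 1), omega ^ 2 * a 2 1;
           omega * a 2 1, omega * (a 2 2).re, omega * (starRingEnd ℂ) (a 2 1);
           (starRingEnd ℂ) (a 2 1), a 2 1, ((a 2 2).re : ℂ)] := by
  have hB20 : a 2 0 = (starRingEnd ℂ) (a 2 1) := by
    have := congr_fun (congr_fun hB 2) 0
    simp only [Matrix.mul_apply, Fin.sum_univ_three, Matrix.map_apply] at this
    simpa [matB] using this
  have hB22 : ((a 2 2).re : ℂ) = a 2 2 := by
    have := congr_fun (congr_fun hB 2) 2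
    simp only [Matrix.mul_apply, Fin.sum_univ_three, Matrix.map_apply] at this
    refine Complex.conj_eq_iff_re.1 (Eq.symm ?_)
    simpa [matB] using this
  have h (i j : Fin 3) : (matA * a) i j = omega * (a * matA) i j := by rw [hA]; rfl
  have h10 : a 1 0 = omega * a 2 1 := by
    simpa [matA, Matrix.mul_apply, Fin.sum_univ_three] using h 2 0
  have h11 : a 1 1 = omega * a 2 2 := by
    simpa [matA, Matrix.mul_apply, Fin.sum_univ_three] using h 2 1
  have h12 : a 1 2 = omega * a 2 0 := by
    simpa [matA, Matrix.mul_apply, Fin.sum_univ_three] using h 2 2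
  have h00 : a 0 0 = omega * a 1 1 := by
    simpa [matA, Matrix.mul_apply, Fin.sum_univ_three] using h 1 0
  have h01 : a 0 1 = omega * a 1 2 := by
    simpa [matA, Matrix.mul_apply, Fin.sum_univ_three] using h 1 1
  have h02 : a 0 2 = omega * a 1 0 := by
    simpa [matA, Matrix.mul_apply, Fin.sum_univ_three] using h 1 2
  rw [hB22, ← hB20]
  ext i j
  fin_cases i <;> fin_cases j <;> simp [h00, h01, h02, h10, h11, h12] <;> ring

lemma commutator_mul_apply (a : Matrix (Fin 3) (Fin 3) ℂ) (d : Fin 3 → ℂ) (i j : Fin 3) :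
    ((a * Matrix.diagonal d - Matrix.diagonal d * a) * a) i j =
      ∑ l, a i l * (d l - d i) * a l j := by
  rw [Matrix.mul_apply]
  refine Finset.sum_congr rfl fun l _ => ?_
  rw [Matrix.sub_apply, Matrix.mul_diagonal, Matrix.diagonal_mul]
  ring

/-- The `(2, 1)` entry of the evolution equation, with the second coefficient eliminated. -/
lemma evolution_entry {a b : Matrix (Fin 3) (Fin 3) ℂ} {y f₁ f₂ f₃ : ℂ}
    (ha : a = !![omega ^ 2 * f₃, omega ^ 2 * f₁, omega ^ 2 * f₂;
                 omega * f₂, omega * f₃, omega * f₁; f₁, f₂, f₃])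
    {X₀ X₁ : Matrix (Fin 3) (Fin 3) ℂ}
    (hX₁ : X₁ = (27 / 2 : ℂ) • Matrix.diagonal (fun i => J i ^ 2))
    (hX₀ : X₀ = (3 * y : ℂ) • Matrix.diagonal J)
    (h : b * X₁ - X₁ * b - (a * X₁ - X₁ * a) * a + (a * X₀ - X₀ * a) = 0) :
    ((3 : ℂ) • (diagonal J * b - b * diagonal J +
      (a * diagonal J - diagonal J * a) * a)) 2 1 =
      9 * f₁ ^ 2 + 2 / 3 * y * (omega ^ 2 - omega) * f₂ := by
  have h21 := congr_fun (congr_fun h 2) 1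
  have a01 : a 0 1 = omega ^ 2 * f₁ := by rw [ha]; rfl
  have a11 : a 1 1 = omega * f₃ := by rw [ha]; rfl
  have a20 : a 2 0 = f₁ := by rw [ha]; rfl
  have a21 : a 2 1 = f₂ := by rw [ha]; rfl
  have a22 : a 2 2 = f₃ := by rw [ha]; rfl
  have j0 : J 0 = omega := rfl
  have j1 : J 1 = omega ^ 2 := rfl
  have j2 : J 2 = 1 := rfl
  have hw := omega_sq_add
  rw [hX₁, hX₀] at h21
  simp only [Matrix.mul_smul, Matrix.smul_mul, ← smul_sub, Matrix.add_apply, Matrix.smul_apply,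
    commutator_mul_apply, Matrix.sub_apply, Matrix.zero_apply,
    Matrix.mul_diagonal, Matrix.diagonal_mul, smul_eq_mul,
    Fin.sum_univ_three, a01, a11, a20, a21, a22, j0, j1, j2] at h21 ⊢
  -- `h21` gives the entry `b 2 1`, and `ω² + ω + 1 = 0` is the only other relation needed.
  generalize omega = w at *
  clear ha hX₁ hX₀ h a01 a11 a20 a21 a22 j0 j1 j2
  grind

end Symmetry


/-! ### The Painlevé IV equation -/

section Painleve

lemma omega_sq_sub : omega ^ 2 - omega = -(√3 * Complex.I) := by
  have h := omega_sq_add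
  rw [show omega ^ 2 - omega = -1 - 2 * omega by linear_combination h, omega_eq]
  ring

/-- Solutions of the first order system for the real and imaginary part of `φ₂` are smooth. -/
lemma contDiffOn_of_system {Y : Set ℝ} (hY : IsOpen Y) {p q : ℝ → ℝ}
    (hp : ∀ y ∈ Y, HasDerivAt p (9 * (p y ^ 2 - q y ^ 2) + 2 / 3 * √3 * y * q y) y)
    (hq : ∀ y ∈ Y, HasDerivAt q (-18 * p y * q y - 2 / 3 * √3 * y * p y) y) (n : ℕ) :
    ContDiffOn ℝ n p Y ∧ ContDiffOn ℝ n q Y := by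
  have dp : DifferentiableOn ℝ p Y := fun y hy => (hp y hy).differentiableAt.differentiableWithinAt
  have dq : DifferentiableOn ℝ q Y := fun y hy => (hq y hy).differentiableAt.differentiableWithinAt
  induction n with
  | zero =>
    rw [Nat.cast_zero, contDiffOn_zero, contDiffOn_zero]
    exact ⟨dp.continuousOn, dq.continuousOn⟩
  | succ n ih =>
    obtain ⟨ip, iq⟩ := ih
    rw [Nat.cast_succ, contDiffOn_succ_iff_deriv_of_isOpen hY,
      contDiffOn_succ_iff_deriv_of_isOpen hY]
    refine ⟨⟨dp, by simp, ContDiffOn.congr ?_ fun y hy => (hp y hy).deriv⟩,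
      ⟨dq, by simp, ContDiffOn.congr ?_ fun y hy => (hq y hy).deriv⟩⟩
    · exact (contDiffOn_const.mul ((ip.pow 2).sub (iq.pow 2))).add
        ((contDiffOn_const.mul contDiffOn_id).mul iq)
    · exact ((contDiffOn_const.mul ip).mul iq).sub ((contDiffOn_const.mul contDiffOn_id).mul ip)

/-- The first order system turns into the Painlevé IV equation for `P = -6√3 q - 2y/3`. -/
theorem solvesPIV_of_system {Y : Set ℝ} (hY : IsOpen Y) {p q : ℝ → ℝ}
    (hp : ∀ y ∈ Y, HasDerivAt p (9 * (p y ^ 2 - q y ^ 2) + 2 / 3 * √3 * y * q y) y)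
    (hq : ∀ y ∈ Y, HasDerivAt q (-18 * p y * q y - 2 / 3 * √3 * y * p y) y) {P : ℝ → ℝ}
    (hP : ∀ y, P y = -(6 * √3) * q y - 2 / 3 * y) :
    SolvesPIV (-1 / 6) (-2 / 3) Y P ∧ ∀ y ∈ Y, 18 * P y * p y = -(deriv P y + 2 / 3) := by
  have h3 : √3 ^ 2 = 3 := Real.sq_sqrt (by norm_num)
  have hP' : P = fun y => -(6 * √3) * q y - 2 / 3 * y := funext hP
  have hd : ∀ y ∈ Y, HasDerivAt P (-18 * (P y * p y) - 2 / 3) y := by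
    intro y hy
    have h := ((hq y hy).const_mul (-(6 * √3))).sub ((hasDerivAt_id y).const_mul (2 / 3))
    rw [hP']
    refine h.congr_deriv ?_
    linear_combination (4 * y * p y) * h3
  have hrel : ∀ y ∈ Y, 18 * P y * p y = -(deriv P y + 2 / 3) := by
    intro y hy
    rw [(hd y hy).deriv]; ring
  refine ⟨⟨?_, ?_, ?_⟩, hrel⟩
  · rw [hP']
    exact (contDiffOn_const.mul (contDiffOn_of_system hY hp hq 2).2).sub
      (contDiffOn_const.mul contDiffOn_id)
  · intro y hy hP0
    have h1 := (hd y hy).deriv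
    have h2 : deriv (deriv P) y = -18 * ((-18 * (P y * p y) - 2 / 3) * p y +
        P y * (9 * (p y ^ 2 - q y ^ 2) + 2 / 3 * √3 * y * q y)) := by
      have he : deriv P =ᶠ[𝓝 y] fun y => -18 * (P y * p y) - 2 / 3 := by
        filter_upwards [hY.mem_nhds hy] with x hx using (hd x hx).deriv
      rw [he.deriv_eq]
      exact ((((hd y hy).mul (hp y hy)).const_mul (-18)).sub_const (2 / 3)).deriv
    have hq1 : 6 * √3 * q y = -(P y) - 2 / 3 * y := by rw [hP y]; ring
    have hq2 : 108 * q y ^ 2 = (P y + 2 / 3 * y) ^ 2 := by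
      linear_combination (-36 * q y ^ 2) * h3 + (6 * √3 * q y - P y - 2 / 3 * y) * hq1
    rw [h2, h1]
    -- `q` enters through `q²` and `√3 q`, and both are polynomials in `P` and `y`
    field_simp
    linear_combination (162 * P y ^ 2) * hq2 - (216 * y * P y ^ 2) * hq1
  · intro y hy hP0
    rw [(hd y hy).deriv, hP0]
    norm_num

end Painleve

section Existence

open scoped Matrix.Norms.Operator

/-- The coefficients of the expansion, and the equation in `y` for the entry `φ₂` of the first
one. -/
theorem exists_coefficients {s₁ s₃ : ℂ}
    (hs : stokes s₁ s₃ 0 * stokes s₁ s₃ 1 * stokes s₁ s₃ 2 *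
      stokes s₁ s₃ 3 * stokes s₁ s₃ 4 * stokes s₁ s₃ 5 = 1)
    {Y : Set ℝ} (hY : IsOpen Y) {m : ℝ → ℂ → Matrix (Fin 3) (Fin 3) ℂ}
    (hm : ∀ y ∈ Y, IsSolution s₁ s₃ y (m y)) :
    ∃ c : ℕ → ℝ → Matrix (Fin 3) (Fin 3) ℂ,
      (∀ y ∈ Y, ∀ N : ℕ, ∃ C : ℝ, ∀ z ∉ contour, ∀ i k,
        ‖(m y z - (1 + ∑ j ∈ Finset.Icc 1 N, (z ^ j)⁻¹ • c j y)) i k‖ ≤ C * ‖(z ^ (N + 1))⁻¹‖) ∧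
      ∃ (φ : ℝ → ℂ) (φ₃ : ℝ → ℝ),
        (∀ y ∈ Y, c 1 y =
          !![omega ^ 2 * φ₃ y, omega ^ 2 * (starRingEnd ℂ) (φ y), omega ^ 2 * φ y;
             omega * φ y, omega * φ₃ y, omega * (starRingEnd ℂ) (φ y);
             (starRingEnd ℂ) (φ y), φ y, (φ₃ y : ℂ)]) ∧
        ∀ y ∈ Y, HasDerivAt φ
          (9 * (starRingEnd ℂ) (φ y) ^ 2 + 2 / 3 * y * (omega ^ 2 - omega) * φ y) y := by
  classical
  have hex : ∀ y, ∃ M : Fin 6 → ℂ → Matrix (Fin 3) (Fin 3) ℂ, y ∈ Y →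
      SolutionPieces s₁ s₃ y M ∧ ∀ k, ∀ z ∈ openSector k, m y z = M k z := by
    intro y
    by_cases hy : y ∈ Y
    · obtain ⟨M, hM⟩ := (hm y hy).exists_pieces hs
      exact ⟨M, fun _ => hM⟩
    · exact ⟨0, fun h => absurd h hy⟩
  choose M hM using hex
  have hform : ∀ y ∈ Y, _ := fun y hy => eq_of_symmetries
    ((hm y hy).matA_mul_coef_one (hM y hy).1 (hM y hy).2)
    ((hm y hy).coef_one_eq_conj (hM y hy).1 (hM y hy).2)
  refine ⟨fun n y => coef (M y) n, fun y hy N => ?_, fun y => coef (M y) 1 2 1,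
    fun y => (coef (M y) 1 2 2).re, hform, fun y hy => ?_⟩
  · obtain ⟨C, -, hC⟩ := SolutionPieces.exists_expansion_of_eq (hM y hy).1 (hM y hy).2 N
    exact ⟨C, fun z hz i k => (norm_entry_le _ i k).trans (hC z hz)⟩
  · have h := hasDerivAt_coef_one hY (fun y hy => (hM y hy).1) hy 2 1
    rwa [evolution_entry (hform y hy) rfl rfl ((hM y hy).1.coef_relation rfl rfl rfl rfl)] at h

end Existence

end PIVModel

theorem lemmaA1 (s₁ s₃ : ℂ)
    (hs : PIVModel.stokes s₁ s₃ 0 * PIVModel.stokes s₁ s₃ 1 * PIVModel.stokes s₁ s₃ 2 *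
      PIVModel.stokes s₁ s₃ 3 * PIVModel.stokes s₁ s₃ 4 * PIVModel.stokes s₁ s₃ 5 = 1)
    (Y : Set ℝ) (hY : IsOpen Y) (m : ℝ → ℂ → Matrix (Fin 3) (Fin 3) ℂ)
    (hm : ∀ y ∈ Y, PIVModel.IsSolution s₁ s₃ y (m y)) :
    ∃ c : ℕ → ℝ → Matrix (Fin 3) (Fin 3) ℂ,
      (∀ y ∈ Y, ∀ N : ℕ, 1 ≤ N → ∀ i k,
        (fun z : ℂ => (m y z - (1 + ∑ j ∈ Finset.Icc 1 N, (z ^ j)⁻¹ • c j y)) i k)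
          =O[cobounded ℂ ⊓ 𝓟 PIVModel.contourᶜ] (fun z : ℂ => (z ^ (N + 1))⁻¹)) ∧
      ∃ (φ₁ φ₂ : ℝ → ℂ) (φ₃ P : ℝ → ℝ),
        (∀ y ∈ Y, φ₁ y = (starRingEnd ℂ) (φ₂ y)) ∧
        (∀ y ∈ Y, c 1 y =
          !![PIVModel.omega ^ 2 * φ₃ y, PIVModel.omega ^ 2 * φ₁ y, PIVModel.omega ^ 2 * φ₂ y;
             PIVModel.omega * φ₂ y, PIVModel.omega * φ₃ y, PIVModel.omega * φ₁ y;
             φ₁ y, φ₂ y, (φ₃ y : ℂ)]) ∧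
        PIVModel.SolvesPIV (-1 / 6) (-2 / 3) Y P ∧
        (∀ y ∈ Y, (φ₂ y).im = -(P y + 2 * y / 3) / (6 * √3)) ∧
        (∀ y ∈ Y, 18 * P y * (φ₂ y).re = -(deriv P y + 2 / 3)) := by
  obtain ⟨c, hc, φ, φ₃, hform, hφd⟩ := PIVModel.exists_coefficients hs hY hm
  have hp : ∀ y ∈ Y, HasDerivAt (fun y => (φ y).re)
      (9 * ((φ y).re ^ 2 - (φ y).im ^ 2) + 2 / 3 * √3 * y * (φ y).im) y := by
    intro y hy
    refine (Complex.reCLM.hasFDerivAt.comp_hasDerivAt y (hφd y hy)).congr_deriv ?_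
    rw [PIVModel.omega_sq_sub]
    simp [sq]
    left
    ring
  have hq : ∀ y ∈ Y, HasDerivAt (fun y => (φ y).im)
      (-18 * (φ y).re * (φ y).im - 2 / 3 * √3 * y * (φ y).re) y := by
    intro y hy
    refine (Complex.imCLM.hasFDerivAt.comp_hasDerivAt y (hφd y hy)).congr_deriv ?_
    rw [PIVModel.omega_sq_sub]
    simp [sq]
    ring
  obtain ⟨hPIV, hrel⟩ := PIVModel.solvesPIV_of_system hY hp hq
    (P := fun y => -(6 * √3) * (φ y).im - 2 / 3 * y) fun _ => rfl
  refine ⟨c, fun y hy N _ i k => ?_, fun y => (starRingEnd ℂ) (φ y), φ, φ₃, _, fun _ _ => rfl,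
    hform, hPIV, fun y _ => ?_, hrel⟩
  · obtain ⟨C, hC⟩ := hc y hy N
    refine IsBigO.of_bound C ?_
    rw [eventually_inf_principal]
    exact Eventually.of_forall fun z hz => hC z hz i k
  · have h3 : √3 ≠ 0 := by positivity
    field_simp
    ring
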